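/- Let $d\ge 1$, let $B\subset\mathbb C^d$ be an open Euclidean ball of radius $R>0$, and let $0<r<1$. Let $\mathcal I$ be a countable index set. For each $i\in\mathcal I$ let $w_i:B\to\mathbb C$ be holomorphic, with $\sum_{i\in\mathcal I}\sup_{z\in B}|w_i(z)|<\infty$, and let $T_i:B\to B$ be holomorphic, with $\bigcup_{i\in\mathcal I}T_i(B)$ contained in the (closed) ball concentric with $B$ of radius $rR$. Put $W:=\sup_{z\in B}\sum_{i\in\mathcal I}|w_i(z)|$. Let $\sigma$ be the $(2d-1)$-dimensional Lebesgue measure on $\partial B$, normalised so that $\sigma(\partial B)=1$, and let the Hardy space $H^2(B)$ be the closure in $L^2(\partial B,\sigma)$ of the set of (boundary values of) functions that are holomorphic on $B$ and continuous on $\overline B$; each $f\in H^2(B)$ has a natural holomorphic extension to $B$, namely the pointwise limit on $B$ of any sequence of such functions whose boundary values converge to $f$ in $L^2(\partial B,\sigma)$. Then the transfer operator $\mathcal Lf=\sum_{i\in\mathcal I}w_i\cdot f\circ T_i$ (an identity between holomorphic extensions to $B$) is a well-defined compact linear operator $\mathcal L:H^2(B)\to H^2(B)$. Let $(\lambda_n)_{n\ge1}$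 be its eigenvalues, counted with algebraic multiplicity and ordered by decreasing modulus (continued by zeros if there are only finitely many nonzero eigenvalues; eigenvalues of the same modulus may be written in any order). If the $w_i$ do not all vanish identically on $B$, then $$|\lambda_n| < \frac{W\sqrt d}{r^d(1-r^2)^{d/2}}\; n^{(d-1)/(2d)}\; r^{\frac{d}{d+1}(d!)^{1/d}n^{1/d}}\qquad\text{for all } n\ge1,$$ and in any case this holds with $\le$ in place of $<$. If $d=1$, then moreover $$|\lambda_n|\le \frac{W}{\sqrt{1-r^2}}\; r^{(n-1)/2}\qquad\text{for all } n\ge1 .$$ -/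

import Mathlib

open MeasureTheory Metric Filter Topology
open scoped ENNReal

noncomputable section

/-- `ℂ^d` with the Euclidean norm. -/
abbrev Cd (d : ℕ) : Type := EuclideanSpace ℂ (Fin d)

/-- The rotation-invariant `(2d-1)`-dimensional Lebesgue measure on the boundary sphere of the ball
with centre `c` and radius `R`, normalised to have total mass `1` (for `1 ≤ d`, `0 < R`). It is
regarded as a measure on `ℂ^d` that is concentrated on the sphere: the normalised surface measure
of the unit sphere is transported by `x ↦ c + R x`. -/
def sphereMeasure {d : ℕ} (c : Cd d) (R : ℝ) : Measure (Cd d) :=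
  (((volume : Measure (Cd d)).toSphere Set.univ)⁻¹ • (volume : Measure (Cd d)).toSphere).map
    (fun x : sphere (0 : Cd d) 1 => c + R • (x : Cd d))

/-- Classes in `L²(∂B, σ)` of boundary values of functions that are holomorphic on the open ball
`B = ball c R` and continuous on its closure. -/
def ballAlgebraBoundary {d : ℕ} (c : Cd d) (R : ℝ) :
    Submodule ℂ (Lp ℂ 2 (sphereMeasure c R)) where
  carrier := {f | ∃ u : Cd d → ℂ, DiffContOnCl ℂ u (ball c R) ∧ f =ᵐ[sphereMeasure c R] u}
  zero_mem' := ⟨0, diffContOnCl_const, Lp.coeFn_zero _ _ _⟩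
  add_mem' := by
    rintro f g ⟨u, hu, hfu⟩ ⟨v, hv, hgv⟩
    exact ⟨u + v, hu.add hv, (Lp.coeFn_add f g).trans (hfu.add hgv)⟩
  smul_mem' := by
    rintro a f ⟨u, hu, hfu⟩
    exact ⟨a • u, hu.const_smul a, (Lp.coeFn_smul a f).trans (hfu.const_smul a)⟩

/-- The Hardy space `H²(B)` of the ball `B = ball c R`: the closure of the above in
`L²(∂B, σ)`. -/
abbrev HardySpace {d : ℕ} (c : Cd d) (R : ℝ) : Submodule ℂ (Lp ℂ 2 (sphereMeasure c R)) :=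
  (ballAlgebraBoundary c R).topologicalClosure

/-- `F` is, on `B = ball c R`, the natural holomorphic extension of `f ∈ L²(∂B, σ)`: it is
holomorphic on `B`, and some sequence of functions holomorphic on `B` and continuous on the closure
converges to `f` in `L²(∂B, σ)` and to `F` pointwise on `B`. Values of `F` outside `B` are
irrelevant. -/
def IsHolomorphicExtension {d : ℕ} (c : Cd d) (R : ℝ) (f : Lp ℂ 2 (sphereMeasure c R))
    (F : Cd d → ℂ) : Prop :=
  DifferentiableOn ℂ F (ball c R) ∧
    ∃ u : ℕ → Cd d → ℂ, (∀ n, DiffContOnCl ℂ (u n) (ball c R)) ∧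
      Tendsto (fun n => eLpNorm (fun z => u n z - f z) 2 (sphereMeasure c R)) atTop (𝓝 0) ∧
      ∀ z ∈ ball c R, Tendsto (fun n => u n z) atTop (𝓝 (F z))

/-- `L : H²(B) → H²(B)` is the transfer operator `f ↦ ∑ i, w i · (f ∘ T i)`: every `f ∈ H²(B)` has
a holomorphic extension to `B`, and whenever `F` is one, `∑ i, w i · (F ∘ T i)` is a holomorphic
extension of `L f`. -/
def IsTransferOperator {d : ℕ} (c : Cd d) (R : ℝ) {ι : Type*} (w : ι → Cd d → ℂ)
    (T : ι → Cd d → Cd d) (L : HardySpace c R → HardySpace c R) : Prop :=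
  ∀ f : HardySpace c R, (∃ F : Cd d → ℂ, IsHolomorphicExtension c R f F) ∧
    ∀ F : Cd d → ℂ, IsHolomorphicExtension c R f F →
      IsHolomorphicExtension c R (L f) (fun z => ∑' i, w i z * F (T i z))

/-- Algebraic multiplicity of `μ` as an eigenvalue of `A`: the dimension of the generalised
eigenspace `⋃ k, ker (A - μ)^k`, as an extended natural number (`0` if `μ` is no eigenvalue). -/
def algMultiplicity {V : Type*} [AddCommGroup V] [Module ℂ V] (A : Module.End ℂ V) (μ : ℂ) : ℕ∞ :=
  Cardinal.toENat (Module.rank ℂ (A.maxGenEigenspace μ))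

/-- `ev 0, ev 1, …` lists the eigenvalues of `A` with algebraic multiplicities, by decreasing
modulus: every nonzero `μ` occurs as often as its algebraic multiplicity says. If there are only
finitely many nonzero eigenvalues, the list is continued by zeros. -/
def IsEigenvalueSequence {V : Type*} [AddCommGroup V] [Module ℂ V] (A : Module.End ℂ V)
    (ev : ℕ → ℂ) : Prop :=
  Antitone (fun n => ‖ev n‖) ∧ ∀ μ : ℂ, μ ≠ 0 → {n | ev n = μ}.encard = algMultiplicity A μ

/-- `sup_{z ∈ B} ∑ i, |w i z|`, a supremum in `[0, ∞]` turned into a real number (it is finite as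
soon as `∑ i, sup_B |w i|` is). -/
def weightSup {d : ℕ} (c : Cd d) (R : ℝ) {ι : Type*} (w : ι → Cd d → ℂ) : ℝ :=
  (⨆ z ∈ ball c R, ∑' i, ‖w i z‖ₑ).toReal

/-- The right-hand side of the eigenvalue estimate in dimension `d`. -/
def eigenvalueBound (d : ℕ) (W r : ℝ) (n : ℕ) : ℝ :=
  W * √(d : ℝ) / (r ^ d * (1 - r ^ 2) ^ ((d : ℝ) / 2)) * (n : ℝ) ^ (((d : ℝ) - 1) / (2 * d)) *
    r ^ ((d : ℝ) / (d + 1) * (d.factorial : ℝ) ^ (1 / (d : ℝ)) * (n : ℝ) ^ (1 / (d : ℝ)))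

end

/-! Write d = e + 1. The monomials in the coordinate (z - c)/R, normalised in L²(σ), form a Hilbert
basis of H²(B). For each m the sum of the squared moduli of those of degree m is unitarily
invariant, hence constant on the unit sphere, where it equals its mean, the number of these
monomials. So it is C(m+e, e)‖y‖^(2m) (`homogKernel_eq`). By Cauchy–Schwarz, an f orthogonal to all
polynomials of degree less than m satisfies |f| ≤ √(`kernelTail e r m`) ‖f‖ on the ball of radius rR
(`norm_hardyExt_le`).

The T_i map B into that ball, so |Lf| ≤ W √(`kernelTail e r m`) ‖f‖ on B for such f. A bounded
holomorphic function on B lies in H²(B), with norm at most its supremum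
(`exists_hardyExt_eq_of_bounded`). Taking m = 0 shows that L is bounded. Letting m grow shows that L
is a norm limit of finite rank operators, hence compact. Moreover there are polynomial spaces Q_k of
dimension at most k with ‖Lf‖ ≤ s_k ‖f‖ on the complement of Q_k, where s_k is `approxBound`.

Weyl's inequality turns this into an eigenvalue estimate. An n-dimensional invariant subspace has an
orthonormal basis whose k-th vector is orthogonal to Q_k, and Hadamard's inequality bounds the
determinant of L on it by s_0⋯s_(n-1) (`norm_det_restrict_le_prod`). Sums of generalised eigenspaces
then give |λ_n|^n ≤ s_0⋯s_(n-1) (`HasWeylBound.norm_pow_le_prod`). Since s_k → 0, the same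
inequality shows that nonzero eigenvalues have finite multiplicity and accumulate only at 0, so that
an eigenvalue sequence exists.

Binomial estimates bound s_k by a power of k+1 times r^((d!(k+1))^(1/d)). In the product the
exponents add up, ∑_{k≤n} k^(1/d) > n^(1+1/d)/(1+1/d) strictly, and the n-th root is the claim. For
d = 1 one has s_k ≤ W r^k/√(1-r²), and the geometric mean of r^0, …, r^(n-1) is r^((n-1)/2). -/

/-! ### Hadamard's inequality and Weyl's multiplicative inequality -/

/-- Hadamard's inequality over `ℝ` or `ℂ`. -/
theorem OrthonormalBasis.norm_det_le_prod_norm {𝕜 E : Type*} [RCLike 𝕜] [NormedAddCommGroup E]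
    [InnerProductSpace 𝕜 E] {n : ℕ} (b : OrthonormalBasis (Fin n) 𝕜 E) (v : Fin n → E) :
    ‖b.toBasis.det v‖ ≤ ∏ i, ‖v i‖ := by
  have : FiniteDimensional 𝕜 E := b.toBasis.finiteDimensional_of_finite
  have h : Module.finrank 𝕜 E = Fintype.card (Fin n) := Module.finrank_eq_card_basis b.toBasis
  set g := InnerProductSpace.gramSchmidtOrthonormalBasis h v
  -- Change to the Gram–Schmidt basis of `v`: the first factor has modulus one, the second is the
  -- determinant of a triangular matrix with diagonal entries `inner 𝕜 (g i) (v i)`.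
  have h1 : b.toBasis.det v = b.toBasis.det g * g.toBasis.det v := by
    rw [Module.Basis.det_apply, Module.Basis.det_apply, Module.Basis.det_apply, ← Matrix.det_mul,
      ← OrthonormalBasis.coe_toBasis g, Module.Basis.toMatrix_mul_toMatrix]
  rw [h1, norm_mul, OrthonormalBasis.det_to_matrix_orthonormalBasis, one_mul,
    InnerProductSpace.gramSchmidtOrthonormalBasis_det, norm_prod]
  refine Finset.prod_le_prod (fun _ _ => norm_nonneg _) fun i _ => ?_
  refine (norm_inner_le_norm _ _).trans ?_
  simp

/-- By dimension, the orthogonal projection onto `Q` restricted to `V` has a nontrivial kernel. -/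
theorem Submodule.exists_norm_eq_one_mem_orthogonal {𝕜 E : Type*} [RCLike 𝕜]
    [NormedAddCommGroup E] [InnerProductSpace 𝕜 E] (V Q : Submodule 𝕜 E) [FiniteDimensional 𝕜 V]
    [FiniteDimensional 𝕜 Q] (h : Module.finrank 𝕜 Q < Module.finrank 𝕜 V) :
    ∃ x ∈ V, x ∈ Qᗮ ∧ ‖x‖ = 1 := by
  let f : V →ₗ[𝕜] Q := (Q.orthogonalProjectionOnto : E →ₗ[𝕜] Q) ∘ₗ V.subtype
  have hk : LinearMap.ker f ≠ ⊥ := LinearMap.ker_ne_bot_of_finrank_lt h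
  obtain ⟨x, hx, hx0⟩ := (Submodule.ne_bot_iff _).1 hk
  have hxQ : (x : E) ∈ Qᗮ := by
    have : Q.orthogonalProjectionOnto (x : E) = 0 := hx
    exact (Submodule.orthogonalProjectionOnto_eq_zero_iff).1 this
  have hx0' : (x : E) ≠ 0 := by simpa using hx0
  refine ⟨((‖(x : E)‖⁻¹ : ℝ) : 𝕜) • (x : E), V.smul_mem _ x.2, Qᗮ.smul_mem _ hxQ, ?_⟩
  rw [norm_smul]
  simp [hx0']

/-- A finite-dimensional space has an orthonormal basis whose `k`-th vector is orthogonal to a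
prescribed subspace of dimension at most `k`. -/
theorem Submodule.exists_orthonormal_mem_orthogonal {𝕜 E : Type*} [RCLike 𝕜]
    [NormedAddCommGroup E] [InnerProductSpace 𝕜 E] (Q : ℕ → Submodule 𝕜 E)
    [∀ k, FiniteDimensional 𝕜 (Q k)] (hQ : ∀ k, Module.finrank 𝕜 (Q k) ≤ k) (n : ℕ) :
    ∀ (V : Submodule 𝕜 E) [FiniteDimensional 𝕜 V], Module.finrank 𝕜 V = n →
      ∃ e : Fin n → E, Orthonormal 𝕜 e ∧ ∀ k, e k ∈ V ∧ e k ∈ (Q k)ᗮ := by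
  induction n with
  | zero => exact fun V _ _ => ⟨Fin.elim0, ⟨fun i => i.elim0, fun i => i.elim0⟩, fun i => i.elim0⟩
  | succ n ih =>
    intro V _ hV
    -- The basis is built from the last vector down: only the full space `V`, of dimension `n + 1`,
    -- is sure to contain a unit vector orthogonal to `Q n`. The induction continues in the
    -- complement of `x` in `V`.
    obtain ⟨x, hxV, hxQ, hx1⟩ := V.exists_norm_eq_one_mem_orthogonal (Q n)
      (by have := hQ n; omega)
    have hle : 𝕜 ∙ x ≤ V := (Submodule.span_singleton_le_iff_mem _ _).2 hxV
    have hx0 : x ≠ 0 := by rintro rfl; simp at hx1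
    have hfin := Submodule.finrank_add_inf_finrank_orthogonal hle
    rw [finrank_span_singleton hx0, hV] at hfin
    obtain ⟨e, he, hek⟩ := ih ((𝕜 ∙ x)ᗮ ⊓ V) (by omega)
    have hin : ∀ k, inner 𝕜 x (e k) = 0 := fun k =>
      Submodule.mem_orthogonal_singleton_iff_inner_right.1 (hek k).1.1
    have hin' : ∀ k, inner 𝕜 (e k) x = 0 := fun k => inner_eq_zero_symm.1 (hin k)
    refine ⟨Fin.snoc (α := fun _ => E) e x, ⟨?_, ?_⟩, ?_⟩
    · intro i
      refine Fin.lastCases ?_ (fun j => ?_) i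
      · simpa using hx1
      · simpa using he.1 j
    · intro i j
      refine Fin.lastCases ?_ (fun i' => ?_) i <;> refine Fin.lastCases ?_ (fun j' => ?_) j
      · simp
      · simp [hin]
      · simp [hin']
      · intro hij
        simpa using he.2 (fun h => hij (by rw [h]))
    · intro i
      refine Fin.lastCases ?_ (fun j => ?_) i
      · simpa using ⟨hxV, hxQ⟩
      · simpa using ⟨(hek j).1.2, (hek j).2⟩

/-- A form of Weyl's multiplicative inequality. -/
theorem norm_det_restrict_le_prod {𝕜 E : Type*} [RCLike 𝕜] [NormedAddCommGroup E]
    [InnerProductSpace 𝕜 E] (A : Module.End 𝕜 E) (Q : ℕ → Submodule 𝕜 E)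
    [∀ k, FiniteDimensional 𝕜 (Q k)] (hQ : ∀ k, Module.finrank 𝕜 (Q k) ≤ k) (s : ℕ → ℝ)
    (hs : ∀ k, ∀ x ∈ (Q k)ᗮ, ‖A x‖ ≤ s k * ‖x‖) (V : Submodule 𝕜 E) [FiniteDimensional 𝕜 V]
    (hV : ∀ x ∈ V, A x ∈ V) :
    ‖LinearMap.det (A.restrict hV)‖ ≤ ∏ k ∈ Finset.range (Module.finrank 𝕜 V), s k := by
  -- In this basis the k-th column `A (e k)` has norm at most `s k`, since `e k` is orthogonal to `Q
  -- k`; Hadamard's inequality then bounds the determinant.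
  obtain ⟨e, he, hek⟩ := Submodule.exists_orthonormal_mem_orthogonal Q hQ _ V rfl
  let e' : Fin (Module.finrank 𝕜 V) → V := fun k => ⟨e k, (hek k).1⟩
  have he' : Orthonormal 𝕜 e' := by
    refine ⟨fun i => he.1 i, fun i j hij => he.2 hij⟩
  let b : OrthonormalBasis (Fin (Module.finrank 𝕜 V)) 𝕜 V :=
    OrthonormalBasis.mk he' (by
      rw [LinearIndependent.span_eq_top_of_card_eq_finrank' he'.linearIndependent (by simp)])
  have hb : ∀ i, (b i : E) = e i := fun i => by simp [b, e']
  have hdet : LinearMap.det (A.restrict hV) = b.toBasis.det (fun i => A.restrict hV (b i)) := by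
    rw [← LinearMap.det_toMatrix b.toBasis, Module.Basis.det_apply]
    congr 1
    ext i j
    simp [LinearMap.toMatrix_apply, Module.Basis.toMatrix_apply]
  rw [hdet, ← Fin.prod_univ_eq_prod_range]
  refine (b.norm_det_le_prod_norm _).trans ?_
  refine Finset.prod_le_prod (fun _ _ => norm_nonneg _) fun i _ => ?_
  have := hs i (e i) (hek i).2
  rw [he.1 i, mul_one] at this
  simpa [hb, Submodule.coe_norm] using this

/-! ### Spectral consequences of Weyl's inequality -/

/-- Every finite-dimensional `A`-invariant subspace all of whose eigenvalues have modulus at least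
`t` has, with `N` denoting its dimension, `t ^ N ≤ s 0 * ⋯ * s (N - 1)`. -/
def HasWeylBound {V : Type*} [AddCommGroup V] [Module ℂ V] (A : Module.End ℂ V) (s : ℕ → ℝ) :
    Prop :=
  ∀ (U : Submodule ℂ V) [FiniteDimensional ℂ U], (∀ x ∈ U, A x ∈ U) → ∀ t : ℝ, 0 ≤ t →
    (∀ μ : ℂ, ∀ x ∈ U, x ≠ 0 → A x = μ • x → t ≤ ‖μ‖) →
      t ^ Module.finrank ℂ U ≤ ∏ k ∈ Finset.range (Module.finrank ℂ U), s k

/-- The determinant is the product of the roots of the characteristic polynomial, and their number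
with multiplicity is the dimension. -/
theorem pow_finrank_le_norm_det {V : Type*} [AddCommGroup V] [Module ℂ V] [FiniteDimensional ℂ V]
    (A : Module.End ℂ V) (t : ℝ) (ht : 0 ≤ t) (h : ∀ μ, A.HasEigenvalue μ → t ≤ ‖μ‖) :
    t ^ Module.finrank ℂ V ≤ ‖LinearMap.det A‖ := by
  have hs : A.charpoly.Splits := IsAlgClosed.splits _
  rw [Module.End.det_eq_prod_roots_charpoly_of_splits hs, ← LinearMap.charpoly_natDegree A,
    hs.natDegree_eq_card_roots]
  have key : ∀ m : Multiset ℂ, (∀ μ ∈ m, t ≤ ‖μ‖) → t ^ m.card ≤ ‖m.prod‖ := by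
    intro m
    induction m using Multiset.induction_on with
    | empty => simp
    | cons a m ih =>
      intro hm
      rw [Multiset.card_cons, Multiset.prod_cons, norm_mul, pow_succ']
      exact mul_le_mul (hm a (by simp)) (ih fun μ hμ => hm μ (by simp [hμ])) (by positivity)
        (norm_nonneg _)
  refine key _ fun μ hμ => h μ ?_
  rw [Module.End.hasEigenvalue_iff_isRoot_charpoly]
  exact (Polynomial.mem_roots'.1 hμ).2

/-- This is where the Hilbert space structure enters; the spectral lemmas below use only
`HasWeylBound`. -/
theorem hasWeylBound_of_norm_le {E : Type*} [NormedAddCommGroup E]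
    [InnerProductSpace ℂ E] (A : Module.End ℂ E) (Q : ℕ → Submodule ℂ E)
    [∀ k, FiniteDimensional ℂ (Q k)] (hQ : ∀ k, Module.finrank ℂ (Q k) ≤ k) (s : ℕ → ℝ)
    (hs : ∀ k, ∀ x ∈ (Q k)ᗮ, ‖A x‖ ≤ s k * ‖x‖) : HasWeylBound A s := by
  intro U _ hU t ht h
  refine le_trans (pow_finrank_le_norm_det (A.restrict hU) t ht fun μ hμ => ?_)
    (norm_det_restrict_le_prod A Q hQ s hs U hU)
  obtain ⟨x, hx⟩ := hμ.exists_hasEigenvector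
  refine h μ x x.2 (by simpa using hx.2) ?_
  have := hx.apply_eq_smul
  simpa using congrArg Subtype.val this

section

variable {V : Type*} [AddCommGroup V] [Module ℂ V] {A : Module.End ℂ V} {s : ℕ → ℝ}

/-- Generalised eigenspaces are independent, so an eigenvector for an eigenvalue outside `S` cannot
lie in their sum over `S`. -/
theorem mem_of_apply_eq_smul_of_mem_iSup (S : Finset ℂ) {x : V}
    (hx : x ∈ ⨆ μ ∈ S, A.maxGenEigenspace μ) (hx0 : x ≠ 0) {ν : ℂ} (hν : A x = ν • x) :
    ν ∈ S := by
  by_contra hn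
  have hd := A.independent_maxGenEigenspace ν
  refine hx0 (Submodule.disjoint_def.1 hd x ?_ ?_)
  · exact Module.End.eigenspace_le_maxGenEigenspace (Module.End.mem_eigenspace_iff.2 hν)
  · have hle : (⨆ μ ∈ S, A.maxGenEigenspace μ : Submodule ℂ V) ≤
        ⨆ μ, ⨆ (_ : μ ≠ ν), A.maxGenEigenspace μ :=
      iSup₂_le fun μ hμ => le_iSup₂_of_le μ (by rintro rfl; exact hn hμ) le_rfl
    exact hle hx

/-- From some index `K` on, `s` is below t/2. In dimension K + M + j the Weyl bound then forces
2^(M+j) t^K ≤ s_0⋯s_(K-1), which the choice of `M` excludes. -/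
theorem HasWeylBound.exists_finrank_le (h : HasWeylBound A s) (hs0 : ∀ k, 0 ≤ s k)
    (hs : Tendsto s atTop (𝓝 0)) (t : ℝ) (ht : 0 < t) :
    ∃ N : ℕ, ∀ (U : Submodule ℂ V) [FiniteDimensional ℂ U], (∀ x ∈ U, A x ∈ U) →
      (∀ μ : ℂ, ∀ x ∈ U, x ≠ 0 → A x = μ • x → t ≤ ‖μ‖) → Module.finrank ℂ U ≤ N := by
  obtain ⟨K, hK⟩ := eventually_atTop.1 (hs.eventually (gt_mem_nhds (half_pos ht)))
  obtain ⟨M, hM⟩ := pow_unbounded_of_one_lt ((∏ k ∈ Finset.range K, s k) / t ^ K) one_lt_two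
  refine ⟨K + M, fun U _ hU hUt => ?_⟩
  by_contra! hlt
  obtain ⟨j, hj⟩ := Nat.exists_eq_add_of_le hlt.le
  have h1 := h U hU t ht.le hUt
  rw [hj, add_assoc, Finset.prod_range_add] at h1
  have h2 : ∏ x ∈ Finset.range (M + j), s (K + x) ≤ (t / 2) ^ (M + j) := by
    refine (Finset.prod_le_prod (fun _ _ => hs0 _) fun i _ => (hK (K + i) (by omega)).le).trans ?_
    rw [Finset.prod_const, Finset.card_range]
  have h3 : 0 ≤ ∏ k ∈ Finset.range K, s k := Finset.prod_nonneg fun _ _ => hs0 _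
  have h4 := h1.trans (mul_le_mul_of_nonneg_left h2 h3)
  rw [div_lt_iff₀ (by positivity)] at hM
  have h5 : (2 : ℝ) ^ M ≤ 2 ^ (M + j) := pow_le_pow_right₀ (by norm_num) (by omega)
  have h6 : ∏ k ∈ Finset.range K, s k < 2 ^ (M + j) * t ^ K :=
    hM.trans_le (mul_le_mul_of_nonneg_right h5 (by positivity))
  have h7 : (∏ k ∈ Finset.range K, s k) * (t / 2) ^ (M + j) <
      2 ^ (M + j) * t ^ K * (t / 2) ^ (M + j) := mul_lt_mul_of_pos_right h6 (by positivity)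
  have h8 : 2 ^ (M + j) * t ^ K * (t / 2) ^ (M + j) = t ^ (K + (M + j)) := by
    rw [div_pow, pow_add t K]
    field_simp
  linarith

/-- A single power of `A - μ` kills the finite set `S`, so the images of its span under the lower
powers already span an invariant space. This makes `HasWeylBound`, which concerns finite-dimensional
subspaces, applicable before a generalised eigenspace is known to be finite-dimensional. -/
theorem exists_invariant_of_finset_maxGenEigenspace (A : Module.End ℂ V) (μ : ℂ) (S : Finset V)
    (hS : ∀ x ∈ S, x ∈ A.maxGenEigenspace μ) :
    ∃ U : Submodule ℂ V, FiniteDimensional ℂ U ∧ (∀ x ∈ U, A x ∈ U) ∧ (∀ x ∈ S, x ∈ U) ∧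
      U ≤ A.maxGenEigenspace μ := by
  have hex : ∃ k : ℕ, ∀ x ∈ S, ((A - algebraMap ℂ _ μ) ^ k) x = 0 := by
    have : ∀ x ∈ S, ∃ k : ℕ, ((A - algebraMap ℂ _ μ) ^ k) x = 0 := fun x hx => by
      simpa [Algebra.algebraMap_eq_smul_one] using (Module.End.mem_maxGenEigenspace _ _ _).1 (hS x hx)
    choose! k hk using this
    refine ⟨S.sup k, fun x hx => ?_⟩
    obtain ⟨j, hj⟩ := Nat.exists_eq_add_of_le (Finset.le_sup (f := k) hx)
    rw [hj, add_comm, pow_add, Module.End.mul_apply, hk x hx, map_zero]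
  obtain ⟨k, hk⟩ := hex
  set B := A - algebraMap ℂ (Module.End ℂ V) μ with hB
  have hk' : ∀ x ∈ Submodule.span ℂ (S : Set V), (B ^ k) x = 0 := by
    intro x hx
    have : Submodule.span ℂ (S : Set V) ≤ LinearMap.ker (B ^ k) :=
      Submodule.span_le.2 fun x hx => hk x hx
    exact this hx
  set U : Submodule ℂ V :=
    ⨆ j : Fin (k + 1), (Submodule.span ℂ (S : Set V)).map (B ^ (j : ℕ)) with hU
  have hmem : ∀ j : ℕ, ∀ x ∈ Submodule.span ℂ (S : Set V), (B ^ j) x ∈ U := by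
    intro j x hx
    by_cases hj : j < k + 1
    · exact Submodule.mem_iSup_of_mem (⟨j, hj⟩ : Fin (k + 1)) (Submodule.mem_map_of_mem hx)
    · obtain ⟨i, rfl⟩ := Nat.exists_eq_add_of_le (show k ≤ j by omega)
      rw [add_comm, pow_add, Module.End.mul_apply, hk' x hx, map_zero]
      exact U.zero_mem
  have hBU : ∀ x ∈ U, B x ∈ U := by
    intro x hx
    refine Submodule.iSup_induction _ (motive := fun x => B x ∈ U) hx ?_ (by simp) ?_
    · rintro j _ ⟨y, hy, rfl⟩
      have := hmem (j + 1) y hy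
      rwa [pow_succ', Module.End.mul_apply] at this
    · intro y z hy hz
      rw [map_add]
      exact U.add_mem hy hz
  refine ⟨U, ?_, ?_, ?_, ?_⟩
  · have : FiniteDimensional ℂ (Submodule.span ℂ (S : Set V)) :=
      FiniteDimensional.span_finset ℂ S
    exact Submodule.finiteDimensional_iSup _
  · intro x hx
    have : A x = B x + μ • x := by simp [hB, Algebra.algebraMap_eq_smul_one]
    rw [this]
    exact U.add_mem (hBU x hx) (U.smul_mem _ hx)
  · intro x hx
    simpa using hmem 0 x (Submodule.subset_span hx)
  · refine iSup_le fun j => ?_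
    rintro _ ⟨y, hy, rfl⟩
    rw [Module.End.mem_maxGenEigenspace]
    refine ⟨k, ?_⟩
    have : A - μ • (1 : Module.End ℂ V) = B := by rw [hB, Algebra.algebraMap_eq_smul_one]
    rw [this, ← Module.End.mul_apply, ← pow_add, add_comm, pow_add, Module.End.mul_apply,
      hk' y hy, map_zero]

/-- Any finite independent family in the generalised eigenspace sits in a finite-dimensional
invariant subspace with no eigenvalue other than `μ`, so its size is bounded by `exists_finrank_le`.
-/
theorem HasWeylBound.finiteDimensional_maxGenEigenspace (h : HasWeylBound A s)
    (hs0 : ∀ k, 0 ≤ s k) (hs : Tendsto s atTop (𝓝 0)) {μ : ℂ} (hμ : μ ≠ 0) :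
    FiniteDimensional ℂ (A.maxGenEigenspace μ) := by
  obtain ⟨N, hN⟩ := h.exists_finrank_le hs0 hs ‖μ‖ (norm_pos_iff.2 hμ)
  have hr : Module.rank ℂ (A.maxGenEigenspace μ) ≤ N := by
    refine rank_le fun S hS => ?_
    obtain ⟨U, hUf, hUA, hSU, hU⟩ := exists_invariant_of_finset_maxGenEigenspace A μ
      (S.map (Function.Embedding.subtype _)) (by simp +contextual)
    have hlin : LinearIndependent ℂ (fun i : S => ((i : A.maxGenEigenspace μ) : V)) :=
      hS.map' (A.maxGenEigenspace μ).subtype (Submodule.ker_subtype _)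
    have hlin' : LinearIndependent ℂ (fun i : S => (⟨(i : A.maxGenEigenspace μ), hSU _ (by
        simp)⟩ : U)) :=
      LinearIndependent.of_comp U.subtype hlin
    have h1 := hlin'.fintype_card_le_finrank
    refine le_trans (by simpa using h1) (hN U hUA fun ν x hx hx0 hν => ?_)
    have := mem_of_apply_eq_smul_of_mem_iSup (A := A) {μ} (x := x) (by simpa using hU hx) hx0 hν
    rw [Finset.mem_singleton.1 this]
  exact Module.rank_lt_aleph0_iff.1 (hr.trans_lt (Cardinal.natCast_lt_aleph0))

theorem finrank_iSup_maxGenEigenspace (A : Module.End ℂ V) (S : Finset ℂ)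
    (hS : ∀ μ ∈ S, FiniteDimensional ℂ (A.maxGenEigenspace μ)) :
    FiniteDimensional ℂ (⨆ μ ∈ S, A.maxGenEigenspace μ : Submodule ℂ V) ∧
    Module.finrank ℂ (⨆ μ ∈ S, A.maxGenEigenspace μ : Submodule ℂ V) =
      ∑ μ ∈ S, Module.finrank ℂ (A.maxGenEigenspace μ) := by
  induction S using Finset.induction_on with
  | empty =>
    have : (⨆ μ ∈ (∅ : Finset ℂ), A.maxGenEigenspace μ : Submodule ℂ V) = ⊥ := by simp
    rw [this]
    exact ⟨inferInstance, by simp⟩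
  | insert a S ha ih =>
    obtain ⟨hf, hr⟩ := ih fun μ hμ => hS μ (by simp [hμ])
    have := hS a (by simp)
    rw [Finset.iSup_insert, Finset.sum_insert ha, ← hr]
    have hd : Disjoint (A.maxGenEigenspace a) (⨆ μ ∈ S, A.maxGenEigenspace μ) := by
      refine (A.independent_maxGenEigenspace a).mono_right (iSup₂_le fun μ hμ => ?_)
      exact le_iSup₂_of_le μ (by rintro rfl; exact ha hμ) le_rfl
    refine ⟨inferInstance, ?_⟩
    have h1 := Submodule.finrank_sup_add_finrank_inf_eq (A.maxGenEigenspace a)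
      (⨆ μ ∈ S, A.maxGenEigenspace μ)
    rw [hd.eq_bot, finrank_bot] at h1
    omega

theorem apply_mem_iSup_maxGenEigenspace (A : Module.End ℂ V) (S : Finset ℂ) :
    ∀ x ∈ (⨆ μ ∈ S, A.maxGenEigenspace μ : Submodule ℂ V),
      A x ∈ (⨆ μ ∈ S, A.maxGenEigenspace μ : Submodule ℂ V) := by
  have : (⨆ μ ∈ S, A.maxGenEigenspace μ : Submodule ℂ V) ≤
      (⨆ μ ∈ S, A.maxGenEigenspace μ : Submodule ℂ V).comap A := by
    refine iSup₂_le fun μ hμ x hx => ?_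
    have h1 : A x ∈ A.maxGenEigenspace μ :=
      Module.End.mapsTo_maxGenEigenspace_of_comm (Commute.refl A) μ hx
    exact (le_iSup₂_of_le μ hμ le_rfl : A.maxGenEigenspace μ ≤ _) h1
  exact this

/-- The sum of the generalised eigenspaces of `N + 1` such eigenvalues would have dimension greater
than the bound `N` of `exists_finrank_le`. -/
theorem HasWeylBound.finite_setOf_le_norm (h : HasWeylBound A s)
    (hs0 : ∀ k, 0 ≤ s k) (hs : Tendsto s atTop (𝓝 0)) {t : ℝ} (ht : 0 < t) :
    {μ : ℂ | t ≤ ‖μ‖ ∧ Module.finrank ℂ (A.maxGenEigenspace μ) ≠ 0}.Finite := by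
  obtain ⟨N, hN⟩ := h.exists_finrank_le hs0 hs t ht
  by_contra hinf
  obtain ⟨S, hS, hcard⟩ := Set.Infinite.exists_subset_card_eq hinf (N + 1)
  obtain ⟨hf, hr⟩ := finrank_iSup_maxGenEigenspace A S fun μ hμ =>
    h.finiteDimensional_maxGenEigenspace hs0 hs
      (norm_pos_iff.1 (ht.trans_le (hS hμ).1))
  have h1 := hN _ (apply_mem_iSup_maxGenEigenspace A S) fun ν x hx hx0 hν =>
    (hS (mem_of_apply_eq_smul_of_mem_iSup S hx hx0 hν)).1
  rw [hr] at h1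
  have h2 : S.card • 1 ≤ ∑ μ ∈ S, Module.finrank ℂ (A.maxGenEigenspace μ) :=
    Finset.card_nsmul_le_sum _ _ _ fun μ hμ => Nat.one_le_iff_ne_zero.2 (hS hμ).2
  simp at h2
  omega

theorem algMultiplicity_eq_finrank (A : Module.End ℂ V) (μ : ℂ)
    [FiniteDimensional ℂ (A.maxGenEigenspace μ)] :
    algMultiplicity A μ = Module.finrank ℂ (A.maxGenEigenspace μ) := by
  rw [algMultiplicity, ← Module.finrank_eq_rank]
  simp

/-- The sum of generalised eigenspaces used below may have dimension `N` larger than the index `n`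
in question. If `t ≤ s n`, every factor before `n` is at least `t`; otherwise the factors from `n`
on are at most `t` and can be cancelled. -/
theorem pow_le_prod_of_antitone (hs0 : ∀ k, 0 ≤ s k) (hs : Antitone s) {t : ℝ} (ht : 0 < t)
    {n N : ℕ} (hn : n ≤ N) (h : t ^ N ≤ ∏ k ∈ Finset.range N, s k) :
    t ^ n ≤ ∏ k ∈ Finset.range n, s k := by
  obtain ⟨j, rfl⟩ := Nat.exists_eq_add_of_le hn
  rcases le_total t (s n) with h1 | h1
  · rw [← Finset.card_range n, ← Finset.prod_const, Finset.card_range]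
    exact Finset.prod_le_prod (fun _ _ => ht.le) fun k hk =>
      h1.trans (hs (Finset.mem_range.1 hk).le)
  · rw [Finset.prod_range_add, pow_add] at h
    have h2 : ∏ x ∈ Finset.range j, s (n + x) ≤ t ^ j := by
      refine (Finset.prod_le_prod (fun _ _ => hs0 _) fun i _ =>
        (hs (show n ≤ n + i by omega)).trans h1).trans ?_
      simp
    have h3 : 0 ≤ ∏ k ∈ Finset.range n, s k := Finset.prod_nonneg fun _ _ => hs0 _
    exact le_of_mul_le_mul_right (h.trans (mul_le_mul_of_nonneg_left h2 h3)) (by positivity)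

theorem HasWeylBound.norm_pow_le_prod (h : HasWeylBound A s) (hs0 : ∀ k, 0 ≤ s k)
    (hsa : Antitone s) (hs : Tendsto s atTop (𝓝 0)) {ev : ℕ → ℂ} (hev : IsEigenvalueSequence A ev)
    (n : ℕ) : ‖ev n‖ ^ (n + 1) ≤ ∏ k ∈ Finset.range (n + 1), s k := by
  rcases eq_or_ne (ev n) 0 with h0 | h0
  · rw [h0, norm_zero, zero_pow (by omega)]
    exact Finset.prod_nonneg fun _ _ => hs0 _
  have ht : 0 < ‖ev n‖ := norm_pos_iff.2 h0
  -- The invariant subspace is the sum of the full generalised eigenspaces of the distinct values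
  -- among `ev 0, …, ev n`. Its dimension is at least `n + 1`, because each value occurs there at
  -- most as often as its multiplicity.
  set S := (Finset.range (n + 1)).image ev with hS
  have hSt : ∀ μ ∈ S, ‖ev n‖ ≤ ‖μ‖ := by
    intro μ hμ
    obtain ⟨k, hk, rfl⟩ := Finset.mem_image.1 hμ
    exact hev.1 (Nat.lt_succ_iff.1 (Finset.mem_range.1 hk))
  have hfd : ∀ μ ∈ S, FiniteDimensional ℂ (A.maxGenEigenspace μ) := fun μ hμ =>
    h.finiteDimensional_maxGenEigenspace hs0 hs (norm_pos_iff.1 (ht.trans_le (hSt μ hμ)))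
  obtain ⟨hf, hr⟩ := finrank_iSup_maxGenEigenspace A S hfd
  have h1 := h _ (apply_mem_iSup_maxGenEigenspace A S) ‖ev n‖ ht.le fun ν x hx hx0 hν =>
    hSt ν (mem_of_apply_eq_smul_of_mem_iSup S hx hx0 hν)
  refine pow_le_prod_of_antitone hs0 hsa ht ?_ h1
  rw [hr]
  conv_lhs => rw [← Finset.card_range (n + 1)]
  rw [Finset.card_eq_sum_card_image ev]
  refine Finset.sum_le_sum fun μ hμ => ?_
  have := hfd μ hμ
  have h2 := hev.2 μ (norm_pos_iff.1 (ht.trans_le (hSt μ hμ)))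
  rw [algMultiplicity_eq_finrank] at h2
  have h3 : ((({k ∈ Finset.range (n + 1) | ev k = μ} : Finset ℕ) : Set ℕ)).encard ≤
      {k | ev k = μ}.encard := Set.encard_le_encard fun k hk => by
    simpa using (Finset.mem_filter.1 hk).2
  rw [h2, Set.encard_coe_eq_coe_finsetCard] at h3
  exact_mod_cast h3

end

/-! ### Listing eigenvalues by decreasing modulus -/

/-- A multiplicity function on `ℂ` with finite support outside each disc around `0` is listed by a
sequence of decreasing modulus. -/
theorem exists_antitone_norm_encard_eq (m : ℂ → ℕ)
    (hm : ∀ t : ℝ, 0 < t → {μ : ℂ | t ≤ ‖μ‖ ∧ m μ ≠ 0}.Finite) :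
    ∃ ev : ℕ → ℂ, Antitone (fun n => ‖ev n‖) ∧
      ∀ μ : ℂ, μ ≠ 0 → {n | ev n = μ}.encard = m μ := by
  classical
  let S := {p : ℂ × ℕ // p.1 ≠ 0 ∧ p.2 < m p.1}
  -- Each value is replaced by as many labelled copies as its multiplicity, ordered by decreasing
  -- modulus; real part, imaginary part and label break ties. Initial segments are finite, so the
  -- number of predecessors enumerates `S`.
  let key : S → ℝ ×ₗ (ℝ ×ₗ (ℝ ×ₗ ℕ)) := fun p =>
    toLex (-‖p.1.1‖, toLex (p.1.1.re, toLex (p.1.1.im, p.1.2)))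
  have hkey : Function.Injective key := by
    rintro ⟨⟨a, i⟩, ha⟩ ⟨⟨b, j⟩, hb⟩ h
    simp only [key, EmbeddingLike.apply_eq_iff_eq, Prod.mk.injEq] at h
    simp [S, Complex.ext_iff, h]
  let _ : LinearOrder S := LinearOrder.lift' key hkey
  have hnorm : ∀ p q : S, p ≤ q → ‖q.1.1‖ ≤ ‖p.1.1‖ := by
    intro p q h
    have h' : key p ≤ key q := h
    rw [Prod.Lex.le_iff] at h'
    rcases h' with h' | h'
    · have := h'.le
      simpa [key] using this
    · have := h'.1.le
      simpa [key] using this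
  have hfin : ∀ p : S, (Set.Iio p).Finite := by
    intro p
    have hF := hm ‖p.1.1‖ (norm_pos_iff.2 p.2.1)
    have hG : ((fun q : S => q.1) '' Set.Iio p).Finite := by
      refine Set.Finite.subset (hF.biUnion (t := fun μ => (fun k => (μ, k)) '' Set.Iio (m μ))
        fun μ _ => (Set.finite_Iio _).image _) ?_
      rintro _ ⟨q, hq, rfl⟩
      simp only [Set.mem_iUnion]
      exact ⟨q.1.1, ⟨hnorm _ _ (le_of_lt hq), (Nat.zero_le _).trans_lt q.2.2 |>.ne'⟩, q.1.2, q.2.2,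
        rfl⟩
    exact hG.of_finite_image Subtype.val_injective.injOn
  let rank : S → ℕ := fun p => (Set.Iio p).ncard
  have hmono : StrictMono rank := fun p q h =>
    Set.ncard_lt_ncard (Set.Iio_ssubset_Iio_iff.2 h) (hfin q)
  have hpred : ∀ p n, rank p = n + 1 → ∃ q, rank q = n := by
    intro p n hp
    have hne : (Set.Iio p).Nonempty := by
      rw [← Set.ncard_pos (hfin p)]
      change 0 < rank p
      omega
    -- The largest element below `p` is its immediate predecessor. Hence the ranks leave no gaps,
    -- and the default value 0 of `ev` appears only after all of them.
    obtain ⟨q, hq, hmax⟩ := Set.exists_max_image _ id (hfin p) hne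
    refine ⟨q, ?_⟩
    have : Set.Iio p = insert q (Set.Iio q) := by
      ext x
      simp only [Set.mem_Iio, Set.mem_insert_iff]
      constructor
      · intro hx
        exact (hmax x hx).eq_or_lt
      · rintro (rfl | hx)
        · exact hq
        · exact hx.trans hq
    have h2 : rank p = rank q + 1 := by
      change (Set.Iio p).ncard = _
      rw [this, Set.ncard_insert_of_notMem (by simp) (hfin q)]
    omega
  let ev : ℕ → ℂ := fun n => if h : ∃ p, rank p = n then h.choose.1.1 else 0
  have hev : ∀ p, ev (rank p) = p.1.1 := by
    intro p
    have h : ∃ q, rank q = rank p := ⟨p, rfl⟩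
    have h1 : h.choose = p := hmono.injective h.choose_spec
    simp only [ev, dif_pos h, h1]
  refine ⟨ev, antitone_nat_of_succ_le fun n => ?_, fun μ hμ => ?_⟩
  · by_cases h : ∃ p, rank p = n + 1
    · obtain ⟨p, hp⟩ := h
      obtain ⟨q, rfl⟩ := hpred p n hp
      rw [← hp, hev, hev]
      exact hnorm _ _ (hmono.lt_iff_lt.1 (by omega)).le
    · simp [ev, dif_neg h]
  · have h1 : {n | ev n = μ} = rank '' {p | p.1.1 = μ} := by
      ext n
      constructor
      · intro hn
        by_cases h : ∃ p, rank p = n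
        · obtain ⟨p, rfl⟩ := h
          exact ⟨p, (hev p).symm.trans hn, rfl⟩
        · simp only [ev, dif_neg h, Set.mem_ofPred_eq] at hn
          exact absurd hn.symm hμ
      · rintro ⟨p, hp, rfl⟩
        exact (hev p).trans hp
    have h2 : (fun p : S => p.1.2) '' {p | p.1.1 = μ} = Set.Iio (m μ) := by
      ext k
      constructor
      · rintro ⟨p, rfl, rfl⟩
        exact p.2.2
      · intro hk
        exact ⟨⟨(μ, k), hμ, hk⟩, rfl, rfl⟩
    have h3 : Set.InjOn (fun p : S => p.1.2) {p | p.1.1 = μ} := by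
      intro p hp q hq h
      exact Subtype.ext (Prod.ext (hp.trans hq.symm) h)
    rw [h1, hmono.injective.encard_image, ← h3.encard_image, h2]
    have : Set.Iio (m μ) = ((Finset.range (m μ) : Finset ℕ) : Set ℕ) := by ext; simp
    rw [this, Set.encard_coe_eq_coe_finsetCard, Finset.card_range]

theorem HasWeylBound.exists_isEigenvalueSequence {V : Type*} [AddCommGroup V] [Module ℂ V]
    {A : Module.End ℂ V} {s : ℕ → ℝ} (h : HasWeylBound A s) (hs0 : ∀ k, 0 ≤ s k)
    (hs : Tendsto s atTop (𝓝 0)) : ∃ ev : ℕ → ℂ, IsEigenvalueSequence A ev := by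
  obtain ⟨ev, hanti, hev⟩ := exists_antitone_norm_encard_eq
    (fun μ => Module.finrank ℂ (A.maxGenEigenspace μ)) fun t ht => h.finite_setOf_le_norm hs0 hs ht
  refine ⟨ev, hanti, fun μ hμ => ?_⟩
  have := h.finiteDimensional_maxGenEigenspace hs0 hs hμ
  rw [hev μ hμ, algMultiplicity_eq_finrank]

/-! ### Elementary inequalities for sums and binomial coefficients -/

/-- The left side is the integral of x^p over [0, n], and each unit interval is compared with its
right endpoint by Bernoulli's strict inequality. The strictness of the final estimate comes from
here. -/
theorem rpow_div_lt_sum_rpow {p : ℝ} (hp : 0 < p) {n : ℕ} (hn : 1 ≤ n) :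
    (n : ℝ) ^ (1 + p) / (1 + p) < ∑ k ∈ Finset.range n, ((k : ℝ) + 1) ^ p := by
  have step : ∀ k : ℕ, ((k : ℝ) + 1) ^ (1 + p) / (1 + p) <
      (k : ℝ) ^ (1 + p) / (1 + p) + ((k : ℝ) + 1) ^ p := by
    intro k
    have hk : (0 : ℝ) < (k : ℝ) + 1 := by positivity
    -- Here 1 + s = k/(k+1); multiplying by (k+1)^(1+p) turns Bernoulli's inequality into the
    -- required increment.
    have hb := one_add_mul_self_lt_rpow_one_add (s := -(1 / ((k : ℝ) + 1))) (p := 1 + p)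
      (by rw [neg_le_neg_iff, div_le_one hk]; simp) (by simp; positivity) (by linarith)
    have h1 : (1 : ℝ) + -(1 / ((k : ℝ) + 1)) = k / (k + 1) := by field_simp; ring
    rw [h1, Real.div_rpow (by positivity) hk.le, lt_div_iff₀ (by positivity)] at hb
    have h2 : ((k : ℝ) + 1) ^ (1 + p) = (k + 1) * ((k : ℝ) + 1) ^ p := by
      rw [Real.rpow_add hk, Real.rpow_one]
    have h3 : (1 + (1 + p) * -(1 / ((k : ℝ) + 1))) * ((k : ℝ) + 1) ^ (1 + p) =
        ((k : ℝ) + 1) ^ (1 + p) - (1 + p) * ((k : ℝ) + 1) ^ p := by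
      rw [h2]; field_simp; ring
    rw [h3] at hb
    rw [div_lt_iff₀ (by linarith), add_mul, div_mul_cancel₀ _ (by linarith)]
    linarith
  induction n, hn using Nat.le_induction with
  | base =>
    have := step 0
    simpa [Real.zero_rpow (show 1 + p ≠ 0 by linarith)] using this
  | succ n hn ih =>
    rw [Finset.sum_range_succ]
    have := step n
    push_cast
    linarith

/-- In the induction on `e` the two sides gain factors for which (m+e+1)(j+e+1) exceeds
(j+m+e+1)(e+1) by jm. The product form lets the first coefficient be pulled out of `kernelTail`. -/
theorem choose_add_add_le_mul (j m e : ℕ) :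
    (j + m + e).choose e ≤ (m + e).choose e * (j + e).choose e := by
  induction e with
  | zero => simp
  | succ e ih =>
    have h : ∀ a : ℕ, (a + (e + 1)).choose (e + 1) * (e + 1) = (a + e + 1) * (a + e).choose e :=
      fun a => (Nat.add_one_mul_choose_eq (a + e) e).symm
    refine le_of_mul_le_mul_right ?_ (show 0 < (e + 1) * (e + 1) by positivity)
    calc (j + m + (e + 1)).choose (e + 1) * ((e + 1) * (e + 1))
        = (j + m + e + 1) * (e + 1) * (j + m + e).choose e := by
          rw [← mul_assoc, h]; ring
      _ ≤ ((m + e + 1) * (j + e + 1)) * ((m + e).choose e * (j + e).choose e) := by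
          refine Nat.mul_le_mul ?_ ih
          nlinarith [Nat.zero_le (j * m)]
      _ = ((m + (e + 1)).choose (e + 1) * (e + 1)) * ((j + (e + 1)).choose (e + 1) * (e + 1)) := by
          rw [h, h]; ring
      _ = _ := by ring

theorem choose_add_le_mul_pow {m : ℕ} (hm : 1 ≤ m) (e : ℕ) :
    (m + e).choose e ≤ (e + 1) * m ^ e := by
  induction e with
  | zero => simp
  | succ e ih =>
    have h : (m + (e + 1)).choose (e + 1) * (e + 1) = (m + e + 1) * (m + e).choose e :=
      (Nat.add_one_mul_choose_eq (m + e) e).symm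
    refine le_of_mul_le_mul_right ?_ (show 0 < e + 1 by positivity)
    rw [h]
    calc (m + e + 1) * (m + e).choose e ≤ ((e + 2) * m) * ((e + 1) * m ^ e) := by
          refine Nat.mul_le_mul ?_ ih
          nlinarith
      _ = _ := by ring

/-- An integer form of C(m+e, e) ≤ d N^(e/d) with d = e + 1. One of the d factors is estimated by d
m^e, and C(m+e, e) m = d C(m+e, d) brings in `N`. -/
theorem choose_pow_le {m e N : ℕ} (hN : (m + e).choose (e + 1) < N) :
    (m + e).choose e ^ (e + 1) ≤ (e + 1) ^ (e + 1) * N ^ e := by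
  rcases Nat.eq_zero_or_pos m with rfl | hm
  · simp only [zero_add, Nat.choose_self, one_pow]
    have : 0 < N := by omega
    exact Nat.one_le_iff_ne_zero.2 (by positivity)
  · have h1 : (m + e).choose (e + 1) * (e + 1) = (m + e).choose e * m := by
      rw [Nat.choose_succ_right_eq]; simp
    calc (m + e).choose e ^ (e + 1) = (m + e).choose e ^ e * (m + e).choose e := pow_succ _ _
      _ ≤ (m + e).choose e ^ e * ((e + 1) * m ^ e) :=
          Nat.mul_le_mul le_rfl (choose_add_le_mul_pow hm e)
      _ = (e + 1) * ((m + e).choose e * m) ^ e := by rw [mul_pow]; ring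
      _ = (e + 1) * ((m + e).choose (e + 1) * (e + 1)) ^ e := by rw [h1]
      _ ≤ (e + 1) * (N * (e + 1)) ^ e := by gcongr
      _ = _ := by rw [mul_pow]; ring

/-! ### Kernel tails and the explicit form of the bound -/

noncomputable section

/-- The tail `∑_{j ≥ m} (j + e choose e) r ^ (2 j)` of the series of `(1 - r²)^{-(e + 1)}`. -/
def kernelTail (e : ℕ) (r : ℝ) (m : ℕ) : ℝ :=
  ∑' j : ℕ, ((j + m + e).choose e : ℝ) * r ^ (2 * (j + m))

/-- The largest `m` such that the polynomials of degree less than `m` in `e + 1` variables form a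
space of dimension at most `k`. -/
def degreeBelow (e k : ℕ) : ℕ := Nat.findGreatest (fun m => (m + e).choose (e + 1) ≤ k) k

section

variable {e : ℕ} {r : ℝ}

theorem summable_choose_mul_sq_pow (e : ℕ) (hr0 : 0 ≤ r) (hr1 : r < 1) :
    Summable fun j : ℕ => ((j + e).choose e : ℝ) * r ^ (2 * j) := by
  have : ‖r ^ 2‖ < 1 := by
    rw [Real.norm_of_nonneg (by positivity)]; nlinarith
  simpa [pow_mul] using summable_choose_mul_geometric_of_norm_lt_one e this

theorem kernelTail_nonneg (e : ℕ) (hr0 : 0 ≤ r) (m : ℕ) : 0 ≤ kernelTail e r m :=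
  tsum_nonneg fun _ => by positivity

theorem kernelTail_eq_sub (e : ℕ) (hr0 : 0 ≤ r) (hr1 : r < 1) (m : ℕ) :
    kernelTail e r m = (∑' j : ℕ, ((j + e).choose e : ℝ) * r ^ (2 * j)) -
      ∑ j ∈ Finset.range m, ((j + e).choose e : ℝ) * r ^ (2 * j) := by
  rw [← (summable_choose_mul_sq_pow e hr0 hr1).sum_add_tsum_nat_add m, kernelTail]
  ring

theorem kernelTail_antitone (e : ℕ) (hr0 : 0 ≤ r) (hr1 : r < 1) : Antitone (kernelTail e r) := by
  refine antitone_nat_of_succ_le fun m => ?_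
  rw [kernelTail_eq_sub e hr0 hr1, kernelTail_eq_sub e hr0 hr1, Finset.sum_range_succ]
  have : 0 ≤ ((m + e).choose e : ℝ) * r ^ (2 * m) := by positivity
  linarith

theorem tendsto_kernelTail (e : ℕ) (r : ℝ) :
    Tendsto (kernelTail e r) atTop (𝓝 0) :=
  tendsto_sum_nat_add fun j : ℕ => ((j + e).choose e : ℝ) * r ^ (2 * j)

/-- By `choose_add_add_le_mul` the tail is at most its first term times the full series, whose sum
is (1 - r²)^(-(e+1)). -/
theorem kernelTail_le (e : ℕ) (hr0 : 0 ≤ r) (hr1 : r < 1) (m : ℕ) :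
    kernelTail e r m ≤ ((m + e).choose e : ℝ) * r ^ (2 * m) / (1 - r ^ 2) ^ (e + 1) := by
  have h1 : ‖r ^ 2‖ < 1 := by
    rw [Real.norm_of_nonneg (by positivity)]; nlinarith
  have h2 := tsum_choose_mul_geometric_of_norm_lt_one e h1
  have hsum := summable_choose_mul_sq_pow e hr0 hr1
  have h3 : ((m + e).choose e : ℝ) * r ^ (2 * m) / (1 - r ^ 2) ^ (e + 1) =
      ∑' j : ℕ, ((m + e).choose e : ℝ) * r ^ (2 * m) * (((j + e).choose e : ℝ) * r ^ (2 * j)) := by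
    simp only [pow_mul r 2] at *
    rw [tsum_mul_left, h2]
    ring
  rw [h3, kernelTail]
  refine Summable.tsum_le_tsum (fun j => ?_) ?_ (hsum.mul_left _)
  · have : ((j + m + e).choose e : ℝ) ≤ (m + e).choose e * (j + e).choose e := by
      exact_mod_cast choose_add_add_le_mul j m e
    calc ((j + m + e).choose e : ℝ) * r ^ (2 * (j + m))
        ≤ ((m + e).choose e * (j + e).choose e) * r ^ (2 * (j + m)) := by gcongr
      _ = _ := by rw [mul_add, pow_add]; ring
  · exact (summable_nat_add_iff m).2 hsum

/-- Shows that the search bound `k` in `degreeBelow` loses nothing. -/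
theorem le_choose_add_succ (m e : ℕ) : m ≤ (m + e).choose (e + 1) := by
  induction e with
  | zero => simp
  | succ e ih =>
    refine ih.trans ?_
    rw [← add_assoc, Nat.choose_succ_succ]
    exact Nat.le_add_right _ _

theorem choose_degreeBelow_le (e k : ℕ) : (degreeBelow e k + e).choose (e + 1) ≤ k :=
  Nat.findGreatest_spec (P := fun m => (m + e).choose (e + 1) ≤ k) (Nat.zero_le k) (by simp)

theorem lt_choose_degreeBelow (e k : ℕ) : k < (degreeBelow e k + (e + 1)).choose (e + 1) := by
  by_contra! h
  have h' : (degreeBelow e k + 1 + e).choose (e + 1) ≤ k := by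
    rwa [add_assoc, add_comm 1 e]
  have h1 : degreeBelow e k + 1 ≤ k := (le_choose_add_succ _ e).trans h'
  have := Nat.le_findGreatest (P := fun m => (m + e).choose (e + 1) ≤ k) h1 h'
  change _ ≤ degreeBelow e k at this
  omega

theorem le_degreeBelow {e k m : ℕ} (h : (m + e).choose (e + 1) ≤ k) : m ≤ degreeBelow e k :=
  Nat.le_findGreatest (P := fun m => (m + e).choose (e + 1) ≤ k) ((le_choose_add_succ m e).trans h) h

theorem degreeBelow_mono (e : ℕ) : Monotone (degreeBelow e) := fun _ _ h =>
  le_degreeBelow ((choose_degreeBelow_le e _).trans h)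

theorem tendsto_degreeBelow (e : ℕ) : Tendsto (degreeBelow e) atTop atTop :=
  tendsto_atTop_atTop.2 fun m => ⟨(m + e).choose (e + 1), fun _ h => le_degreeBelow h⟩

theorem degreeBelow_zero (k : ℕ) : degreeBelow 0 k = k := by
  refine le_antisymm (Nat.findGreatest_le k) (le_degreeBelow (by simp))

theorem sqrt_kernelTail_le (hr0 : 0 ≤ r) (hr1 : r < 1) (m : ℕ) :
    √(kernelTail e r m) ≤
      √((m + e).choose e) * r ^ m / (1 - r ^ 2) ^ (((e + 1 : ℕ) : ℝ) / 2) := by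
  have h1 : 0 < 1 - r ^ 2 := by nlinarith
  refine (Real.sqrt_le_sqrt (kernelTail_le e hr0 hr1 m)).trans (le_of_eq ?_)
  rw [Real.sqrt_div (by positivity), Real.sqrt_mul (by positivity), mul_comm 2 m, pow_mul,
    Real.sqrt_sq (by positivity), Real.sqrt_eq_rpow ((1 - r ^ 2) ^ (e + 1)),
    ← Real.rpow_natCast (1 - r ^ 2) (e + 1), ← Real.rpow_mul h1.le]
  congr 2
  ring

theorem sqrt_choose_le {m N : ℕ} (hN : (m + e).choose (e + 1) < N) :
    √((m + e).choose e) ≤ √((e + 1 : ℕ) : ℝ) * (N : ℝ) ^ ((e : ℝ) / (2 * ((e + 1 : ℕ) : ℝ))) := by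
  have h1 : (((m + e).choose e : ℕ) : ℝ) ≤
      ((e + 1 : ℕ) : ℝ) * (N : ℝ) ^ ((e : ℝ) / ((e + 1 : ℕ) : ℝ)) := by
    refine le_of_pow_le_pow_left₀ (n := e + 1) (by omega) (by positivity) ?_
    rw [mul_pow, ← Real.rpow_natCast ((N : ℝ) ^ _), ← Real.rpow_mul (by positivity),
      div_mul_cancel₀ _ (by positivity), Real.rpow_natCast]
    exact_mod_cast choose_pow_le hN
  refine (Real.sqrt_le_sqrt h1).trans (le_of_eq ?_)
  rw [Real.sqrt_mul (by positivity), Real.sqrt_eq_rpow ((N : ℝ) ^ _),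
    ← Real.rpow_mul (by positivity)]
  congr 2
  field_simp

/-- From d! N ≤ (m+1)⋯(m+d) ≤ (m+d)^d one gets (d! N)^(1/d) ≤ m + d; the shift by `d` costs the
factor r^(-d). -/
theorem pow_le_rpow_of_le_choose (hr0 : 0 < r) (hr1 : r < 1) {m N d : ℕ} (hd : d ≠ 0)
    (hN : N ≤ (m + d).choose d) :
    r ^ m ≤ (r ^ d)⁻¹ * r ^ ((d.factorial : ℝ) ^ (1 / (d : ℝ)) * (N : ℝ) ^ (1 / (d : ℝ))) := by
  have h1 : d.factorial * N ≤ (m + d) ^ d := by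
    refine (Nat.mul_le_mul le_rfl hN).trans ?_
    rw [← Nat.descFactorial_eq_factorial_mul_choose]
    exact Nat.descFactorial_le_pow _ _
  have h2 : (d.factorial : ℝ) ^ (1 / (d : ℝ)) * (N : ℝ) ^ (1 / (d : ℝ)) ≤ (m + d : ℕ) := by
    rw [← Real.mul_rpow (by positivity) (by positivity)]
    have h3 : ((d.factorial : ℝ) * N) ≤ ((m + d : ℕ) : ℝ) ^ d := by exact_mod_cast h1
    refine (Real.rpow_le_rpow (by positivity) h3 (by positivity)).trans (le_of_eq ?_)
    rw [one_div, Real.pow_rpow_inv_natCast (by positivity) hd]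
  have h4 := Real.rpow_le_rpow_of_exponent_ge hr0 hr1.le h2
  rw [Real.rpow_natCast, pow_add] at h4
  rw [le_inv_mul_iff₀ (by positivity), mul_comm]
  exact h4

/-- With m = `degreeBelow e k`, the two sides of C(m+e, e+1) ≤ k < C(m+e+1, e+1) control the
binomial factor from above and the exponent of `r` from below, both with N = k + 1. -/
theorem sqrt_kernelTail_degreeBelow_le (hr0 : 0 < r) (hr1 : r < 1) (k : ℕ) :
    √(kernelTail e r (degreeBelow e k)) ≤
      √((e + 1 : ℕ) : ℝ) / (r ^ (e + 1) * (1 - r ^ 2) ^ (((e + 1 : ℕ) : ℝ) / 2)) *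
        ((k + 1 : ℕ) : ℝ) ^ ((e : ℝ) / (2 * ((e + 1 : ℕ) : ℝ))) *
          r ^ (((e + 1).factorial : ℝ) ^ (1 / ((e + 1 : ℕ) : ℝ)) *
            ((k + 1 : ℕ) : ℝ) ^ (1 / ((e + 1 : ℕ) : ℝ))) := by
  have h1 : 0 < 1 - r ^ 2 := by nlinarith
  refine (sqrt_kernelTail_le hr0.le hr1 _).trans ?_
  have h2 := sqrt_choose_le (Nat.lt_succ_of_le (choose_degreeBelow_le e k))
  have h3 := pow_le_rpow_of_le_choose hr0 hr1 (Nat.succ_ne_zero e) (lt_choose_degreeBelow e k)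
  refine (div_le_div_of_nonneg_right (mul_le_mul h2 h3 (by positivity) (by positivity))
    (by positivity)).trans (le_of_eq ?_)
  simp only [Nat.succ_eq_add_one]
  rw [div_mul_eq_mul_div, div_mul_eq_mul_div]
  field_simp

end

/-- Bounds for the approximation numbers of the transfer operator in dimension `e + 1`. -/
def approxBound (e : ℕ) (W r : ℝ) (k : ℕ) : ℝ := W * √(kernelTail e r (degreeBelow e k))

section

variable {e : ℕ} {W r : ℝ}

theorem approxBound_nonneg (hW : 0 ≤ W) (k : ℕ) : 0 ≤ approxBound e W r k :=
  mul_nonneg hW (Real.sqrt_nonneg _)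

theorem approxBound_antitone (hW : 0 ≤ W) (hr0 : 0 ≤ r) (hr1 : r < 1) :
    Antitone (approxBound e W r) := fun _ _ h =>
  mul_le_mul_of_nonneg_left
    (Real.sqrt_le_sqrt (kernelTail_antitone e hr0 hr1 (degreeBelow_mono e h))) hW

theorem tendsto_sqrt_kernelTail (e : ℕ) (r W : ℝ) :
    Tendsto (fun m => W * √(kernelTail e r m)) atTop (𝓝 0) := by
  simpa using (tendsto_kernelTail e r).sqrt.const_mul W

theorem tendsto_approxBound (e : ℕ) (W r : ℝ) :
    Tendsto (approxBound e W r) atTop (𝓝 0) :=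
  (tendsto_sqrt_kernelTail e r W).comp (tendsto_degreeBelow e)

theorem prod_approxBound_le (hW : 0 ≤ W) (hr0 : 0 < r) (hr1 : r < 1) (n : ℕ) :
    ∏ k ∈ Finset.range n, approxBound e W r k ≤
      (W * √((e + 1 : ℕ) : ℝ) / (r ^ (e + 1) * (1 - r ^ 2) ^ (((e + 1 : ℕ) : ℝ) / 2)) *
        (n : ℝ) ^ ((e : ℝ) / (2 * ((e + 1 : ℕ) : ℝ)))) ^ n *
          r ^ (((e + 1).factorial : ℝ) ^ (1 / ((e + 1 : ℕ) : ℝ)) *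
            ∑ k ∈ Finset.range n, ((k : ℝ) + 1) ^ (1 / ((e + 1 : ℕ) : ℝ))) := by
  have h1 : 0 < 1 - r ^ 2 := by nlinarith
  rw [Finset.mul_sum, Real.rpow_sum_of_pos hr0, ← Finset.card_range n, ← Finset.prod_const,
    Finset.card_range, ← Finset.prod_mul_distrib]
  refine Finset.prod_le_prod (fun k _ => approxBound_nonneg hW k) fun k hk => ?_
  -- Only the polynomial factor is enlarged to its value at `n`; the exponents of `r` are kept,
  -- since their sum determines the rate.
  have hkn : ((k + 1 : ℕ) : ℝ) ≤ n := by exact_mod_cast Finset.mem_range.1 hk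
  have h2 := mul_le_mul_of_nonneg_left (sqrt_kernelTail_degreeBelow_le (e := e) hr0 hr1 k) hW
  refine h2.trans ?_
  rw [← mul_assoc, ← mul_assoc, ← mul_div_assoc]
  push_cast at hkn ⊢
  gcongr

theorem lt_eigenvalueBound (hW : 0 < W) (hr0 : 0 < r) (hr1 : r < 1) {n : ℕ} (hn : 1 ≤ n) {t : ℝ}
    (h : t ^ n ≤ ∏ k ∈ Finset.range n, approxBound e W r k) :
    t < eigenvalueBound (e + 1) W r n := by
  have h1 : 0 < 1 - r ^ 2 := by nlinarith
  have hn0 : (0 : ℝ) < n := by exact_mod_cast hn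
  have hB : 0 ≤ eigenvalueBound (e + 1) W r n := by unfold eigenvalueBound; positivity
  refine lt_of_pow_lt_pow_left₀ n hB ((h.trans (prod_approxBound_le hW.le hr0 hr1 n)).trans_lt ?_)
  have hs := rpow_div_lt_sum_rpow (p := 1 / ((e + 1 : ℕ) : ℝ)) (by positivity) hn
  have he : (((e + 1 : ℕ) : ℝ) - 1) / (2 * ((e + 1 : ℕ) : ℝ)) = e / (2 * ((e + 1 : ℕ) : ℝ)) := by
    push_cast; ring
  rw [eigenvalueBound, mul_pow _ (r ^ _), he]
  refine mul_lt_mul_of_pos_left ?_ (by positivity)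
  rw [← Real.rpow_natCast (r ^ _), ← Real.rpow_mul hr0.le]
  -- As r < 1, a strict lower bound for the exponent suffices; n^(1+1/d)/(1+1/d) is n times d/(d+1)
  -- · n^(1/d).
  refine Real.rpow_lt_rpow_of_exponent_gt hr0 hr1 ?_
  have hf : 0 < ((e + 1).factorial : ℝ) ^ (1 / ((e + 1 : ℕ) : ℝ)) := by positivity
  refine lt_of_eq_of_lt ?_ (mul_lt_mul_of_pos_left hs hf)
  rw [Real.rpow_add hn0, Real.rpow_one]
  field_simp

theorem le_eigenvalueBound (hW : 0 ≤ W) (hr0 : 0 < r) (hr1 : r < 1) {n : ℕ} (hn : 1 ≤ n) {t : ℝ}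
    (ht : 0 ≤ t) (h : t ^ n ≤ ∏ k ∈ Finset.range n, approxBound e W r k) :
    t ≤ eigenvalueBound (e + 1) W r n := by
  rcases hW.eq_or_lt with rfl | hW
  · have h0 : ∏ k ∈ Finset.range n, approxBound e 0 r k = 0 :=
      Finset.prod_eq_zero (Finset.mem_range.2 hn) (by simp [approxBound])
    rw [h0] at h
    have : t = 0 := eq_zero_of_pow_eq_zero (h.antisymm (by positivity))
    simp [this, eigenvalueBound]
  · exact (lt_eigenvalueBound hW hr0 hr1 hn h).le

/-- In one variable `degreeBelow` is the identity and the binomial factor is 1, so the exponents 0,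
…, n - 1 can be summed exactly. -/
theorem le_of_pow_le_prod_approxBound_zero (hW : 0 ≤ W) (hr0 : 0 < r) (hr1 : r < 1) {n : ℕ}
    (hn : 1 ≤ n) {t : ℝ} (h : t ^ n ≤ ∏ k ∈ Finset.range n, approxBound 0 W r k) :
    t ≤ W / √(1 - r ^ 2) * r ^ (((n : ℝ) - 1) / 2) := by
  have h1 : 0 < 1 - r ^ 2 := by nlinarith
  have hn0 : (0 : ℝ) < n := by exact_mod_cast hn
  refine le_of_pow_le_pow_left₀ (n := n) (by omega) (by positivity) (h.trans ?_)
  have hk : ∀ k, approxBound 0 W r k ≤ W / √(1 - r ^ 2) * r ^ k := by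
    intro k
    have := mul_le_mul_of_nonneg_left (sqrt_kernelTail_le (e := 0) hr0.le hr1 (degreeBelow 0 k)) hW
    refine this.trans (le_of_eq ?_)
    rw [degreeBelow_zero, Real.sqrt_eq_rpow (1 - r ^ 2)]
    simp
    ring
  refine (Finset.prod_le_prod (fun k _ => approxBound_nonneg hW k) fun k _ => hk k).trans
    (le_of_eq ?_)
  rw [Finset.prod_mul_distrib, Finset.prod_const, Finset.card_range, Finset.prod_pow_eq_pow_sum,
    mul_pow, ← Real.rpow_natCast (r ^ _) n, ← Real.rpow_mul hr0.le,
    ← Real.rpow_natCast r (∑ i ∈ Finset.range n, i)]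
  congr 2
  have : (∑ i ∈ Finset.range n, i) * 2 = n * (n - 1) := Finset.sum_range_id_mul_two n
  have h2 : ((∑ i ∈ Finset.range n, i : ℕ) : ℝ) * 2 = n * (n - 1) := by
    rw [← Nat.cast_pred hn]
    exact_mod_cast this
  linarith

end

end

/-! ### Uniform limits, Taylor coefficients and homogeneous components -/

section

variable {E : Type*} [NormedAddCommGroup E] [NormedSpace ℂ E]

theorem norm_fderiv_le_of_forall_mem_ball_norm_le {u : E → ℂ} {z : E} {δ M : ℝ} (hδ : 0 < δ)
    (hu : DifferentiableOn ℂ u (ball z δ)) (hM : ∀ y ∈ ball z δ, ‖u y‖ ≤ M) :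
    ‖fderiv ℂ u z‖ ≤ 2 * M / δ := by
  -- The image lies in a closed ball around `u z`, not around 0, which accounts for the radius 2M.
  refine Complex.norm_fderiv_le_div_of_mapsTo_ball hu (fun y hy => ?_) hδ
  rw [mem_closedBall, dist_eq_norm]
  have h1 := hM y hy
  have h2 := hM z (mem_ball_self hδ)
  linarith [norm_sub_le (u y) (u z)]

/-- Uniform limits of holomorphic functions on a ball are holomorphic at its centre. -/
theorem TendstoUniformlyOn.differentiableAt_center {ι : Type*} {l : Filter ι} [l.NeBot]
    {F : ι → E → ℂ} {f : E → ℂ} {x : E} {ρ : ℝ} (hρ : 0 < ρ)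
    (hF : ∀ n, DifferentiableOn ℂ (F n) (ball x ρ)) (h : TendstoUniformlyOn F f l (ball x ρ)) :
    DifferentiableAt ℂ f x := by
  have hsub : ∀ y ∈ ball x (ρ / 2), ball y (ρ / 2) ⊆ ball x ρ := fun y hy =>
    ball_subset_ball' (by rw [mem_ball] at hy; linarith)
  -- Cauchy's estimate on balls of radius ρ/2, applied to differences of the `F n`, makes the
  -- derivatives uniformly Cauchy; termwise differentiation then applies.
  have hC : UniformCauchySeqOn (fun n => fderiv ℂ (F n)) l (ball x (ρ / 2)) := by
    intro U hU
    obtain ⟨ε, hε, hεU⟩ := Metric.mem_uniformity_dist.1 hU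
    -- Functions within `c` of the limit differ by at most 2c, so their derivatives differ by at
    -- most 2(2c)/(ρ/2), which is ε/2 for this `c`.
    obtain ⟨c, hc, hcε⟩ : ∃ c : ℝ, 0 < c ∧ 2 * (2 * c) / (ρ / 2) < ε :=
      ⟨ε * ρ / 16, by positivity, by field_simp; norm_num⟩
    have hev := Metric.tendstoUniformlyOn_iff.1 h c hc
    filter_upwards [hev.prod_mk hev] with p hp y hy
    refine hεU ?_
    have hd : ∀ n, DifferentiableOn ℂ (F n) (ball y (ρ / 2)) := fun n => (hF n).mono (hsub y hy)
    have hy' : ∀ n, DifferentiableAt ℂ (F n) y := fun n =>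
      (hd n).differentiableAt (ball_mem_nhds _ (half_pos hρ))
    rw [dist_eq_norm, ← fderiv_sub (hy' _) (hy' _)]
    refine lt_of_le_of_lt (norm_fderiv_le_of_forall_mem_ball_norm_le (half_pos hρ)
      ((hd _).sub (hd _)) fun w hw => ?_) hcε
    have h1 := hp.1 w (hsub y hy hw)
    have h2 := hp.2 w (hsub y hy hw)
    rw [Pi.sub_apply, ← dist_eq_norm]
    rw [dist_comm] at h1
    linarith [dist_triangle (F p.1 w) (f w) (F p.2 w)]
  have hlim : ∀ y, ∃ L : E →L[ℂ] ℂ, y ∈ ball x (ρ / 2) →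
      Tendsto (fun n => fderiv ℂ (F n) y) l (𝓝 L) := by
    intro y
    by_cases hy : y ∈ ball x (ρ / 2)
    · obtain ⟨L, hL⟩ := CompleteSpace.complete (hC.cauchy_map hy)
      exact ⟨L, fun _ => hL⟩
    · exact ⟨0, fun h => absurd h hy⟩
  choose g hg using hlim
  refine (hasFDerivAt_of_tendstoUniformlyOn (f := F) (g := f) isOpen_ball
    (hC.tendstoUniformlyOn_of_tendsto hg) (fun n y hy => ?_) (fun y hy => ?_)
    (mem_ball_self (half_pos hρ))).differentiableAt
  · exact ((hF n).differentiableAt (isOpen_ball.mem_nhds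
      (ball_subset_ball (by linarith) hy))).hasFDerivAt
  · exact h.tendsto_at (ball_subset_ball (by linarith) hy)

end

section Taylor

/-- The `m`-th Taylor coefficient at `0`. -/
noncomputable def taylorCoeff (m : ℕ) (g : ℂ → ℂ) : ℂ := (m.factorial : ℂ)⁻¹ * iteratedDeriv m g 0

variable {g : ℂ → ℂ} {M : ℝ}

/-- Cauchy's estimate on circles of radius ρ < 1, with ρ tending to 1. -/
theorem norm_taylorCoeff_le (hg : DifferentiableOn ℂ g (ball 0 1))
    (hM : ∀ t ∈ ball (0 : ℂ) 1, ‖g t‖ ≤ M) (m : ℕ) : ‖taylorCoeff m g‖ ≤ M := by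
  have h1 : ∀ ρ : ℝ, ρ ∈ Set.Ioo (0 : ℝ) 1 → ‖taylorCoeff m g‖ ≤ M / ρ ^ m := by
    intro ρ hρ
    have hs : closedBall (0 : ℂ) ρ ⊆ ball 0 1 := closedBall_subset_ball hρ.2
    have h2 := Complex.norm_iteratedDeriv_le_of_forall_mem_sphere_norm_le (c := (0 : ℂ)) m hρ.1
      ((hg.mono hs).diffContOnCl_ball le_rfl) fun z hz => hM z (hs (sphere_subset_closedBall hz))
    have h3 : (0 : ℝ) < m.factorial := by positivity
    rw [taylorCoeff, norm_mul, norm_inv, Complex.norm_natCast, inv_mul_le_iff₀ h3]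
    exact h2.trans (le_of_eq (mul_div_assoc _ _ _))
  have h2 : Tendsto (fun ρ : ℝ => M / ρ ^ m) (𝓝[<] 1) (𝓝 M) := by
    have : ContinuousAt (fun ρ : ℝ => M / ρ ^ m) 1 := by
      refine ContinuousAt.div (by fun_prop) (by fun_prop) (by simp)
    have h3 := this.tendsto
    simp only [one_pow, div_one] at h3
    exact h3.mono_left nhdsWithin_le_nhds
  refine ge_of_tendsto h2 ?_
  filter_upwards [Ioo_mem_nhdsLT (show (0 : ℝ) < 1 by norm_num)] with ρ hρ using h1 ρ hρ

theorem norm_sub_sum_taylorCoeff_le (hg : DifferentiableOn ℂ g (ball 0 1))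
    (hM : ∀ t ∈ ball (0 : ℂ) 1, ‖g t‖ ≤ M) (m : ℕ) {t : ℂ} (ht : ‖t‖ < 1) :
    ‖g t - ∑ j ∈ Finset.range m, t ^ j * taylorCoeff j g‖ ≤ M * ‖t‖ ^ m / (1 - ‖t‖) := by
  have h1 : HasSum (fun j => t ^ j * taylorCoeff j g) (g t) := by
    have := Complex.hasSum_taylorSeries_on_ball hg (z := t) (by simpa using ht)
    refine this.congr_fun fun j => ?_
    simp only [taylorCoeff, smul_eq_mul, sub_zero]
    ring
  have h2 := (hasSum_nat_add_iff' m).2 h1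
  rw [← h2.tsum_eq]
  refine tsum_of_norm_bounded (g := fun j => M * ‖t‖ ^ m * ‖t‖ ^ j) ?_ fun j => ?_
  · exact (hasSum_geometric_of_lt_one (norm_nonneg _) ht).mul_left _
  · rw [norm_mul, norm_pow, pow_add]
    have := norm_taylorCoeff_le hg hM (j + m)
    calc ‖t‖ ^ j * ‖t‖ ^ m * ‖taylorCoeff (j + m) g‖ ≤ ‖t‖ ^ j * ‖t‖ ^ m * M := by gcongr
      _ = _ := by ring

/-- The bound depends on `g` only through `M`. For the slices of a bounded function of several
variables the convergence as t → 0 is therefore uniform in the base point, which is how directional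
derivatives and homogeneous components inherit holomorphy. -/
theorem norm_div_pow_sub_taylorCoeff_le (hg : DifferentiableOn ℂ g (ball 0 1))
    (hM : ∀ t ∈ ball (0 : ℂ) 1, ‖g t‖ ≤ M) (m : ℕ) {t : ℂ} (ht : ‖t‖ < 1) (ht0 : t ≠ 0) :
    ‖(g t - ∑ j ∈ Finset.range m, t ^ j * taylorCoeff j g) / t ^ m - taylorCoeff m g‖ ≤
      M * ‖t‖ / (1 - ‖t‖) := by
  have h := norm_sub_sum_taylorCoeff_le hg hM (m + 1) ht
  have h0 : t ^ m ≠ 0 := pow_ne_zero _ ht0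
  have h1 : (g t - ∑ j ∈ Finset.range m, t ^ j * taylorCoeff j g) / t ^ m - taylorCoeff m g =
      (g t - ∑ j ∈ Finset.range (m + 1), t ^ j * taylorCoeff j g) / t ^ m := by
    rw [Finset.sum_range_succ]
    field_simp
    ring
  rw [h1, norm_div, norm_pow, div_le_iff₀ (by positivity)]
  refine h.trans (le_of_eq ?_)
  ring

theorem tendsto_mul_norm_div_one_sub_norm (M : ℝ) :
    Tendsto (fun t : ℂ => M * ‖t‖ / (1 - ‖t‖)) (𝓝[≠] 0) (𝓝 0) := by
  have : ContinuousAt (fun t : ℂ => M * ‖t‖ / (1 - ‖t‖)) 0 :=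
    ContinuousAt.div (by fun_prop) (by fun_prop) (by simp)
  have h := this.tendsto
  simp only [norm_zero, mul_zero, zero_div] at h
  exact h.mono_left nhdsWithin_le_nhds

theorem eventually_norm_lt_one_and_ne_zero : ∀ᶠ t : ℂ in 𝓝[≠] 0, ‖t‖ < 1 ∧ t ≠ 0 := by
  filter_upwards [nhdsWithin_le_nhds (ball_mem_nhds (0 : ℂ) one_pos), self_mem_nhdsWithin]
    with t ht ht0
  exact ⟨by simpa using ht, ht0⟩

end Taylor

section

variable {E : Type*} [NormedAddCommGroup E] [NormedSpace ℂ E]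

theorem differentiableOn_slice {u : E → ℂ} {z w : E} {s : Set E} (hu : DifferentiableOn ℂ u s)
    (h : ∀ t ∈ ball (0 : ℂ) 1, z + t • w ∈ s) :
    DifferentiableOn ℂ (fun t : ℂ => u (z + t • w)) (ball 0 1) :=
  hu.comp (by fun_prop) h

/-- Directional derivatives of holomorphic functions are holomorphic. -/
theorem DifferentiableOn.fderiv_apply {u : E → ℂ} {U : Set E} (hU : IsOpen U)
    (hu : DifferentiableOn ℂ u U) (v : E) : DifferentiableOn ℂ (fun z => fderiv ℂ u z v) U := by
  intro x hx
  refine DifferentiableAt.differentiableWithinAt ?_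
  have hcont : ContinuousAt u x := (hu.differentiableAt (hU.mem_nhds hx)).continuousAt
  obtain ⟨ε, hε, hball⟩ : ∃ ε > 0, ball x ε ⊆ U ∩ {y | ‖u y‖ < ‖u x‖ + 1} := by
    refine Metric.mem_nhds_iff.1 (inter_mem (hU.mem_nhds hx) ?_)
    exact hcont.norm.eventually (gt_mem_nhds (by linarith))
  -- The bound on `u` holds only on `ball x ε`, so `v` is shortened until the unit slices through
  -- points of the ball of half the radius stay inside.
  obtain ⟨δ, hδ, hδv⟩ : ∃ δ : ℝ, 0 < δ ∧ δ * ‖v‖ < ε / 2 := by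
    refine ⟨ε / 2 / (‖v‖ + 1), by positivity, ?_⟩
    rw [div_mul_eq_mul_div, div_lt_iff₀ (by positivity)]
    nlinarith [norm_nonneg v]
  set w : E := (δ : ℂ) • v with hw
  have hwn : ‖w‖ < ε / 2 := by
    rw [hw, norm_smul, Complex.norm_real, Real.norm_of_nonneg hδ.le]; exact hδv
  have hmem : ∀ y ∈ ball x (ε / 2), ∀ t ∈ ball (0 : ℂ) 1, y + t • w ∈ ball x ε := by
    intro y hy t ht
    rw [mem_ball_zero_iff] at ht
    rw [mem_ball, dist_eq_norm] at hy ⊢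
    have h1 : ‖t • w‖ ≤ ‖w‖ := by
      rw [norm_smul]; exact mul_le_of_le_one_left (norm_nonneg _) ht.le
    have h2 : y + t • w - x = (y - x) + t • w := by abel
    rw [h2]
    linarith [norm_add_le (y - x) (t • w)]
  have hdw : DifferentiableAt ℂ (fun z => fderiv ℂ u z w) x := by
    -- Difference quotients converge uniformly to the derivative, the Taylor coefficient of order 1
    -- along the slice. The value 0 for other `t` only serves to make every member of the family
    -- holomorphic.
    have hlim : TendstoUniformlyOn (fun t : ℂ => if ‖t‖ < 1 ∧ t ≠ 0 then
        (fun y => (u (y + t • w) - u y) / t) else fun _ => 0) (fun z => fderiv ℂ u z w) (𝓝[≠] 0)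
        (ball x (ε / 2)) := by
      rw [Metric.tendstoUniformlyOn_iff]
      intro η hη
      filter_upwards [eventually_norm_lt_one_and_ne_zero,
        (tendsto_mul_norm_div_one_sub_norm (‖u x‖ + 1)).eventually (gt_mem_nhds hη)] with t ht htη y hy
      refine lt_of_le_of_lt ?_ htη
      rw [if_pos ht, dist_comm, dist_eq_norm]
      have h1 := norm_div_pow_sub_taylorCoeff_le (g := fun t : ℂ => u (y + t • w)) (M := ‖u x‖ + 1)
        (differentiableOn_slice hu fun t ht => (hball (hmem y hy t ht)).1)
        (fun t ht => (hball (hmem y hy t ht)).2.le) 1 ht.1 ht.2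
      have hyU : y ∈ U := (hball (ball_subset_ball (by linarith) hy)).1
      have h2 : HasDerivAt (fun t : ℂ => u (y + t • w)) (fderiv ℂ u y w) 0 := by
        have h3 : HasFDerivAt u (fderiv ℂ u y) (y + (0 : ℂ) • w) := by
          simpa using (hu.differentiableAt (hU.mem_nhds hyU)).hasFDerivAt
        have h4 : HasDerivAt (fun t : ℂ => y + t • w) w 0 := by
          simpa using ((hasDerivAt_id (0 : ℂ)).smul_const w).const_add y
        exact h3.comp_hasDerivAt (0 : ℂ) h4
      simpa [taylorCoeff, iteratedDeriv_one, h2.deriv] using h1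
    refine hlim.differentiableAt_center (half_pos hε) fun t => ?_
    split_ifs with ht
    · simp only [div_eq_mul_inv]
      refine DifferentiableOn.mul_const (DifferentiableOn.fun_sub ?_ ?_) _
      · refine hu.comp (by fun_prop) fun y hy => (hball (hmem y hy t ?_)).1
        simpa using ht.1
      · exact hu.mono fun y hy => (hball (ball_subset_ball (by linarith) hy)).1
    · exact differentiableOn_const _
  have hv : v = ((δ : ℂ)⁻¹) • w := by
    rw [hw, smul_smul, inv_mul_cancel₀ (by exact_mod_cast hδ.ne'), one_smul]
  rw [hv]
  simpa using hdw.const_mul ((δ : ℂ)⁻¹)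

/-- The homogeneous component of degree `m` at `0`. -/
noncomputable def homogComponent (m : ℕ) (u : E → ℂ) (z : E) : ℂ :=
  taylorCoeff m fun t : ℂ => u (t • z)

variable {u : E → ℂ} {M : ℝ}

theorem smul_mem_unitBall {z : E} (hz : z ∈ ball (0 : E) 1) {t : ℂ} (ht : ‖t‖ ≤ 1) :
    t • z ∈ ball (0 : E) 1 := by
  rw [mem_ball_zero_iff, norm_smul] at *
  exact (mul_le_of_le_one_left (norm_nonneg _) ht).trans_lt hz

theorem differentiableOn_slice_zero (hu : DifferentiableOn ℂ u (ball 0 1)) {z : E}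
    (hz : z ∈ ball (0 : E) 1) : DifferentiableOn ℂ (fun t : ℂ => u (t • z)) (ball 0 1) :=
  hu.comp (by fun_prop) fun _ ht =>
    smul_mem_unitBall hz (by simpa using (mem_ball_zero_iff.1 ht).le)

theorem norm_slice_le (hM : ∀ z ∈ ball (0 : E) 1, ‖u z‖ ≤ M) {z : E} (hz : z ∈ ball (0 : E) 1) :
    ∀ t ∈ ball (0 : ℂ) 1, ‖u (t • z)‖ ≤ M := fun _ ht =>
  hM _ (smul_mem_unitBall hz (mem_ball_zero_iff.1 ht).le)

/-- Once the lower components are known to be holomorphic, the next one is a uniform limit of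
holomorphic functions: remove the lower components from u(tz), divide by t^m and let t → 0. -/
theorem differentiableOn_homogComponent (hu : DifferentiableOn ℂ u (ball 0 1))
    (hM : ∀ z ∈ ball (0 : E) 1, ‖u z‖ ≤ M) (m : ℕ) :
    DifferentiableOn ℂ (homogComponent m u) (ball 0 1) := by
  induction m using Nat.strong_induction_on with
  | _ m ih =>
    intro x hx
    refine DifferentiableAt.differentiableWithinAt ?_
    obtain ⟨ρ, hρ, hball⟩ := Metric.isOpen_iff.1 isOpen_ball x hx
    have hlim : TendstoUniformlyOn (fun t : ℂ => if ‖t‖ < 1 ∧ t ≠ 0 then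
        (fun z => (u (t • z) - ∑ j ∈ Finset.range m, t ^ j * homogComponent j u z) / t ^ m)
        else fun _ => 0) (homogComponent m u) (𝓝[≠] 0) (ball x ρ) := by
      rw [Metric.tendstoUniformlyOn_iff]
      intro η hη
      filter_upwards [eventually_norm_lt_one_and_ne_zero,
        (tendsto_mul_norm_div_one_sub_norm M).eventually (gt_mem_nhds hη)] with t ht htη y hy
      refine lt_of_le_of_lt ?_ htη
      rw [if_pos ht, dist_comm, dist_eq_norm]
      exact norm_div_pow_sub_taylorCoeff_le (differentiableOn_slice_zero hu (hball hy))
        (norm_slice_le hM (hball hy)) m ht.1 ht.2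
    refine hlim.differentiableAt_center hρ fun t => DifferentiableOn.mono ?_ hball
    split_ifs with ht
    · simp only [div_eq_mul_inv]
      refine DifferentiableOn.mul_const (DifferentiableOn.fun_sub ?_ ?_) _
      · exact hu.comp (by fun_prop) fun y hy => smul_mem_unitBall hy ht.1.le
      · exact DifferentiableOn.fun_sum fun j hj => (ih j (Finset.mem_range.1 hj)).const_mul _
    · exact differentiableOn_const _

theorem tendsto_homogComponent (hu : DifferentiableOn ℂ u (ball 0 1))
    (hM : ∀ z ∈ ball (0 : E) 1, ‖u z‖ ≤ M) (m : ℕ) {z : E} (hz : z ∈ ball (0 : E) 1) :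
    Tendsto (fun t : ℂ => (u (t • z) - ∑ j ∈ Finset.range m, t ^ j * homogComponent j u z) / t ^ m)
      (𝓝[≠] 0) (𝓝 (homogComponent m u z)) := by
  rw [tendsto_iff_norm_sub_tendsto_zero]
  refine squeeze_zero' (Eventually.of_forall fun _ => norm_nonneg _) ?_
    (tendsto_mul_norm_div_one_sub_norm M)
  filter_upwards [eventually_norm_lt_one_and_ne_zero] with t ht
  exact norm_div_pow_sub_taylorCoeff_le (differentiableOn_slice_zero hu hz)
    (norm_slice_le hM hz) m ht.1 ht.2

/-- Replace t by ta in the limit of `tendsto_homogComponent`. Working with this limit, rather than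
with derivatives, also covers |a| > 1. -/
theorem homogComponent_smul (hu : DifferentiableOn ℂ u (ball 0 1))
    (hM : ∀ z ∈ ball (0 : E) 1, ‖u z‖ ≤ M) (m : ℕ) {z : E} (hz : z ∈ ball (0 : E) 1) {a : ℂ}
    (ha : a ≠ 0) (haz : a • z ∈ ball (0 : E) 1) :
    homogComponent m u (a • z) = a ^ m * homogComponent m u z := by
  induction m using Nat.strong_induction_on with
  | _ m ih =>
    have hmul : Tendsto (fun t : ℂ => t * a) (𝓝[≠] 0) (𝓝[≠] 0) := by
      refine tendsto_nhdsWithin_iff.2 ⟨?_, ?_⟩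
      · have : Tendsto (fun t : ℂ => t * a) (𝓝 0) (𝓝 (0 * a)) := by
          exact (continuous_mul_const a).tendsto 0
        rw [zero_mul] at this
        exact this.mono_left nhdsWithin_le_nhds
      · filter_upwards [self_mem_nhdsWithin] with t ht using mul_ne_zero ht ha
    have h1 := tendsto_homogComponent hu hM m haz
    have h2 := ((tendsto_homogComponent hu hM m hz).comp hmul).const_mul (a ^ m)
    refine tendsto_nhds_unique h1 (h2.congr' ?_)
    filter_upwards [self_mem_nhdsWithin] with t ht
    have ht0 : t ≠ 0 := ht
    have h3 : ∑ j ∈ Finset.range m, t ^ j * homogComponent j u (a • z) =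
        ∑ j ∈ Finset.range m, (t * a) ^ j * homogComponent j u z := by
      refine Finset.sum_congr rfl fun j hj => ?_
      rw [ih j (Finset.mem_range.1 hj), mul_pow, mul_assoc]
    rw [h3, Function.comp_apply, smul_smul, mul_pow t a m]
    field_simp

theorem norm_sub_sum_homogComponent_le (hu : DifferentiableOn ℂ u (ball 0 1))
    (hM : ∀ z ∈ ball (0 : E) 1, ‖u z‖ ≤ M) (m : ℕ) {z : E} (hz : z ∈ ball (0 : E) 1) {t : ℂ}
    (ht : ‖t‖ < 1) :
    ‖u (t • z) - ∑ j ∈ Finset.range m, t ^ j * homogComponent j u z‖ ≤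
      M * ‖t‖ ^ m / (1 - ‖t‖) :=
  norm_sub_sum_taylorCoeff_le (differentiableOn_slice_zero hu hz) (norm_slice_le hM hz) m ht

end

/-! ### Homogeneous polynomials and uniform polynomial approximation -/

noncomputable section

variable {d : ℕ}

/-- The monomial `x ^ α` as a function on `ℂ^d`. -/
def mono (α : Fin d → ℕ) (x : Cd d) : ℂ := ∏ i, x i ^ α i

/-- Homogeneous polynomial functions of degree `m` on `ℂ^d`. -/
def homogPoly (d m : ℕ) : Submodule ℂ (Cd d → ℂ) :=
  Submodule.span ℂ {f | ∃ α : Fin d → ℕ, ∑ i, α i = m ∧ f = mono α}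

theorem mono_mem_homogPoly (α : Fin d → ℕ) : mono α ∈ homogPoly d (∑ i, α i) :=
  Submodule.subset_span ⟨α, rfl, rfl⟩

theorem mono_zero : mono (0 : Fin d → ℕ) = fun _ => 1 := by ext; simp [mono]

theorem mono_smul (α : Fin d → ℕ) (a : ℂ) (x : Cd d) :
    mono α (a • x) = a ^ (∑ i, α i) * mono α x := by
  simp [mono, mul_pow, Finset.prod_mul_distrib, Finset.prod_pow_eq_pow_sum]

theorem mono_add_single (α : Fin d → ℕ) (i : Fin d) (x : Cd d) :
    mono (α + Pi.single i 1) x = x i * mono α x := by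
  simp only [mono, Pi.add_apply, pow_add, Finset.prod_mul_distrib]
  rw [mul_comm]
  congr 1
  rw [Finset.prod_eq_single i]
  · simp
  · intro j _ hj; simp [hj]
  · simp

theorem differentiable_mono (α : Fin d → ℕ) : Differentiable ℂ (mono α) := by
  unfold mono
  fun_prop

theorem coord_mul_mem_homogPoly {m : ℕ} {p : Cd d → ℂ} (hp : p ∈ homogPoly d m) (i : Fin d) :
    (fun x : Cd d => x i * p x) ∈ homogPoly d (m + 1) := by
  induction hp using Submodule.span_induction with
  | mem f hf =>
    obtain ⟨α, rfl, rfl⟩ := hf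
    refine Submodule.subset_span ⟨α + Pi.single i 1, ?_, ?_⟩
    · simp [Finset.sum_add_distrib]
    · ext x; rw [mono_add_single]
  | zero =>
    convert (homogPoly d (m + 1)).zero_mem using 1
    ext x; simp
  | add f g _ _ hf hg =>
    convert (homogPoly d (m + 1)).add_mem hf hg using 1
    ext x; simp [mul_add]
  | smul a f _ hf =>
    convert (homogPoly d (m + 1)).smul_mem a hf using 1
    ext x; simp; ring

theorem sum_coord_mul_mem_homogPoly {m : ℕ} {p : Fin d → Cd d → ℂ}
    (hp : ∀ i, p i ∈ homogPoly d m) (a : Fin d → ℂ) :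
    (fun x : Cd d => ∑ i, a i * (x i * p i x)) ∈ homogPoly d (m + 1) := by
  have : (fun x : Cd d => ∑ i, a i * (x i * p i x)) =
      ∑ i, a i • fun x : Cd d => x i * p i x := by
    ext x; simp
  rw [this]
  exact Submodule.sum_mem _ fun i _ => Submodule.smul_mem _ _ (coord_mul_mem_homogPoly (hp i) i)

/-- A holomorphic function on the unit ball that is homogeneous of degree `m` is a homogeneous
polynomial. -/
theorem exists_homogPoly_of_homogeneous (m : ℕ) : ∀ g : Cd d → ℂ,
    DifferentiableOn ℂ g (ball 0 1) →
    (∀ z ∈ ball (0 : Cd d) 1, ∀ a : ℂ, a ≠ 0 → a • z ∈ ball (0 : Cd d) 1 →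
      g (a • z) = a ^ m * g z) →
    ∃ p ∈ homogPoly d m, ∀ z ∈ ball (0 : Cd d) 1, g z = p z := by
  induction m with
  | zero =>
    intro g hg h
    refine ⟨g 0 • mono 0, Submodule.smul_mem _ _ (Submodule.subset_span ⟨0, by simp, rfl⟩), ?_⟩
    intro z hz
    -- Degree 0 means that `g` is constant on punctured discs through the origin; continuity at 0
    -- identifies all these constants.
    have h0 : ContinuousAt g 0 := (hg.differentiableAt (ball_mem_nhds _ one_pos)).continuousAt
    have h1 : Tendsto (fun t : ℂ => t • z) (𝓝[≠] 0) (𝓝 0) := by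
      have : Tendsto (fun t : ℂ => t • z) (𝓝 0) (𝓝 ((0 : ℂ) • z)) :=
        (continuous_id.smul continuous_const).tendsto 0
      rw [zero_smul] at this
      exact this.mono_left nhdsWithin_le_nhds
    have h2 : Tendsto (fun t : ℂ => g (t • z)) (𝓝[≠] 0) (𝓝 (g 0)) := h0.tendsto.comp h1
    have h3 : Tendsto (fun t : ℂ => g (t • z)) (𝓝[≠] 0) (𝓝 (g z)) := by
      refine tendsto_const_nhds.congr' ?_
      filter_upwards [eventually_norm_lt_one_and_ne_zero] with t ht
      rw [h z hz t ht.2 (smul_mem_unitBall hz ht.1.le)]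
      simp
    rw [tendsto_nhds_unique h3 h2]
    simp [mono_zero]
  | succ m ih =>
    intro g hg h
    -- Differentiating the homogeneity relation shows that the partial derivatives are homogeneous
    -- of degree `m`, hence polynomials by induction.
    have hp : ∀ i : Fin d, ∃ p ∈ homogPoly d m, ∀ z ∈ ball (0 : Cd d) 1,
        fderiv ℂ g z (EuclideanSpace.single i 1) = p z := by
      intro i
      refine ih _ (hg.fderiv_apply isOpen_ball _) fun z hz a ha haz => ?_
      have h1 : HasFDerivAt (fun w => g (a • w)) (a • fderiv ℂ g (a • z)) z := by
        have h2 : HasFDerivAt (fun w : Cd d => a • w) (a • ContinuousLinearMap.id ℂ (Cd d)) z :=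
          (hasFDerivAt_id z).const_smul a
        have h3 := ((hg.differentiableAt (isOpen_ball.mem_nhds haz)).hasFDerivAt).comp z h2
        convert! h3 using 1
        ext; simp
      have h2 : HasFDerivAt (fun w => g (a • w)) (a ^ (m + 1) • fderiv ℂ g z) z := by
        refine ((hg.differentiableAt (isOpen_ball.mem_nhds hz)).hasFDerivAt.const_mul
          (a ^ (m + 1))).congr_of_eventuallyEq ?_
        have : ∀ᶠ w in 𝓝 z, a • w ∈ ball (0 : Cd d) 1 :=
          (continuous_const_smul a).continuousAt.eventually (isOpen_ball.mem_nhds haz)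
        filter_upwards [this, isOpen_ball.mem_nhds hz] with w hw hw'
        exact h w hw' a ha hw
      have h3 := congrArg (fun L : Cd d →L[ℂ] ℂ => L (EuclideanSpace.single i 1)) (h1.unique h2)
      simp only [smul_apply, smul_eq_mul, pow_succ'] at h3
      exact mul_left_cancel₀ ha (h3.trans (mul_assoc _ _ _))
    choose p hp hpz using hp
    refine ⟨_, sum_coord_mul_mem_homogPoly hp fun _ => ((m : ℂ) + 1)⁻¹, fun z hz => ?_⟩
    have hz1 : (1 : ℂ) • z ∈ ball (0 : Cd d) 1 := by simpa using hz
    -- Euler's identity: the derivative of t ↦ g(tz) at t = 1 is computed by the chain rule and by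
    -- homogeneity, which recovers `g` from its partial derivatives.
    have h1 : HasDerivAt (fun t : ℂ => g (t • z)) (fderiv ℂ g z z) 1 := by
      have h3 : HasFDerivAt g (fderiv ℂ g z) ((1 : ℂ) • z) := by
        simpa using (hg.differentiableAt (isOpen_ball.mem_nhds hz)).hasFDerivAt
      have h4 : HasDerivAt (fun t : ℂ => t • z) z 1 := by
        simpa using (hasDerivAt_id (1 : ℂ)).smul_const z
      exact h3.comp_hasDerivAt (1 : ℂ) h4
    have h2 : HasDerivAt (fun t : ℂ => g (t • z)) (((m : ℂ) + 1) * g z) 1 := by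
      have h3 : HasDerivAt (fun t : ℂ => t ^ (m + 1) * g z) (((m : ℂ) + 1) * g z) 1 := by
        simpa using (hasDerivAt_pow (m + 1) (1 : ℂ)).mul_const (g z)
      refine h3.congr_of_eventuallyEq ?_
      have h4 : ∀ᶠ t : ℂ in 𝓝 1, t • z ∈ ball (0 : Cd d) 1 :=
        (continuous_id.smul continuous_const).continuousAt.eventually (isOpen_ball.mem_nhds hz1)
      filter_upwards [h4, isOpen_ne.mem_nhds (one_ne_zero : (1 : ℂ) ≠ 0)] with t ht ht0
      exact h z hz t ht0 ht
    have h3 : fderiv ℂ g z z = ∑ i, z i * p i z := by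
      have key : ∀ L : Cd d →L[ℂ] ℂ, L z = ∑ i, z i * L (EuclideanSpace.single i 1) := by
        intro L
        conv_lhs => rw [← (EuclideanSpace.basisFun (Fin d) ℂ).sum_repr z]
        simp
      rw [key]
      exact Finset.sum_congr rfl fun i _ => by rw [hpz i z hz]
    have h4 : ((m : ℂ) + 1) * g z = ∑ i, z i * p i z := by
      rw [← h3]; exact h2.unique h1
    have h5 : ((m : ℂ) + 1) ≠ 0 := by exact_mod_cast Nat.succ_ne_zero m
    rw [← Finset.mul_sum, ← h4, inv_mul_cancel_left₀ h5]

theorem homogPoly_le_span_range_mono (m : ℕ) :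
    homogPoly d m ≤ Submodule.span ℂ (Set.range (mono (d := d))) := by
  refine Submodule.span_mono ?_
  rintro _ ⟨α, _, rfl⟩
  exact ⟨α, rfl⟩

theorem continuous_of_mem_span_mono {p : Cd d → ℂ}
    (hp : p ∈ Submodule.span ℂ (Set.range (mono (d := d)))) : Continuous p := by
  induction hp using Submodule.span_induction with
  | mem f hf => obtain ⟨α, rfl⟩ := hf; exact (differentiable_mono α).continuous
  | zero => exact continuous_zero
  | add f g _ _ hf hg => exact hf.add hg
  | smul a f _ hf => exact hf.const_smul a

/-- Functions continuous on the closed unit ball and holomorphic inside are uniform limits of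
polynomials. -/
theorem exists_poly_norm_sub_le {u : Cd d → ℂ} (hu : DiffContOnCl ℂ u (ball 0 1)) {ε : ℝ}
    (hε : 0 < ε) : ∃ p ∈ Submodule.span ℂ (Set.range (mono (d := d))),
      ∀ z ∈ closedBall (0 : Cd d) 1, ‖u z - p z‖ ≤ ε := by
  have hcl : closure (ball (0 : Cd d) 1) = closedBall 0 1 := closure_ball _ one_ne_zero
  have hcont : ContinuousOn u (closedBall 0 1) := hcl ▸ hu.continuousOn
  have hcomp : IsCompact (closedBall (0 : Cd d) 1) := isCompact_closedBall _ _
  obtain ⟨M, hM⟩ := hcomp.exists_bound_of_continuousOn hcont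
  have huc := hcomp.uniformContinuousOn_of_continuous hcont
  obtain ⟨δ, hδ, hδu⟩ := Metric.uniformContinuousOn_iff.1 huc (ε / 2) (half_pos hε)
  -- The dilate u(tz) is uniformly close to u(z) by uniform continuity, and its homogeneous
  -- expansion converges uniformly on the ball at the geometric rate t.
  obtain ⟨t, ht0, ht1, htδ⟩ : ∃ t : ℝ, 0 < t ∧ t < 1 ∧ 1 - t < δ := by
    refine ⟨max (1 / 2) (1 - δ / 2), lt_max_of_lt_left (by norm_num),
      max_lt (by norm_num) (by linarith), ?_⟩
    linarith [le_max_right (1 / 2) (1 - δ / 2)]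
  have hM' : ∀ z ∈ ball (0 : Cd d) 1, ‖u z‖ ≤ M := fun z hz => hM z (ball_subset_closedBall hz)
  have htn : ‖(t : ℂ)‖ = t := by rw [Complex.norm_real, Real.norm_of_nonneg ht0.le]
  have hlim : Tendsto (fun m : ℕ => M * t ^ m / (1 - t)) atTop (𝓝 0) := by
    simpa using ((tendsto_pow_atTop_nhds_zero_of_lt_one ht0.le ht1).const_mul M).div_const (1 - t)
  obtain ⟨N, hN⟩ := (hlim.eventually (gt_mem_nhds (half_pos hε))).exists
  have hp : ∀ m, ∃ p ∈ homogPoly d m, ∀ z ∈ ball (0 : Cd d) 1, homogComponent m u z = p z :=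
    fun m => exists_homogPoly_of_homogeneous m _
      (differentiableOn_homogComponent hu.differentiableOn hM' m) fun z hz a ha haz =>
        homogComponent_smul hu.differentiableOn hM' m hz ha haz
  choose p hp hpz using hp
  have hmem : ∑ j ∈ Finset.range N, ((t : ℂ) ^ j) • p j ∈
      Submodule.span ℂ (Set.range (mono (d := d))) :=
    Submodule.sum_mem _ fun j _ => Submodule.smul_mem _ _ (homogPoly_le_span_range_mono j (hp j))
  refine ⟨_, hmem, ?_⟩
  have hball : ∀ z ∈ ball (0 : Cd d) 1,
      ‖u z - (∑ j ∈ Finset.range N, ((t : ℂ) ^ j) • p j) z‖ ≤ ε := by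
    intro z hz
    have h1 := norm_sub_sum_homogComponent_le hu.differentiableOn hM' N hz (t := t) (by rwa [htn])
    rw [htn] at h1
    have h2 : (∑ j ∈ Finset.range N, ((t : ℂ) ^ j) • p j) z =
        ∑ j ∈ Finset.range N, (t : ℂ) ^ j * homogComponent j u z := by
      simp [hpz _ z hz]
    have h3 : dist (u z) (u ((t : ℂ) • z)) < ε / 2 := by
      refine hδu z (ball_subset_closedBall hz) _
        (ball_subset_closedBall (smul_mem_unitBall hz (by rw [htn]; exact ht1.le))) ?_
      have h4 : z - (t : ℂ) • z = ((1 - t : ℝ) : ℂ) • z := by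
        push_cast; rw [sub_smul, one_smul]
      rw [dist_eq_norm, h4, norm_smul, Complex.norm_real, Real.norm_of_nonneg (by linarith)]
      rw [mem_ball_zero_iff] at hz
      nlinarith [norm_nonneg z]
    rw [dist_eq_norm] at h3
    rw [h2]
    have h5 := norm_sub_le_norm_sub_add_norm_sub (u z) (u ((t : ℂ) • z))
      (∑ j ∈ Finset.range N, (t : ℂ) ^ j * homogComponent j u z)
    linarith
  intro z hz
  refine le_on_closure (s := ball (0 : Cd d) 1) hball ?_ continuousOn_const (hcl.symm ▸ hz)
  rw [hcl]
  exact (hcont.sub (continuous_of_mem_span_mono hmem).continuousOn).norm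

end

/-! ### Unitary invariance and the reproducing kernel on the sphere -/

noncomputable section

open scoped Pointwise ComplexConjugate

/-- The normalised surface measure on the unit sphere of `ℂ^d`. -/
def unitSphereMeasure (d : ℕ) : Measure (sphere (0 : Cd d) 1) :=
  ((volume : Measure (Cd d)).toSphere Set.univ)⁻¹ • (volume : Measure (Cd d)).toSphere

instance (e : ℕ) : IsProbabilityMeasure (unitSphereMeasure (e + 1)) := by
  refine ⟨?_⟩
  rw [unitSphereMeasure, Measure.smul_apply, smul_eq_mul]
  refine ENNReal.inv_mul_cancel ?_ (measure_ne_top _ _)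
  rw [Measure.measure_univ_ne_zero]
  exact Measure.toSphere_ne_zero _

instance (d : ℕ) : (unitSphereMeasure d).IsOpenPosMeasure :=
  Measure.isOpenPosMeasure_smul _ (ENNReal.inv_ne_zero.2 (measure_ne_top _ _))

/-- The action of a unitary map on the unit sphere. -/
def sphereMap {d : ℕ} (U : Cd d ≃ₗᵢ[ℂ] Cd d) (x : sphere (0 : Cd d) 1) : sphere (0 : Cd d) 1 :=
  ⟨U x, by simp⟩

theorem continuous_sphereMap {d : ℕ} (U : Cd d ≃ₗᵢ[ℂ] Cd d) : Continuous (sphereMap U) := by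
  unfold sphereMap
  exact (U.continuous.comp continuous_subtype_val).subtype_mk _

/-- The surface measure of a set is a multiple of the volume of the cone over it, and a unitary map,
as a real isometry, preserves volume and carries cones to cones. -/
theorem map_sphereMap {d : ℕ} (U : Cd d ≃ₗᵢ[ℂ] Cd d) :
    (unitSphereMeasure d).map (sphereMap U) = unitSphereMeasure d := by
  have hm : Measurable (sphereMap U) := (continuous_sphereMap U).measurable
  let V : Cd d ≃ₗᵢ[ℝ] Cd d := { U.toLinearEquiv.restrictScalars ℝ with norm_map' := U.norm_map }
  have hV : MeasurePreserving V volume volume := V.measurePreserving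
  rw [unitSphereMeasure, Measure.map_smul]
  congr 1
  ext s hs
  rw [Measure.map_apply hm hs, Measure.toSphere_apply' _ (hm hs), Measure.toSphere_apply' _ hs]
  congr 1
  have h1 : Set.Ioo (0 : ℝ) 1 • ((↑) '' (sphereMap U ⁻¹' s) : Set (Cd d)) =
      V ⁻¹' (Set.Ioo (0 : ℝ) 1 • ((↑) '' s : Set (Cd d))) := by
    ext y
    simp only [Set.mem_smul, Set.mem_preimage]
    constructor
    · rintro ⟨a, ha, _, ⟨x, hx, rfl⟩, rfl⟩
      exact ⟨a, ha, _, ⟨sphereMap U x, hx, rfl⟩, (V.map_smul a _).symm⟩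
    · rintro ⟨a, ha, _, ⟨x, hx, rfl⟩, hxy⟩
      have hx' : sphereMap U (sphereMap U.symm x) = x := by
        ext1
        exact U.apply_symm_apply _
      refine ⟨a, ha, _, ⟨sphereMap U.symm x, by rw [Set.mem_preimage, hx']; exact hx, rfl⟩, ?_⟩
      apply V.injective
      rw [← hxy, V.map_smul]
      exact congrArg (fun z : sphere (0 : Cd d) 1 => a • (z : Cd d)) hx'
  rw [h1]
  exact hV.measure_preimage_equiv (f := V.toHomeomorph.toMeasurableEquiv) _

theorem integral_comp_unitary {d : ℕ} {F : Type*} [NormedAddCommGroup F] [NormedSpace ℝ F]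
    (U : Cd d ≃ₗᵢ[ℂ] Cd d) {f : Cd d → F} (hf : Continuous f) :
    ∫ x : sphere (0 : Cd d) 1, f (U x) ∂unitSphereMeasure d =
      ∫ x : sphere (0 : Cd d) 1, f x ∂unitSphereMeasure d := by
  conv_rhs => rw [← map_sphereMap U]
  rw [integral_map (continuous_sphereMap U).aemeasurable]
  · rfl
  · have : Continuous fun x : sphere (0 : Cd d) 1 => f x := hf.comp continuous_subtype_val
    exact this.aestronglyMeasurable_of_compactSpace

/-- The unitary group acts transitively on the unit sphere. -/
theorem exists_unitary_apply_eq {e : ℕ} {x y : Cd (e + 1)} (hx : ‖x‖ = 1) (hy : ‖y‖ = 1) :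
    ∃ U : Cd (e + 1) ≃ₗᵢ[ℂ] Cd (e + 1), U x = y := by
  have key : ∀ x : Cd (e + 1), ‖x‖ = 1 →
      ∃ b : OrthonormalBasis (Fin (e + 1)) ℂ (Cd (e + 1)), b 0 = x := by
    intro x hx
    have ho : Orthonormal ℂ (({0} : Set (Fin (e + 1))).domRestrict (fun _ => x)) := by
      refine ⟨fun i => hx, fun i j hij => ?_⟩
      exact absurd (Subsingleton.elim i j) hij
    obtain ⟨b, hb⟩ := ho.exists_orthonormalBasis_extension_of_card_eq (by simp)
    exact ⟨b, hb 0 rfl⟩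
  obtain ⟨b, hb⟩ := key x hx
  obtain ⟨b', hb'⟩ := key y hy
  refine ⟨b.equiv b' (Equiv.refl _), ?_⟩
  rw [← hb, ← hb']
  simp

variable {e : ℕ}

theorem continuous_mono {d : ℕ} (α : Fin d → ℕ) : Continuous (mono α) :=
  (differentiable_mono α).continuous

/-- Multiplication of one coordinate by a number of modulus `1`. -/
def rotateCoord {d : ℕ} (i : Fin d) (a : ℂ) (ha : ‖a‖ = 1) : Cd d ≃ₗᵢ[ℂ] Cd d :=
  LinearIsometryEquiv.piLpCongrRight 2 fun j =>
    if j = i then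
      { LinearEquiv.smulOfNeZero ℂ ℂ a (norm_ne_zero_iff.1 (ha ▸ one_ne_zero)) with
        norm_map' := fun z => by change ‖a • z‖ = ‖z‖; rw [norm_smul, ha, one_mul] }
    else LinearIsometryEquiv.refl ℂ ℂ

theorem mono_rotateCoord {d : ℕ} (α : Fin d → ℕ) (i : Fin d) (a : ℂ) (ha : ‖a‖ = 1) (x : Cd d) :
    mono α (rotateCoord i a ha x) = a ^ α i * mono α x := by
  have h : ∀ j, rotateCoord i a ha x j = (if j = i then a else 1) * x j := by
    intro j
    by_cases hj : j = i
    · subst hj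
      simp [rotateCoord]
    · simp [rotateCoord, hj]
  simp only [mono, h, mul_pow, Finset.prod_mul_distrib]
  congr 1
  rw [Finset.prod_eq_single i]
  · simp
  · intro j _ hj; simp [hj]
  · simp

/-- If β_i - α_i = k + 1 > 0, multiplying the i-th coordinate by exp(πi/(k+1)) preserves the measure
and changes the sign of the integrand. The opposite case follows by conjugation. -/
theorem integral_conj_mono_mul_mono {d : ℕ} {α β : Fin d → ℕ} (h : α ≠ β) :
    ∫ x : sphere (0 : Cd d) 1, conj (mono α x) * mono β x ∂unitSphereMeasure d = 0 := by
  have key : ∀ α β : Fin d → ℕ, (∃ i, α i < β i) →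
      ∫ x : sphere (0 : Cd d) 1, conj (mono α x) * mono β x ∂unitSphereMeasure d = 0 := by
    rintro α β ⟨i, hi⟩
    obtain ⟨k, hk⟩ := Nat.exists_eq_add_of_lt hi
    set a : ℂ := Complex.exp ((Real.pi / (k + 1) : ℝ) * Complex.I) with ha_def
    have ha : ‖a‖ = 1 := Complex.norm_exp_ofReal_mul_I _
    have hak : a ^ (k + 1) = -1 := by
      rw [ha_def, ← Complex.exp_nat_mul, ← Complex.exp_pi_mul_I]
      congr 1
      push_cast
      field_simp
    have haa : conj a * a = 1 := by
      rw [mul_comm, Complex.mul_conj, Complex.normSq_eq_norm_sq, ha]; simp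
    have h1 := integral_comp_unitary (rotateCoord i a ha)
      (f := fun x => conj (mono α x) * mono β x)
      ((Complex.continuous_conj.comp (continuous_mono α)).mul (continuous_mono β))
    have h2 : ∀ x : Cd d, conj (mono α (rotateCoord i a ha x)) * mono β (rotateCoord i a ha x) =
        -(conj (mono α x) * mono β x) := by
      intro x
      have h3 : conj a ^ α i * a ^ β i = -1 := by
        rw [hk, add_assoc, pow_add, ← mul_assoc, ← mul_pow, haa, one_pow, one_mul, hak]
      rw [mono_rotateCoord, mono_rotateCoord, map_mul, map_pow]
      linear_combination (conj (mono α x) * mono β x) * h3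
    simp only [h2] at h1
    rw [integral_neg] at h1
    exact self_eq_neg.1 h1.symm
  obtain ⟨i, hi⟩ := Function.ne_iff.1 h
  rcases lt_or_gt_of_ne hi with hi | hi
  · exact key α β ⟨i, hi⟩
  · have h1 := congrArg conj (key β α ⟨i, hi⟩)
    rw [← integral_conj, map_zero] at h1
    simpa [mul_comm] using h1

/-- The square of the `L²`-norm of a monomial on the unit sphere. -/
def monoNormSq {d : ℕ} (α : Fin d → ℕ) : ℝ :=
  ∫ x : sphere (0 : Cd d) 1, ‖mono α x‖ ^ 2 ∂unitSphereMeasure d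

/-- No monomial vanishes at the normalised vector (1, …, 1), and the measure charges open sets. -/
theorem monoNormSq_pos (α : Fin (e + 1) → ℕ) : 0 < monoNormSq α := by
  let y : Cd (e + 1) := WithLp.toLp 2 fun _ => 1
  have hy : y ≠ 0 := fun h => by
    have := congrArg (fun z : Cd (e + 1) => z 0) h
    simp [y] at this
  have hy1 : ‖((‖y‖⁻¹ : ℝ) : ℂ) • y‖ = 1 := by
    rw [norm_smul, Complex.norm_real, norm_inv, norm_norm, inv_mul_cancel₀ (norm_ne_zero_iff.2 hy)]
  let x : sphere (0 : Cd (e + 1)) 1 := ⟨((‖y‖⁻¹ : ℝ) : ℂ) • y, by simpa using hy1⟩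
  have hc : Continuous fun x : sphere (0 : Cd (e + 1)) 1 => ‖mono α x‖ ^ 2 :=
    (((continuous_mono α).comp continuous_subtype_val).norm.pow 2)
  refine hc.integral_pos_of_hasCompactSupport_nonneg_nonzero (x := x)
    (HasCompactSupport.of_compactSpace _) (fun _ => by positivity) ?_
  have : mono α x = (((‖y‖⁻¹ : ℝ) : ℂ)) ^ (∑ i, α i) * mono α y := mono_smul _ _ _
  have hy2 : mono α y = 1 := by simp [mono, y]
  rw [this, hy2, mul_one]
  simp [hy]

/-- Monomials normalised in `L²` of the unit sphere. -/
def normMono {d : ℕ} (α : Fin d → ℕ) (x : Cd d) : ℂ := ((√(monoNormSq α))⁻¹ : ℝ) * mono α x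

theorem continuous_normMono {d : ℕ} (α : Fin d → ℕ) : Continuous (normMono α) :=
  continuous_const.mul (continuous_mono α)

theorem differentiable_normMono {d : ℕ} (α : Fin d → ℕ) : Differentiable ℂ (normMono α) :=
  (differentiable_mono α).const_mul _

theorem normMono_smul {d : ℕ} (α : Fin d → ℕ) (a : ℂ) (x : Cd d) :
    normMono α (a • x) = a ^ (∑ i, α i) * normMono α x := by
  rw [normMono, normMono, mono_smul]; ring

theorem mono_eq_smul_normMono (α : Fin (e + 1) → ℕ) :
    mono α = ((√(monoNormSq α) : ℝ) : ℂ) • normMono α := by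
  ext x
  have h : ((√(monoNormSq α) : ℝ) : ℂ) ≠ 0 := by
    exact_mod_cast (Real.sqrt_pos.2 (monoNormSq_pos α)).ne'
  simp only [Pi.smul_apply, normMono, smul_eq_mul, Complex.ofReal_inv]
  rw [mul_inv_cancel_left₀ h]

theorem integral_conj_normMono_mul_normMono (α β : Fin (e + 1) → ℕ) :
    ∫ x : sphere (0 : Cd (e + 1)) 1, conj (normMono α x) * normMono β x
      ∂unitSphereMeasure (e + 1) = if α = β then 1 else 0 := by
  have h1 : ∀ x : Cd (e + 1), conj (normMono α x) * normMono β x =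
      (((√(monoNormSq α))⁻¹ : ℝ) * ((√(monoNormSq β))⁻¹ : ℝ) : ℂ) *
        (conj (mono α x) * mono β x) := by
    intro x
    simp only [normMono, map_mul, Complex.conj_ofReal]
    ring
  simp only [h1]
  rw [integral_const_mul]
  split_ifs with h
  · subst h
    have h2 : ∀ x : Cd (e + 1), conj (mono α x) * mono α x = ((‖mono α x‖ ^ 2 : ℝ) : ℂ) := by
      intro x
      rw [mul_comm, Complex.mul_conj, Complex.normSq_eq_norm_sq]
    simp only [h2]
    rw [integral_complex_ofReal]
    have h3 := monoNormSq_pos α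
    change _ * ((monoNormSq α : ℝ) : ℂ) = 1
    norm_cast
    rw [← mul_inv, Real.mul_self_sqrt h3.le, inv_mul_cancel₀ h3.ne']
  · rw [integral_conj_mono_mul_mono h, mul_zero]

/-- The exponents of degree `m`. -/
def expts (e m : ℕ) : Finset (Fin (e + 1) → ℕ) := Finset.piAntidiag Finset.univ m

theorem mem_expts {m : ℕ} {α : Fin (e + 1) → ℕ} : α ∈ expts e m ↔ ∑ i, α i = m := by
  simp [expts, Finset.mem_piAntidiag]

theorem card_expts (e m : ℕ) : (expts e m).card = (m + e).choose e := by
  have h1 : (expts e m).card = Fintype.card (Sym (Fin (e + 1)) m) :=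
    Finset.card_eq_of_equiv_fintype
      (Equiv.trans (Equiv.subtypeEquivRight fun α => mem_expts)
        (Sym.equivNatSumOfFintype (Fin (e + 1)) m).symm)
  rw [h1, Sym.card_sym_eq_choose, Fintype.card_fin]
  have : e + 1 + m - 1 = m + e := by omega
  rw [this, Nat.choose_symm_add]

theorem integrable_of_continuous_sphere {F : Type*} [NormedAddCommGroup F]
    {f : sphere (0 : Cd (e + 1)) 1 → F} (hf : Continuous f) :
    Integrable f (unitSphereMeasure (e + 1)) :=
  hf.integrable_of_hasCompactSupport (HasCompactSupport.of_compactSpace _)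

theorem exists_eq_sum_normMono {m : ℕ} {p : Cd (e + 1) → ℂ} (hp : p ∈ homogPoly (e + 1) m) :
    ∃ a : (Fin (e + 1) → ℕ) → ℂ, ∀ x, p x = ∑ α ∈ expts e m, a α * normMono α x := by
  induction hp using Submodule.span_induction with
  | mem f hf =>
    obtain ⟨α, hα, rfl⟩ := hf
    refine ⟨Pi.single α ((√(monoNormSq α) : ℝ) : ℂ), fun x => ?_⟩
    rw [Finset.sum_eq_single α, mono_eq_smul_normMono]
    · simp
    · intro β _ hβ; simp [hβ]
    · intro h; exact absurd (mem_expts.2 hα) h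
  | zero => exact ⟨0, fun x => by simp⟩
  | add f g _ _ hf hg =>
    obtain ⟨a, ha⟩ := hf
    obtain ⟨b, hb⟩ := hg
    exact ⟨a + b, fun x => by simp [ha, hb, add_mul, Finset.sum_add_distrib]⟩
  | smul c f _ hf =>
    obtain ⟨a, ha⟩ := hf
    exact ⟨c • a, fun x => by simp [ha, Finset.mul_sum, mul_assoc]⟩

theorem integral_norm_sum_normMono_sq (s : Finset (Fin (e + 1) → ℕ))
    (a : (Fin (e + 1) → ℕ) → ℂ) :
    ∫ x : sphere (0 : Cd (e + 1)) 1, ‖∑ α ∈ s, a α * normMono α x‖ ^ 2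
      ∂unitSphereMeasure (e + 1) = ∑ α ∈ s, ‖a α‖ ^ 2 := by
  have hc : ∀ α : Fin (e + 1) → ℕ, Continuous fun x : sphere (0 : Cd (e + 1)) 1 => normMono α x :=
    fun α => (continuous_normMono α).comp continuous_subtype_val
  have h1 : ∀ x : Cd (e + 1), ((‖∑ α ∈ s, a α * normMono α x‖ ^ 2 : ℝ) : ℂ) =
      ∑ α ∈ s, ∑ β ∈ s, (conj (a α) * a β) * (conj (normMono α x) * normMono β x) := by
    intro x
    rw [← Complex.normSq_eq_norm_sq, ← Complex.mul_conj, mul_comm, map_sum, Finset.sum_mul_sum]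
    refine Finset.sum_congr rfl fun α _ => Finset.sum_congr rfl fun β _ => ?_
    rw [map_mul]; ring
  apply Complex.ofReal_injective
  rw [← integral_complex_ofReal]
  simp only [h1]
  have hint : ∀ α β : Fin (e + 1) → ℕ, Integrable (fun x : sphere (0 : Cd (e + 1)) 1 =>
      (conj (a α) * a β) * (conj (normMono α x) * normMono β x)) (unitSphereMeasure (e + 1)) :=
    fun α β => integrable_of_continuous_sphere
      (continuous_const.mul ((Complex.continuous_conj.comp (hc α)).mul (hc β)))
  rw [integral_finsetSum _ fun α _ => integrable_finsetSum _ fun β _ => hint α β]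
  push_cast
  refine Finset.sum_congr rfl fun α hα => ?_
  rw [integral_finsetSum _ fun β _ => hint α β]
  simp only [integral_const_mul, integral_conj_normMono_mul_normMono]
  rw [Finset.sum_eq_single α]
  · simp only [if_true, mul_one]
    rw [mul_comm, Complex.mul_conj, Complex.normSq_eq_norm_sq]
    push_cast
    rfl
  · intro β _ hβ; simp [hβ.symm]
  · intro h; exact absurd hα h

/-- The reproducing kernel of the homogeneous polynomials of degree `m`, on the diagonal. -/
def homogKernel (e m : ℕ) (x : Cd (e + 1)) : ℝ := ∑ α ∈ expts e m, ‖normMono α x‖ ^ 2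

theorem homogKernel_nonneg (m : ℕ) (x : Cd (e + 1)) : 0 ≤ homogKernel e m x :=
  Finset.sum_nonneg fun _ _ => by positivity

theorem norm_sum_mul_sq_le {ι : Type*} (s : Finset ι) (a b : ι → ℂ) :
    ‖∑ i ∈ s, a i * b i‖ ^ 2 ≤ (∑ i ∈ s, ‖a i‖ ^ 2) * ∑ i ∈ s, ‖b i‖ ^ 2 := by
  have h1 : ‖∑ i ∈ s, a i * b i‖ ≤ ∑ i ∈ s, ‖a i‖ * ‖b i‖ :=
    (norm_sum_le _ _).trans (le_of_eq (by simp))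
  exact (pow_le_pow_left₀ (norm_nonneg _) h1 2).trans (Finset.sum_mul_sq_le_sq_mul_sq _ _ _)

/-- Cauchy–Schwarz in the orthonormal monomials. This inequality makes no reference to a basis on
the polynomial side, so it can be transported by unitary maps. -/
theorem norm_sq_le_homogKernel_mul {m : ℕ} {p : Cd (e + 1) → ℂ} (hp : p ∈ homogPoly (e + 1) m)
    (y : Cd (e + 1)) : ‖p y‖ ^ 2 ≤ homogKernel e m y *
      ∫ x : sphere (0 : Cd (e + 1)) 1, ‖p x‖ ^ 2 ∂unitSphereMeasure (e + 1) := by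
  obtain ⟨a, ha⟩ := exists_eq_sum_normMono hp
  simp only [ha]
  rw [integral_norm_sum_normMono_sq, mul_comm]
  exact norm_sum_mul_sq_le _ _ _

theorem prod_linear_mem_homogPoly {d : ℕ} (L : Fin d → Fin d → ℂ) (α : Fin d → ℕ)
    (s : Finset (Fin d)) :
    (fun x : Cd d => ∏ i ∈ s, (∑ j, L i j * x j) ^ α i) ∈ homogPoly d (∑ i ∈ s, α i) := by
  have hlin : ∀ (a : Fin d → ℂ) (m : ℕ) (p : Cd d → ℂ), p ∈ homogPoly d m →
      (fun x : Cd d => (∑ j, a j * x j) * p x) ∈ homogPoly d (m + 1) := by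
    intro a m p hp
    convert sum_coord_mul_mem_homogPoly (fun _ => hp) a using 1
    ext x
    simp only [Finset.sum_mul, mul_assoc]
  have hpow : ∀ (a : Fin d → ℂ) (k m : ℕ) (p : Cd d → ℂ), p ∈ homogPoly d m →
      (fun x : Cd d => (∑ j, a j * x j) ^ k * p x) ∈ homogPoly d (k + m) := by
    intro a k m p hp
    induction k with
    | zero => simpa using hp
    | succ k ih =>
      rw [show k + 1 + m = k + m + 1 by omega]
      convert hlin a _ _ ih using 1
      ext x; ring
  induction s using Finset.induction_on with
  | empty =>
    have := mono_mem_homogPoly (0 : Fin d → ℕ)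
    simpa [mono_zero] using this
  | insert i s hi ih =>
    simp only [Finset.prod_insert hi, Finset.sum_insert hi]
    exact hpow _ _ _ _ ih

theorem comp_linear_mem_homogPoly {d m : ℕ} {p : Cd d → ℂ} (hp : p ∈ homogPoly d m)
    (A : Cd d →ₗ[ℂ] Cd d) : (fun x => p (A x)) ∈ homogPoly d m := by
  induction hp using Submodule.span_induction with
  | mem f hf =>
    obtain ⟨α, rfl, rfl⟩ := hf
    have h : ∀ (x : Cd d) i, A x i = ∑ j, A (EuclideanSpace.single j 1) i * x j := by
      intro x i
      conv_lhs => rw [← (EuclideanSpace.basisFun (Fin d) ℂ).sum_repr x]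
      simp [mul_comm]
    have h2 := prod_linear_mem_homogPoly (fun i j => A (EuclideanSpace.single j 1) i) α Finset.univ
    convert h2 using 1
    ext x
    exact Finset.prod_congr rfl fun i _ => by rw [h x i]
  | zero => exact (homogPoly d m).zero_mem
  | add f g _ _ hf hg => exact (homogPoly d m).add_mem hf hg
  | smul a f _ hf => exact (homogPoly d m).smul_mem a hf

/-- The kernel function `q` at `y` has both q(y) and ‖q‖² equal to K(y). Applying the pointwise
bound to its unitary translate at `U y` gives K(y)² ≤ K(Uy) K(y). -/
theorem homogKernel_le_apply (m : ℕ) (U : Cd (e + 1) ≃ₗᵢ[ℂ] Cd (e + 1)) (y : Cd (e + 1)) :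
    homogKernel e m y ≤ homogKernel e m (U y) := by
  let q : Cd (e + 1) → ℂ := fun x => ∑ α ∈ expts e m, conj (normMono α y) * normMono α x
  have hq : q ∈ homogPoly (e + 1) m := by
    have : q = ∑ α ∈ expts e m, conj (normMono α y) • normMono α := by
      ext x; simp [q]
    rw [this]
    refine Submodule.sum_mem _ fun α hα => Submodule.smul_mem _ _ ?_
    have h2 : normMono α = (((√(monoNormSq α))⁻¹ : ℝ) : ℂ) • mono α := rfl
    rw [h2]
    exact Submodule.smul_mem _ _ (Submodule.subset_span ⟨α, mem_expts.1 hα, rfl⟩)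
  have hqc : Continuous q := continuous_finsetSum _ fun α _ =>
    continuous_const.mul (continuous_normMono α)
  have h1 := norm_sq_le_homogKernel_mul
    (comp_linear_mem_homogPoly hq (U.symm.toLinearEquiv : Cd (e + 1) →ₗ[ℂ] Cd (e + 1))) (U y)
  have h2 := integral_comp_unitary U.symm (f := fun x => ‖q x‖ ^ 2) (hqc.norm.pow 2)
  have h3 : ∫ x : sphere (0 : Cd (e + 1)) 1, ‖q x‖ ^ 2 ∂unitSphereMeasure (e + 1) =
      homogKernel e m y := by
    simp only [q]
    rw [integral_norm_sum_normMono_sq]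
    simp [homogKernel]
  have h4 : q y = (homogKernel e m y : ℂ) := by
    simp only [q, homogKernel]
    push_cast
    refine Finset.sum_congr rfl fun α _ => ?_
    rw [mul_comm, Complex.mul_conj, Complex.normSq_eq_norm_sq]
    push_cast
    rfl
  have h5 : ‖q y‖ ^ 2 ≤ homogKernel e m (U y) * homogKernel e m y := by
    rw [← h3, ← h2]
    simpa using h1
  rw [h4, Complex.norm_real, Real.norm_of_nonneg (homogKernel_nonneg m y), sq] at h5
  rcases (homogKernel_nonneg m y).eq_or_lt with h0 | h0
  · rw [← h0]; exact homogKernel_nonneg m _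
  · exact le_of_mul_le_mul_right h5 h0

theorem homogKernel_smul (m : ℕ) (a : ℂ) (y : Cd (e + 1)) :
    homogKernel e m (a • y) = ‖a‖ ^ (2 * m) * homogKernel e m y := by
  rw [homogKernel, homogKernel, Finset.mul_sum]
  refine Finset.sum_congr rfl fun α hα => ?_
  rw [normMono_smul, mem_expts.1 hα, norm_mul, norm_pow]
  ring

/-- Transitivity of the unitary group makes the kernel constant on the sphere, so it equals its
mean, which counts the orthonormal monomials. -/
theorem homogKernel_of_norm_eq_one (m : ℕ) {y : Cd (e + 1)} (hy : ‖y‖ = 1) :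
    homogKernel e m y = (m + e).choose e := by
  have h1 : ∀ x : sphere (0 : Cd (e + 1)) 1, homogKernel e m x = homogKernel e m y := by
    intro x
    have hx : ‖(x : Cd (e + 1))‖ = 1 := by simp
    obtain ⟨U, hU⟩ := exists_unitary_apply_eq hx hy
    obtain ⟨V, hV⟩ := exists_unitary_apply_eq hy hx
    exact le_antisymm (hU ▸ homogKernel_le_apply m U x) (hV ▸ homogKernel_le_apply m V y)
  have h2 : ∫ x : sphere (0 : Cd (e + 1)) 1, homogKernel e m x ∂unitSphereMeasure (e + 1) =
      homogKernel e m y := by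
    simp only [h1]
    simp
  rw [← h2]
  simp only [homogKernel]
  rw [integral_finsetSum]
  · have h3 : ∀ α : Fin (e + 1) → ℕ, ∫ x : sphere (0 : Cd (e + 1)) 1, ‖normMono α x‖ ^ 2
        ∂unitSphereMeasure (e + 1) = 1 := by
      intro α
      simpa using integral_norm_sum_normMono_sq {α} (fun _ => 1)
    simp [h3, card_expts]
  · intro α _
    exact integrable_of_continuous_sphere
      (((continuous_normMono α).comp continuous_subtype_val).norm.pow 2)

theorem homogKernel_eq (m : ℕ) (y : Cd (e + 1)) :
    homogKernel e m y = (m + e).choose e * ‖y‖ ^ (2 * m) := by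
  obtain ⟨x, hx, hxy⟩ : ∃ x : Cd (e + 1), ‖x‖ = 1 ∧ y = (‖y‖ : ℂ) • x := by
    by_cases hy : y = 0
    · obtain ⟨x, hx⟩ := exists_norm_eq (Cd (e + 1)) zero_le_one
      exact ⟨x, hx, by simp [hy]⟩
    · have hy' : ‖y‖ ≠ 0 := norm_ne_zero_iff.2 hy
      refine ⟨((‖y‖⁻¹ : ℝ) : ℂ) • y, ?_, ?_⟩
      · rw [norm_smul, Complex.norm_real, norm_inv, norm_norm, inv_mul_cancel₀ hy']
      · rw [smul_smul, Complex.ofReal_inv, mul_inv_cancel₀ (by exact_mod_cast hy'), one_smul]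
  conv_lhs => rw [hxy]
  rw [homogKernel_smul, homogKernel_of_norm_eq_one m hx, Complex.norm_real, norm_norm, mul_comm]

end

/-! ### The Hardy space and its Hilbert basis of monomials -/

noncomputable section

open scoped ComplexConjugate

variable {e : ℕ} {c : Cd (e + 1)} {R : ℝ}

/-- The affine coordinate that maps `ball c R` to the unit ball. -/
def unitCoord (c : Cd (e + 1)) (R : ℝ) (z : Cd (e + 1)) : Cd (e + 1) := (R : ℂ)⁻¹ • (z - c)

/-- The parametrisation of the sphere with centre `c` and radius `R` by the unit sphere. -/
def sphereChart (c : Cd (e + 1)) (R : ℝ) (x : sphere (0 : Cd (e + 1)) 1) : Cd (e + 1) :=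
  c + R • (x : Cd (e + 1))

theorem unitCoord_add_smul (hR : 0 < R) (x : Cd (e + 1)) : unitCoord c R (c + R • x) = x := by
  have h : (R : ℂ) ≠ 0 := by exact_mod_cast hR.ne'
  have h2 : R • x = (R : ℂ) • x := (Complex.coe_smul R x).symm
  rw [unitCoord, add_sub_cancel_left, h2, smul_smul, inv_mul_cancel₀ h, one_smul]

theorem add_smul_unitCoord (hR : 0 < R) (z : Cd (e + 1)) : c + R • unitCoord c R z = z := by
  have h : (R : ℂ) ≠ 0 := by exact_mod_cast hR.ne'
  have h2 : R • unitCoord c R z = (R : ℂ) • unitCoord c R z := (Complex.coe_smul R _).symm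
  rw [h2, unitCoord, smul_smul, mul_inv_cancel₀ h, one_smul, add_sub_cancel]

theorem norm_unitCoord (hR : 0 < R) (z : Cd (e + 1)) : ‖unitCoord c R z‖ = dist z c / R := by
  rw [unitCoord, norm_smul, norm_inv, Complex.norm_real, Real.norm_of_nonneg hR.le, dist_eq_norm,
    div_eq_inv_mul]

theorem norm_unitCoord_lt_one (hR : 0 < R) {z : Cd (e + 1)} (hz : z ∈ ball c R) :
    ‖unitCoord c R z‖ < 1 := by
  rw [norm_unitCoord hR, div_lt_one hR]; exact hz

theorem norm_unitCoord_le (hR : 0 < R) {r : ℝ} {z : Cd (e + 1)} (hz : z ∈ closedBall c (r * R)) :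
    ‖unitCoord c R z‖ ≤ r := by
  rw [norm_unitCoord hR, div_le_iff₀ hR]; exact hz

theorem differentiable_unitCoord : Differentiable ℂ (unitCoord c R) := by
  unfold unitCoord
  fun_prop

theorem continuous_sphereChart : Continuous (sphereChart c R) := by
  unfold sphereChart
  fun_prop

theorem sphereChart_mem_sphere (hR : 0 < R) (x : sphere (0 : Cd (e + 1)) 1) :
    sphereChart c R x ∈ sphere c R := by
  have hx : ‖(x : Cd (e + 1))‖ = 1 := by simp
  rw [mem_sphere, sphereChart, dist_eq_norm, add_sub_cancel_left, norm_smul, hx, mul_one,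
    Real.norm_of_nonneg hR.le]

theorem measurableEmbedding_sphereChart (hR : 0 < R) : MeasurableEmbedding (sphereChart c R) := by
  refine (continuous_sphereChart.isClosedEmbedding fun x y h => ?_).measurableEmbedding
  ext1
  have := congrArg (unitCoord c R) h
  rwa [sphereChart, sphereChart, unitCoord_add_smul hR, unitCoord_add_smul hR] at this

theorem sphereMeasure_eq_map (c : Cd (e + 1)) (R : ℝ) :
    sphereMeasure c R = (unitSphereMeasure (e + 1)).map (sphereChart c R) := rfl

instance (c : Cd (e + 1)) (R : ℝ) : IsProbabilityMeasure (sphereMeasure c R) := by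
  rw [sphereMeasure_eq_map]
  exact Measure.isProbabilityMeasure_map continuous_sphereChart.aemeasurable

theorem ae_mem_sphere (hR : 0 < R) : ∀ᵐ z ∂sphereMeasure c R, z ∈ sphere c R := by
  rw [sphereMeasure_eq_map, (measurableEmbedding_sphereChart hR).ae_map_iff]
  exact Eventually.of_forall fun x => sphereChart_mem_sphere hR x

theorem integral_sphereMeasure (hR : 0 < R) {F : Type*} [NormedAddCommGroup F] [NormedSpace ℝ F]
    (f : Cd (e + 1) → F) : ∫ z, f z ∂sphereMeasure c R =
      ∫ x, f (sphereChart c R x) ∂unitSphereMeasure (e + 1) := by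
  rw [sphereMeasure_eq_map, (measurableEmbedding_sphereChart hR).integral_map]

theorem continuousOn_closedBall_of_diffContOnCl (hR : 0 < R) {u : Cd (e + 1) → ℂ}
    (hu : DiffContOnCl ℂ u (ball c R)) : ContinuousOn u (closedBall c R) := by
  rw [← closure_ball c hR.ne']; exact hu.continuousOn

theorem memLp_of_diffContOnCl (hR : 0 < R) {u : Cd (e + 1) → ℂ}
    (hu : DiffContOnCl ℂ u (ball c R)) : MemLp u 2 (sphereMeasure c R) := by
  rw [sphereMeasure_eq_map, (measurableEmbedding_sphereChart hR).memLp_map_measure_iff]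
  have hc : Continuous (u ∘ sphereChart c R) :=
    (continuousOn_closedBall_of_diffContOnCl hR hu).comp_continuous continuous_sphereChart
      fun x => sphere_subset_closedBall (sphereChart_mem_sphere hR x)
  exact hc.memLp_of_hasCompactSupport (HasCompactSupport.of_compactSpace _)

/-- The element of the Hardy space given by a function holomorphic on the ball and continuous on
its closure. -/
def hardyClass (hR : 0 < R) {u : Cd (e + 1) → ℂ} (hu : DiffContOnCl ℂ u (ball c R)) :
    HardySpace c R :=
  ⟨(memLp_of_diffContOnCl hR hu).toLp u,
    Submodule.le_topologicalClosure _ ⟨u, hu, MemLp.coeFn_toLp _⟩⟩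

theorem coeFn_hardyClass (hR : 0 < R) {u : Cd (e + 1) → ℂ} (hu : DiffContOnCl ℂ u (ball c R)) :
    ((hardyClass hR hu : Lp ℂ 2 (sphereMeasure c R)) : Cd (e + 1) → ℂ) =ᵐ[sphereMeasure c R] u :=
  MemLp.coeFn_toLp (memLp_of_diffContOnCl hR hu)

/-- The measure has total mass 1, so the L² norm is at most the supremum. -/
theorem norm_le_of_ae_eq (hR : 0 < R) {f : HardySpace c R} {u : Cd (e + 1) → ℂ}
    (hf : ((f : Lp ℂ 2 (sphereMeasure c R)) : Cd (e + 1) → ℂ) =ᵐ[sphereMeasure c R] u) {M : ℝ}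
    (hM0 : 0 ≤ M) (hM : ∀ z ∈ sphere c R, ‖u z‖ ≤ M) : ‖f‖ ≤ M := by
  have h := Lp.norm_le_of_ae_bound (f := (f : Lp ℂ 2 (sphereMeasure c R))) hM0 (by
    filter_upwards [hf, ae_mem_sphere hR] with z h1 h2
    rw [h1]; exact hM z h2)
  simpa [measureUnivNNReal] using h

/-- The orthonormal monomials in the coordinates adapted to the ball. -/
def ballMono (c : Cd (e + 1)) (R : ℝ) (α : Fin (e + 1) → ℕ) (z : Cd (e + 1)) : ℂ :=
  normMono α (unitCoord c R z)

theorem differentiable_ballMono (α : Fin (e + 1) → ℕ) : Differentiable ℂ (ballMono c R α) :=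
  (differentiable_normMono α).comp differentiable_unitCoord

theorem ballMono_sphereChart (hR : 0 < R) (α : Fin (e + 1) → ℕ) (x : sphere (0 : Cd (e + 1)) 1) :
    ballMono c R α (sphereChart c R x) = normMono α x := by
  rw [ballMono, sphereChart, unitCoord_add_smul hR]

/-- The orthonormal monomials as elements of the Hardy space. -/
def hardyMono (c : Cd (e + 1)) (hR : 0 < R) (α : Fin (e + 1) → ℕ) : HardySpace c R :=
  hardyClass hR (u := ballMono c R α) (differentiable_ballMono α).diffContOnCl

theorem orthonormal_hardyMono (hR : 0 < R) : Orthonormal ℂ (hardyMono c hR) := by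
  classical
  rw [orthonormal_iff_ite]
  intro α β
  rw [← integral_conj_normMono_mul_normMono α β, Submodule.coe_inner, L2.inner_def]
  have h1 : ∫ z, inner ℂ ((hardyMono c hR α : Lp ℂ 2 (sphereMeasure c R)) z)
      ((hardyMono c hR β : Lp ℂ 2 (sphereMeasure c R)) z) ∂sphereMeasure c R =
      ∫ z, conj (ballMono c R α z) * ballMono c R β z ∂sphereMeasure c R := by
    refine integral_congr_ae ?_
    filter_upwards [coeFn_hardyClass (c := c) hR (differentiable_ballMono α).diffContOnCl,
      coeFn_hardyClass (c := c) hR (differentiable_ballMono β).diffContOnCl] with z h1 h2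
    rw [hardyMono, hardyMono, h1, h2, RCLike.inner_apply, mul_comm]
  rw [h1, integral_sphereMeasure hR]
  simp only [ballMono_sphereChart hR]

theorem exists_mem_span_hardyMono (hR : 0 < R) {p : Cd (e + 1) → ℂ}
    (hp : p ∈ Submodule.span ℂ (Set.range (mono (d := e + 1)))) :
    ∃ h ∈ Submodule.span ℂ (Set.range (hardyMono c hR)),
      ((h : Lp ℂ 2 (sphereMeasure c R)) : Cd (e + 1) → ℂ) =ᵐ[sphereMeasure c R]
        fun z => p (unitCoord c R z) := by
  induction hp using Submodule.span_induction with
  | mem f hf =>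
    obtain ⟨α, rfl⟩ := hf
    refine ⟨((√(monoNormSq α) : ℝ) : ℂ) • hardyMono c hR α,
      Submodule.smul_mem _ _ (Submodule.subset_span ⟨α, rfl⟩), ?_⟩
    filter_upwards [coeFn_hardyClass (c := c) hR (differentiable_ballMono α).diffContOnCl,
      Lp.coeFn_smul ((√(monoNormSq α) : ℝ) : ℂ)
        (hardyMono c hR α : Lp ℂ 2 (sphereMeasure c R))] with z h1 h2
    rw [Submodule.coe_smul, h2, Pi.smul_apply, hardyMono, h1, mono_eq_smul_normMono]
    rfl
  | zero =>
    refine ⟨0, Submodule.zero_mem _, ?_⟩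
    exact Lp.coeFn_zero ℂ 2 (sphereMeasure c R)
  | add f g _ _ hf hg =>
    obtain ⟨h1, hm1, ha1⟩ := hf
    obtain ⟨h2, hm2, ha2⟩ := hg
    refine ⟨h1 + h2, Submodule.add_mem _ hm1 hm2, ?_⟩
    filter_upwards [ha1, ha2, Lp.coeFn_add (h1 : Lp ℂ 2 (sphereMeasure c R))
      (h2 : Lp ℂ 2 (sphereMeasure c R))] with z e1 e2 e3
    rw [Submodule.coe_add, e3, Pi.add_apply, e1, e2]
    rfl
  | smul a f _ hf =>
    obtain ⟨h1, hm1, ha1⟩ := hf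
    refine ⟨a • h1, Submodule.smul_mem _ _ hm1, ?_⟩
    filter_upwards [ha1, Lp.coeFn_smul a (h1 : Lp ℂ 2 (sphereMeasure c R))] with z e1 e3
    rw [Submodule.coe_smul, e3, Pi.smul_apply, e1]
    rfl

/-- One polynomial approximates both uniformly on the closed ball and in norm: the norm estimate
gives density of the monomials, the pair of estimates identifies the holomorphic extension. -/
theorem exists_span_norm_sub_le (hR : 0 < R) {u : Cd (e + 1) → ℂ}
    (hu : DiffContOnCl ℂ u (ball c R)) {ε : ℝ} (hε : 0 < ε) :
    ∃ h ∈ Submodule.span ℂ (Set.range (hardyMono c hR)),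
      ∃ p ∈ Submodule.span ℂ (Set.range (mono (d := e + 1))),
      ((h : Lp ℂ 2 (sphereMeasure c R)) : Cd (e + 1) → ℂ) =ᵐ[sphereMeasure c R]
        (fun z => p (unitCoord c R z)) ∧
      (∀ z ∈ closedBall c R, ‖u z - p (unitCoord c R z)‖ ≤ ε) ∧ ‖hardyClass hR hu - h‖ ≤ ε := by
  have hv : DiffContOnCl ℂ (fun x => u (c + R • x)) (ball (0 : Cd (e + 1)) 1) := by
    have h1 : DiffContOnCl ℂ (fun x : Cd (e + 1) => c + R • x) (ball (0 : Cd (e + 1)) 1) := by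
      have : Differentiable ℂ fun x : Cd (e + 1) => c + (R : ℂ) • x := by fun_prop
      exact this.diffContOnCl
    refine hu.comp h1 fun x hx => ?_
    rw [mem_ball_zero_iff] at hx
    rw [mem_ball, dist_eq_norm, add_sub_cancel_left, norm_smul, Real.norm_of_nonneg hR.le]
    nlinarith
  obtain ⟨p, hp, hpu⟩ := exists_poly_norm_sub_le hv hε
  obtain ⟨h, hh, hhp⟩ := exists_mem_span_hardyMono (c := c) hR hp
  have hclose : ∀ z ∈ closedBall c R, ‖u z - p (unitCoord c R z)‖ ≤ ε := by
    intro z hz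
    have h1 := hpu (unitCoord c R z) (by
      rw [mem_closedBall_zero_iff]
      exact norm_unitCoord_le hR (by simpa using hz))
    simpa only [add_smul_unitCoord hR] using h1
  refine ⟨h, hh, p, hp, hhp, hclose, ?_⟩
  refine norm_le_of_ae_eq hR (u := fun z => u z - p (unitCoord c R z)) ?_ hε.le
    fun z hz => hclose z (sphere_subset_closedBall hz)
  filter_upwards [hhp, coeFn_hardyClass hR hu, Lp.coeFn_sub
    (hardyClass hR hu : Lp ℂ 2 (sphereMeasure c R)) (h : Lp ℂ 2 (sphereMeasure c R))]
    with z e1 e2 e3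
  rw [Submodule.coe_sub, e3, Pi.sub_apply, e1, e2]

theorem exists_hardyClass_norm_sub_lt (hR : 0 < R) (f : HardySpace c R) {ε : ℝ} (hε : 0 < ε) :
    ∃ (u : Cd (e + 1) → ℂ) (hu : DiffContOnCl ℂ u (ball c R)), ‖f - hardyClass hR hu‖ < ε := by
  have hf := f.2
  rw [← SetLike.mem_coe, Submodule.topologicalClosure_coe, Metric.mem_closure_iff] at hf
  obtain ⟨g, ⟨u, hu, hgu⟩, hg⟩ := hf ε hε
  refine ⟨u, hu, ?_⟩
  have : (hardyClass hR hu : Lp ℂ 2 (sphereMeasure c R)) = g :=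
    Lp.ext ((coeFn_hardyClass hR hu).trans hgu.symm)
  rw [Submodule.coe_norm, Submodule.coe_sub, this, ← dist_eq_norm]
  exact hg

theorem orthogonal_span_hardyMono (hR : 0 < R) :
    (Submodule.span ℂ (Set.range (hardyMono c hR)))ᗮ = ⊥ := by
  rw [← Submodule.topologicalClosure_eq_top_iff, eq_top_iff]
  intro f _
  rw [← SetLike.mem_coe, Submodule.topologicalClosure_coe, Metric.mem_closure_iff]
  intro ε hε
  obtain ⟨u, hu, h1⟩ := exists_hardyClass_norm_sub_lt hR f (half_pos hε)
  obtain ⟨h, hh, -, -, -, -, h2⟩ := exists_span_norm_sub_le hR hu (half_pos hε)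
  refine ⟨h, hh, ?_⟩
  rw [dist_eq_norm]
  linarith [norm_sub_le_norm_sub_add_norm_sub f (hardyClass hR hu) h]

/-- The Hilbert basis of normalised monomials. -/
def hardyBasis (c : Cd (e + 1)) (hR : 0 < R) :
    HilbertBasis (Fin (e + 1) → ℕ) ℂ (HardySpace c R) :=
  HilbertBasis.mkOfOrthogonalEqBot (orthonormal_hardyMono hR) (orthogonal_span_hardyMono hR)

theorem hardyBasis_apply (hR : 0 < R) (α : Fin (e + 1) → ℕ) :
    hardyBasis c hR α = hardyMono c hR α := by
  rw [hardyBasis, HilbertBasis.coe_mkOfOrthogonalEqBot]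

end

/-! ### Point evaluation and the holomorphic extension -/

noncomputable section

open scoped ComplexConjugate

variable {e : ℕ} {c : Cd (e + 1)} {R : ℝ}

/-- Grouping the exponents by degree turns the sum into values of `homogKernel`, which are known. -/
theorem sum_norm_normMono_sq_le {r : ℝ} (hr1 : r < 1) {y : Cd (e + 1)} (hy : ‖y‖ ≤ r) (m : ℕ)
    (s : Finset (Fin (e + 1) → ℕ)) (hs : ∀ α ∈ s, m ≤ ∑ i, α i) :
    ∑ α ∈ s, ‖normMono α y‖ ^ 2 ≤ kernelTail e r m := by
  classical
  have hr0 : 0 ≤ r := (norm_nonneg y).trans hy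
  let N := s.sup (fun α => ∑ i, α i) + 1
  have hsub : s ⊆ (Finset.range N).biUnion fun j => expts e (j + m) := by
    intro α hα
    have h1 : ∑ i, α i ≤ s.sup (fun α => ∑ i, α i) := Finset.le_sup (f := fun α => ∑ i, α i) hα
    have h2 := hs α hα
    simp only [Finset.mem_biUnion, Finset.mem_range, mem_expts]
    exact ⟨∑ i, α i - m, by omega, by omega⟩
  refine (Finset.sum_le_sum_of_subset_of_nonneg hsub fun _ _ _ => by positivity).trans ?_
  rw [Finset.sum_biUnion]
  · have hsum : Summable fun j : ℕ => ((j + m + e).choose e : ℝ) * r ^ (2 * (j + m)) :=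
      (summable_nat_add_iff m).2 (summable_choose_mul_sq_pow e hr0 hr1)
    refine le_trans (Finset.sum_le_sum fun j _ => ?_)
      (hsum.sum_le_tsum (Finset.range N) fun _ _ => by positivity)
    change homogKernel e (j + m) y ≤ _
    rw [homogKernel_eq]
    gcongr
  · intro i _ j _ hij
    refine Finset.disjoint_left.2 fun α h1 h2 => hij ?_
    have := (mem_expts.1 h1).symm.trans (mem_expts.1 h2)
    omega

/-- The value at `z` of the holomorphic extension of an element of the Hardy space. -/
def hardyExt (hR : 0 < R) (f : HardySpace c R) (z : Cd (e + 1)) : ℂ :=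
  ∑' α, inner ℂ (hardyBasis c hR α) f * ballMono c R α z

/-- Cauchy–Schwarz, with Bessel's inequality for the coefficients and the kernel tail for the
monomials; the coefficients of degree less than `m` vanish. -/
theorem sum_norm_hardyExt_le (hR : 0 < R) {r : ℝ} (hr1 : r < 1) {z : Cd (e + 1)}
    (hz : ‖unitCoord c R z‖ ≤ r) (m : ℕ) (f : HardySpace c R)
    (hf : ∀ α : Fin (e + 1) → ℕ, ∑ i, α i < m → inner ℂ (hardyBasis c hR α) f = 0)
    (s : Finset (Fin (e + 1) → ℕ)) :
    ∑ α ∈ s, ‖inner ℂ (hardyBasis c hR α) f * ballMono c R α z‖ ≤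
      √(kernelTail e r m) * ‖f‖ := by
  have hr0 : 0 ≤ r := (norm_nonneg _).trans hz
  set t := s.filter fun α => m ≤ ∑ i, α i with ht
  have h0 : ∑ α ∈ s, ‖inner ℂ (hardyBasis c hR α) f * ballMono c R α z‖ =
      ∑ α ∈ t, ‖inner ℂ (hardyBasis c hR α) f‖ * ‖ballMono c R α z‖ := by
    rw [ht, Finset.sum_filter]
    refine Finset.sum_congr rfl fun α _ => ?_
    split_ifs with h
    · rw [norm_mul]
    · rw [hf α (by omega), zero_mul, norm_zero]
  rw [h0]
  refine abs_le_of_sq_le_sq' ?_ (by positivity) |>.2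
  refine (Finset.sum_mul_sq_le_sq_mul_sq _ _ _).trans ?_
  have h1 := (hardyBasis c hR).orthonormal.sum_inner_products_le f (s := t)
  have h2 := sum_norm_normMono_sq_le hr1 hz m t fun α hα => (Finset.mem_filter.1 hα).2
  rw [mul_pow, Real.sq_sqrt (kernelTail_nonneg e hr0 m), mul_comm]
  exact mul_le_mul h2 h1 (Finset.sum_nonneg fun _ _ => by positivity)
    (kernelTail_nonneg e hr0 m)

theorem summable_hardyExt (hR : 0 < R) (f : HardySpace c R) {z : Cd (e + 1)} (hz : z ∈ ball c R) :
    Summable fun α => inner ℂ (hardyBasis c hR α) f * ballMono c R α z := by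
  refine Summable.of_norm (summable_of_sum_le (fun _ => norm_nonneg _)
    (sum_norm_hardyExt_le hR (norm_unitCoord_lt_one hR hz) le_rfl 0 f fun α h => by omega))

theorem norm_hardyExt_le (hR : 0 < R) {r : ℝ} (hr1 : r < 1) {z : Cd (e + 1)}
    (hz : ‖unitCoord c R z‖ ≤ r) (m : ℕ) (f : HardySpace c R)
    (hf : ∀ α : Fin (e + 1) → ℕ, ∑ i, α i < m → inner ℂ (hardyBasis c hR α) f = 0) :
    ‖hardyExt hR f z‖ ≤ √(kernelTail e r m) * ‖f‖ := by
  have hb := sum_norm_hardyExt_le hR hr1 hz m f hf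
  have hs := summable_of_sum_le (fun _ => norm_nonneg _) hb
  exact (norm_tsum_le_tsum_norm hs).trans (hs.tsum_le_of_sum_le hb)

theorem norm_hardyExt_le_zero (hR : 0 < R) {r : ℝ} (hr1 : r < 1) {z : Cd (e + 1)}
    (hz : ‖unitCoord c R z‖ ≤ r) (f : HardySpace c R) :
    ‖hardyExt hR f z‖ ≤ √(kernelTail e r 0) * ‖f‖ :=
  norm_hardyExt_le hR hr1 hz 0 f fun α h => by omega

theorem hardyExt_add (hR : 0 < R) (f g : HardySpace c R) {z : Cd (e + 1)} (hz : z ∈ ball c R) :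
    hardyExt hR (f + g) z = hardyExt hR f z + hardyExt hR g z := by
  rw [hardyExt, hardyExt, hardyExt,
    ← (summable_hardyExt hR f hz).tsum_add (summable_hardyExt hR g hz)]
  exact tsum_congr fun α => by rw [inner_add_right, add_mul]

theorem hardyExt_smul (hR : 0 < R) (a : ℂ) (f : HardySpace c R) (z : Cd (e + 1)) :
    hardyExt hR (a • f) z = a * hardyExt hR f z := by
  rw [hardyExt, hardyExt, ← tsum_mul_left]
  refine tsum_congr fun α => ?_
  have h : inner ℂ (hardyBasis c hR α) (a • f) = a * inner ℂ (hardyBasis c hR α) f :=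
    inner_smul_right (E := HardySpace c R) (hardyBasis c hR α) f a
  rw [h, mul_assoc]

theorem hardyExt_sub (hR : 0 < R) (f g : HardySpace c R) {z : Cd (e + 1)} (hz : z ∈ ball c R) :
    hardyExt hR (f - g) z = hardyExt hR f z - hardyExt hR g z := by
  have h : f - g = f + (-1 : ℂ) • g := by rw [neg_one_smul, sub_eq_add_neg]
  rw [h, hardyExt_add hR _ _ hz, hardyExt_smul]
  ring

theorem hardyExt_zero (hR : 0 < R) (z : Cd (e + 1)) : hardyExt hR (0 : HardySpace c R) z = 0 := by
  simp [hardyExt]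

theorem hardyExt_sum (hR : 0 < R) {ι : Type*} (s : Finset ι) (f : ι → HardySpace c R)
    {z : Cd (e + 1)} (hz : z ∈ ball c R) :
    hardyExt hR (∑ i ∈ s, f i) z = ∑ i ∈ s, hardyExt hR (f i) z := by
  classical
  induction s using Finset.induction_on with
  | empty => simp [hardyExt_zero]
  | insert i s hi ih => rw [Finset.sum_insert hi, Finset.sum_insert hi, hardyExt_add hR _ _ hz, ih]

theorem hardyExt_basis (hR : 0 < R) (α : Fin (e + 1) → ℕ) (z : Cd (e + 1)) :
    hardyExt hR (hardyBasis c hR α) z = ballMono c R α z := by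
  classical
  rw [hardyExt, tsum_eq_single α]
  · rw [orthonormal_iff_ite.1 (hardyBasis c hR).orthonormal]; simp
  · intro β hβ
    rw [orthonormal_iff_ite.1 (hardyBasis c hR).orthonormal]; simp [hβ]

theorem tendsto_hardyExt (hR : 0 < R) {ι : Type*} {l : Filter ι} {f : ι → HardySpace c R}
    {g : HardySpace c R} (h : Tendsto f l (𝓝 g)) {z : Cd (e + 1)} (hz : z ∈ ball c R) :
    Tendsto (fun i => hardyExt hR (f i) z) l (𝓝 (hardyExt hR g z)) := by
  rw [tendsto_iff_norm_sub_tendsto_zero] at h ⊢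
  have h2 := h.const_mul (√(kernelTail e ‖unitCoord c R z‖ 0))
  rw [mul_zero] at h2
  refine squeeze_zero (fun _ => norm_nonneg _) (fun i => ?_) h2
  rw [← hardyExt_sub hR _ _ hz]
  exact norm_hardyExt_le_zero hR (norm_unitCoord_lt_one hR hz) le_rfl _

theorem eq_hardyExt_of_ae_eq_poly (hR : 0 < R) {h : HardySpace c R} {p : Cd (e + 1) → ℂ}
    (hp : p ∈ Submodule.span ℂ (Set.range (mono (d := e + 1))))
    (hh : ((h : Lp ℂ 2 (sphereMeasure c R)) : Cd (e + 1) → ℂ) =ᵐ[sphereMeasure c R]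
        fun z => p (unitCoord c R z)) {z : Cd (e + 1)} (hz : z ∈ ball c R) :
    hardyExt hR h z = p (unitCoord c R z) := by
  -- The induction over polynomials constructs its own element; it coincides with `h` because both
  -- have the same boundary values.
  have key : ∃ h' : HardySpace c R,
      ((h' : Lp ℂ 2 (sphereMeasure c R)) : Cd (e + 1) → ℂ) =ᵐ[sphereMeasure c R]
        (fun z => p (unitCoord c R z)) ∧ hardyExt hR h' z = p (unitCoord c R z) := by
    clear hh
    induction hp using Submodule.span_induction with
    | mem f hf =>
      obtain ⟨α, rfl⟩ := hf
      refine ⟨((√(monoNormSq α) : ℝ) : ℂ) • hardyMono c hR α, ?_, ?_⟩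
      · filter_upwards [coeFn_hardyClass (c := c) hR (differentiable_ballMono α).diffContOnCl,
          Lp.coeFn_smul ((√(monoNormSq α) : ℝ) : ℂ)
            (hardyMono c hR α : Lp ℂ 2 (sphereMeasure c R))] with z h1 h2
        rw [Submodule.coe_smul, h2, Pi.smul_apply, hardyMono, h1, mono_eq_smul_normMono]
        rfl
      · rw [hardyExt_smul, ← hardyBasis_apply, hardyExt_basis, mono_eq_smul_normMono]
        rfl
    | zero =>
      refine ⟨0, ?_, by simp [hardyExt_zero]⟩
      exact Lp.coeFn_zero ℂ 2 (sphereMeasure c R)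
    | add f g _ _ hf hg =>
      obtain ⟨h1, ha1, hm1⟩ := hf
      obtain ⟨h2, ha2, hm2⟩ := hg
      refine ⟨h1 + h2, ?_, ?_⟩
      · filter_upwards [ha1, ha2, Lp.coeFn_add (h1 : Lp ℂ 2 (sphereMeasure c R))
          (h2 : Lp ℂ 2 (sphereMeasure c R))] with z e1 e2 e3
        rw [Submodule.coe_add, e3, Pi.add_apply, e1, e2]
        rfl
      · rw [hardyExt_add hR _ _ hz, hm1, hm2]; rfl
    | smul a f _ hf =>
      obtain ⟨h1, ha1, hm1⟩ := hf
      refine ⟨a • h1, ?_, ?_⟩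
      · filter_upwards [ha1, Lp.coeFn_smul a (h1 : Lp ℂ 2 (sphereMeasure c R))] with z e1 e3
        rw [Submodule.coe_smul, e3, Pi.smul_apply, e1]
        rfl
      · rw [hardyExt_smul, hm1]; rfl
  obtain ⟨h', ha, hm⟩ := key
  have : h = h' := Subtype.ext (Lp.ext (hh.trans ha.symm))
  rw [this, hm]

/-- True for polynomials, and both sides move by a multiple of ε when the function is replaced by a
polynomial within ε on the closed ball. -/
theorem hardyExt_hardyClass (hR : 0 < R) {u : Cd (e + 1) → ℂ}
    (hu : DiffContOnCl ℂ u (ball c R)) {z : Cd (e + 1)} (hz : z ∈ ball c R) :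
    hardyExt hR (hardyClass hR hu) z = u z := by
  set C := √(kernelTail e ‖unitCoord c R z‖ 0)
  have key : ∀ ε : ℝ, 0 < ε → ‖hardyExt hR (hardyClass hR hu) z - u z‖ ≤ (C + 1) * ε := by
    intro ε hε
    obtain ⟨h, -, p, hp, hhp, h1, h2⟩ := exists_span_norm_sub_le hR hu hε
    have h3 := norm_hardyExt_le_zero hR (norm_unitCoord_lt_one hR hz) le_rfl (hardyClass hR hu - h)
    rw [hardyExt_sub hR _ _ hz, eq_hardyExt_of_ae_eq_poly hR hp hhp hz] at h3
    have h4 := h1 z (ball_subset_closedBall hz)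
    have h5 := mul_le_mul_of_nonneg_left h2 (Real.sqrt_nonneg (kernelTail e ‖unitCoord c R z‖ 0))
    have h6 := norm_sub_le_norm_sub_add_norm_sub (hardyExt hR (hardyClass hR hu) z)
      (p (unitCoord c R z)) (u z)
    rw [norm_sub_rev (p (unitCoord c R z)) (u z)] at h6
    have h7 : C * ‖hardyClass hR hu - h‖ ≤ C * ε := h5
    have h8 : ‖hardyExt hR (hardyClass hR hu) z - p (unitCoord c R z)‖ ≤
      C * ‖hardyClass hR hu - h‖ := h3
    linarith
  have hC : 0 ≤ C := Real.sqrt_nonneg _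
  rw [← sub_eq_zero, ← norm_le_zero_iff]
  refine le_of_forall_pos_le_add fun δ hδ => ?_
  refine (key (δ / (C + 1)) (by positivity)).trans (le_of_eq ?_)
  field_simp
  ring

/-- The evaluation bound is uniform where `‖unitCoord c R z‖ ≤ r`, so norm convergence of the basis
expansion gives locally uniform convergence on the ball. -/
theorem differentiableOn_hardyExt (hR : 0 < R) (f : HardySpace c R) :
    DifferentiableOn ℂ (hardyExt hR f) (ball c R) := by
  intro x hx
  refine DifferentiableAt.differentiableWithinAt ?_
  obtain ⟨r, hxr, hr1⟩ := exists_between (norm_unitCoord_lt_one hR hx)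
  obtain ⟨ρ, hρ, hball⟩ : ∃ ρ > 0, ball x ρ ⊆ {z | ‖unitCoord c R z‖ < r} ∩ ball c R := by
    refine Metric.mem_nhds_iff.1 (inter_mem ?_ (isOpen_ball.mem_nhds hx))
    exact (differentiable_unitCoord.continuous.norm).continuousAt.eventually (gt_mem_nhds hxr)
  have hsum := (hardyBasis c hR).hasSum_repr f
  have hlim : TendstoUniformlyOn
      (fun (s : Finset (Fin (e + 1) → ℕ)) z => hardyExt hR
        (∑ α ∈ s, (hardyBasis c hR).repr f α • hardyBasis c hR α) z)
      (hardyExt hR f) atTop (ball x ρ) := by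
    rw [Metric.tendstoUniformlyOn_iff]
    intro ε hε
    have h1 := (tendsto_iff_norm_sub_tendsto_zero.1 hsum).const_mul (√(kernelTail e r 0))
    rw [mul_zero] at h1
    filter_upwards [h1.eventually (gt_mem_nhds hε)] with s hs z hz
    rw [dist_comm, dist_eq_norm, ← hardyExt_sub hR _ _ (hball hz).2]
    exact (norm_hardyExt_le_zero hR hr1 (le_of_lt (hball hz).1) _).trans_lt hs
  refine hlim.differentiableAt_center hρ fun s => ?_
  have : DifferentiableOn ℂ (fun z => ∑ α ∈ s, (hardyBasis c hR).repr f α * ballMono c R α z)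
      (ball x ρ) :=
    (Differentiable.fun_sum fun α _ => (differentiable_ballMono α).const_mul _).differentiableOn
  refine this.congr fun z hz => ?_
  rw [hardyExt_sum hR _ _ (hball hz).2]
  exact Finset.sum_congr rfl fun α _ => by rw [hardyExt_smul, hardyExt_basis]

theorem isHolomorphicExtension_hardyExt (hR : 0 < R) (f : HardySpace c R) {F : Cd (e + 1) → ℂ}
    (hF : ∀ z ∈ ball c R, F z = hardyExt hR f z) :
    IsHolomorphicExtension c R (f : Lp ℂ 2 (sphereMeasure c R)) F := by
  refine ⟨(differentiableOn_hardyExt hR f).congr hF, ?_⟩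
  have hex : ∀ n : ℕ, ∃ (u : Cd (e + 1) → ℂ) (hu : DiffContOnCl ℂ u (ball c R)),
      ‖f - hardyClass hR hu‖ < 1 / ((n : ℝ) + 1) := fun n =>
    exists_hardyClass_norm_sub_lt hR f (by positivity)
  choose u hu hfu using hex
  have hlim : Tendsto (fun n => hardyClass hR (hu n)) atTop (𝓝 f) := by
    rw [tendsto_iff_norm_sub_tendsto_zero]
    refine squeeze_zero (fun _ => norm_nonneg _) (fun n => ?_)
      tendsto_one_div_add_atTop_nhds_zero_nat
    rw [norm_sub_rev]
    exact (hfu n).le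
  refine ⟨u, hu, ?_, fun z hz => ?_⟩
  · have h1 := tendsto_iff_norm_sub_tendsto_zero.1 hlim
    have h2 := ENNReal.tendsto_ofReal h1
    rw [ENNReal.ofReal_zero] at h2
    refine h2.congr fun n => ?_
    rw [Submodule.coe_norm, Lp.norm_def, ENNReal.ofReal_toReal (Lp.eLpNorm_ne_top _)]
    refine eLpNorm_congr_ae ?_
    filter_upwards [coeFn_hardyClass hR (hu n), Lp.coeFn_sub
      (hardyClass hR (hu n) : Lp ℂ 2 (sphereMeasure c R)) (f : Lp ℂ 2 (sphereMeasure c R))]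
      with z e1 e2
    rw [Submodule.coe_sub, e2, Pi.sub_apply, e1]
  · rw [hF z hz]
    exact (tendsto_hardyExt hR hlim hz).congr fun n => hardyExt_hardyClass hR (hu n) hz

/-- Evaluation at `z` is continuous on H²(B), so the pointwise limit does not depend on the
approximating sequence. -/
theorem eq_hardyExt_of_isHolomorphicExtension (hR : 0 < R) {f : HardySpace c R}
    {F : Cd (e + 1) → ℂ} (hF : IsHolomorphicExtension c R (f : Lp ℂ 2 (sphereMeasure c R)) F)
    {z : Cd (e + 1)} (hz : z ∈ ball c R) : F z = hardyExt hR f z := by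
  obtain ⟨-, u, hu, hlim, hpt⟩ := hF
  have h1 : Tendsto (fun n => hardyClass hR (hu n)) atTop (𝓝 f) := by
    rw [tendsto_iff_norm_sub_tendsto_zero]
    have h2 := (ENNReal.tendsto_toReal ENNReal.zero_ne_top).comp hlim
    rw [ENNReal.toReal_zero] at h2
    refine h2.congr fun n => ?_
    rw [Submodule.coe_norm, Lp.norm_def, Function.comp_apply]
    congr 1
    refine eLpNorm_congr_ae ?_
    filter_upwards [coeFn_hardyClass hR (hu n), Lp.coeFn_sub
      (hardyClass hR (hu n) : Lp ℂ 2 (sphereMeasure c R)) (f : Lp ℂ 2 (sphereMeasure c R))]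
      with z e1 e2
    rw [Submodule.coe_sub, e2, Pi.sub_apply, e1]
  refine tendsto_nhds_unique (hpt z hz) ?_
  exact (tendsto_hardyExt hR h1 hz).congr fun n => hardyExt_hardyClass hR (hu n) hz

end

/-! ### Dilations and bounded holomorphic functions -/

noncomputable section

variable {e : ℕ} {c : Cd (e + 1)} {R : ℝ}

/-- The dilation with centre `c` and ratio `t`. -/
def dilate (c : Cd (e + 1)) (t : ℝ) (z : Cd (e + 1)) : Cd (e + 1) := c + (t : ℂ) • (z - c)

theorem unitCoord_dilate (t : ℝ) (z : Cd (e + 1)) :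
    unitCoord c R (dilate c t z) = (t : ℂ) • unitCoord c R z := by
  rw [unitCoord, unitCoord, dilate, add_sub_cancel_left, smul_comm]

theorem dilate_dilate (s t : ℝ) (z : Cd (e + 1)) :
    dilate c s (dilate c t z) = dilate c (s * t) z := by
  rw [dilate, dilate, dilate, add_sub_cancel_left, smul_smul, Complex.ofReal_mul]

theorem dilate_mem_ball (hR : 0 < R) {t : ℝ} (ht0 : 0 ≤ t) (ht1 : t < 1) {z : Cd (e + 1)}
    (hz : z ∈ closedBall c R) : dilate c t z ∈ ball c R := by
  rw [mem_closedBall, dist_eq_norm] at hz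
  rw [mem_ball, dilate, dist_eq_norm, add_sub_cancel_left, norm_smul, Complex.norm_real,
    Real.norm_of_nonneg ht0]
  nlinarith [norm_nonneg (z - c)]

theorem ballMono_dilate (t : ℝ) (α : Fin (e + 1) → ℕ) (z : Cd (e + 1)) :
    ballMono c R α (dilate c t z) = (t : ℂ) ^ (∑ i, α i) * ballMono c R α z := by
  rw [ballMono, unitCoord_dilate, normMono_smul, ballMono]

theorem DifferentiableOn.diffContOnCl_comp_dilate (hR : 0 < R) {t : ℝ} (ht0 : 0 ≤ t) (ht1 : t < 1)
    {g : Cd (e + 1) → ℂ} (hg : DifferentiableOn ℂ g (ball c R)) :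
    DiffContOnCl ℂ (fun z => g (dilate c t z)) (ball c R) := by
  refine DifferentiableOn.diffContOnCl_ball (U := closedBall c R) (hg.comp ?_ fun z hz =>
    dilate_mem_ball hR ht0 ht1 hz) le_rfl
  unfold dilate
  fun_prop

theorem coeFn_sum_hardyBasis (hR : 0 < R) (s : Finset (Fin (e + 1) → ℕ))
    (a : (Fin (e + 1) → ℕ) → ℂ) :
    (((∑ β ∈ s, a β • hardyBasis c hR β : HardySpace c R) : Lp ℂ 2 (sphereMeasure c R)) :
      Cd (e + 1) → ℂ) =ᵐ[sphereMeasure c R] fun z => ∑ β ∈ s, a β * ballMono c R β z := by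
  classical
  induction s using Finset.induction_on with
  | empty => exact Lp.coeFn_zero ℂ 2 (sphereMeasure c R)
  | insert β s hβ ih =>
    rw [Finset.sum_insert hβ]
    filter_upwards [ih, coeFn_hardyClass (c := c) hR (differentiable_ballMono β).diffContOnCl,
      Lp.coeFn_smul (a β) (hardyMono c hR β : Lp ℂ 2 (sphereMeasure c R)),
      Lp.coeFn_add ((a β • hardyBasis c hR β : HardySpace c R) : Lp ℂ 2 (sphereMeasure c R))
        ((∑ β ∈ s, a β • hardyBasis c hR β : HardySpace c R) : Lp ℂ 2 (sphereMeasure c R))]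
      with z e1 e2 e3 e4
    rw [Submodule.coe_add, e4, Pi.add_apply, e1, Finset.sum_insert hβ, Submodule.coe_smul,
      hardyBasis_apply, e3, Pi.smul_apply, hardyMono, e2, smul_eq_mul]

/-- Dilation multiplies a monomial by t^|α|, and the dilated expansion converges uniformly on the
sphere. The coefficients of `f` can thus be read off from its extension inside the ball, without
boundary values. -/
theorem inner_hardyClass_dilate (hR : 0 < R) {t : ℝ} (ht0 : 0 ≤ t) (ht1 : t < 1)
    (f : HardySpace c R) {u : Cd (e + 1) → ℂ} (hu : DiffContOnCl ℂ u (ball c R))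
    (huf : ∀ z ∈ sphere c R, u z = hardyExt hR f (dilate c t z)) (α : Fin (e + 1) → ℕ) :
    inner ℂ (hardyBasis c hR α) (hardyClass hR hu) =
      (t : ℂ) ^ (∑ i, α i) * inner ℂ (hardyBasis c hR α) f := by
  classical
  have hsum := (hardyBasis c hR).hasSum_repr f
  have hnorm : ∀ z ∈ sphere c R, ‖unitCoord c R (dilate c t z)‖ ≤ t := by
    intro z hz
    have h1 : ‖unitCoord c R z‖ ≤ 1 :=
      norm_unitCoord_le hR (by simpa using sphere_subset_closedBall hz)
    rw [unitCoord_dilate, norm_smul, Complex.norm_real, Real.norm_of_nonneg ht0]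
    exact mul_le_of_le_one_right ht0 h1
  have hcl : ∀ s : Finset (Fin (e + 1) → ℕ),
      ‖(∑ β ∈ s, ((t : ℂ) ^ (∑ i, β i) * (hardyBasis c hR).repr f β) • hardyBasis c hR β) -
        hardyClass hR hu‖ ≤ √(kernelTail e t 0) *
          ‖(∑ β ∈ s, (hardyBasis c hR).repr f β • hardyBasis c hR β) - f‖ := by
    intro s
    refine norm_le_of_ae_eq hR (u := fun z => (∑ β ∈ s,
        ((t : ℂ) ^ (∑ i, β i) * (hardyBasis c hR).repr f β) * ballMono c R β z) - u z) ?_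
        (by positivity) fun z hz => ?_
    · filter_upwards [coeFn_sum_hardyBasis (c := c) hR s fun β =>
          (t : ℂ) ^ (∑ i, β i) * (hardyBasis c hR).repr f β, coeFn_hardyClass hR hu,
        Lp.coeFn_sub ((∑ β ∈ s, ((t : ℂ) ^ (∑ i, β i) * (hardyBasis c hR).repr f β) •
          hardyBasis c hR β : HardySpace c R) : Lp ℂ 2 (sphereMeasure c R))
          (hardyClass hR hu : Lp ℂ 2 (sphereMeasure c R))] with z e1 e2 e3
      rw [Submodule.coe_sub, e3, Pi.sub_apply, e1, e2]
    have hzb := dilate_mem_ball hR ht0 ht1 (sphere_subset_closedBall hz)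
    have h1 := norm_hardyExt_le_zero hR ht1 (hnorm z hz)
      ((∑ β ∈ s, (hardyBasis c hR).repr f β • hardyBasis c hR β) - f)
    rw [hardyExt_sub hR _ _ hzb, hardyExt_sum hR _ _ hzb] at h1
    convert h1 using 3
    · refine Finset.sum_congr rfl fun β _ => ?_
      rw [hardyExt_smul, hardyExt_basis, ballMono_dilate]
      ring
    · exact huf z hz
  have hsum' : HasSum (fun β => ((t : ℂ) ^ (∑ i, β i) * (hardyBasis c hR).repr f β) •
      hardyBasis c hR β) (hardyClass hR hu) := by
    have h1 := (tendsto_iff_norm_sub_tendsto_zero.1 hsum).const_mul (√(kernelTail e t 0))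
    rw [mul_zero] at h1
    exact tendsto_iff_norm_sub_tendsto_zero.2 (squeeze_zero (fun _ => norm_nonneg _) hcl h1)
  have h2 := hsum'.mapL (innerSL ℂ (hardyBasis c hR α))
  have h3 : HasSum (fun β => innerSL ℂ (hardyBasis c hR α)
      (((t : ℂ) ^ (∑ i, β i) * (hardyBasis c hR).repr f β) • hardyBasis c hR β))
      ((t : ℂ) ^ (∑ i, α i) * inner ℂ (hardyBasis c hR α) f) := by
    convert hasSum_single α ?_ using 1
    · rw [innerSL_apply_apply, inner_smul_right (E := HardySpace c R),
        orthonormal_iff_ite.1 (hardyBasis c hR).orthonormal, HilbertBasis.repr_apply_apply]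
      simp
    · intro β hβ
      rw [innerSL_apply_apply, inner_smul_right (E := HardySpace c R),
        orthonormal_iff_ite.1 (hardyBasis c hR).orthonormal]
      simp [hβ.symm]
  exact h2.unique h3

/-- The dilate by 1/2 of the difference vanishes, and its coefficients are nonzero multiples of
those of the difference. -/
theorem hardyExt_injective (hR : 0 < R) {f g : HardySpace c R}
    (h : ∀ z ∈ ball c R, hardyExt hR f z = hardyExt hR g z) : f = g := by
  have h0 : ∀ z ∈ ball c R, hardyExt hR (f - g) z = 0 := fun z hz => by
    rw [hardyExt_sub hR _ _ hz, h z hz, sub_self]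
  have hu : DiffContOnCl ℂ (fun _ : Cd (e + 1) => (0 : ℂ)) (ball c R) := diffContOnCl_const
  have hcl : hardyClass hR hu = 0 := by
    rw [← norm_le_zero_iff]
    exact norm_le_of_ae_eq hR (coeFn_hardyClass hR hu) le_rfl fun z _ => by simp
  rw [← sub_eq_zero]
  apply (hardyBasis c hR).repr.injective
  ext α
  have h1 := inner_hardyClass_dilate hR (t := 1 / 2) (by norm_num) (by norm_num) (f - g) hu
    (fun z hz => (h0 _ (dilate_mem_ball hR (by norm_num) (by norm_num)
      (sphere_subset_closedBall hz))).symm) α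
  rw [hcl, inner_zero_right] at h1
  have h2 := (mul_eq_zero.1 h1.symm).resolve_left (pow_ne_zero _ (by norm_num))
  rw [HilbertBasis.repr_apply_apply, h2]
  simp

/-- A bounded holomorphic function on the ball belongs to the Hardy space. -/
theorem exists_hardyExt_eq_of_bounded (hR : 0 < R) {g : Cd (e + 1) → ℂ}
    (hg : DifferentiableOn ℂ g (ball c R)) {M : ℝ} (hM : ∀ z ∈ ball c R, ‖g z‖ ≤ M) :
    ∃ G : HardySpace c R, ‖G‖ ≤ M ∧ ∀ z ∈ ball c R, hardyExt hR G z = g z := by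
  have hM0 : 0 ≤ M := (norm_nonneg _).trans (hM c (mem_ball_self hR))
  have hd : ∀ t : ℝ, 0 ≤ t → t < 1 → DiffContOnCl ℂ (fun z => g (dilate c t z)) (ball c R) :=
    fun t h0 h1 => hg.diffContOnCl_comp_dilate hR h0 h1
  have hcoef : ∀ s t : ℝ, ∀ (hs0 : 0 ≤ s) (hs1 : s < 1) (ht0 : 0 ≤ t) (ht1 : t < 1)
      (hst0 : 0 ≤ s * t) (hst1 : s * t < 1) (α : Fin (e + 1) → ℕ),
      inner ℂ (hardyBasis c hR α) (hardyClass hR (hd (s * t) hst0 hst1)) =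
        (t : ℂ) ^ (∑ i, α i) * inner ℂ (hardyBasis c hR α) (hardyClass hR (hd s hs0 hs1)) := by
    intro s t hs0 hs1 ht0 ht1 hst0 hst1 α
    refine inner_hardyClass_dilate hR ht0 ht1 _ _ (fun z hz => ?_) α
    rw [hardyExt_hardyClass hR _ (dilate_mem_ball hR ht0 ht1 (sphere_subset_closedBall hz)),
      dilate_dilate]
  have hhalf0 : (0 : ℝ) ≤ 1 / 2 := by norm_num
  have hhalf1 : (1 / 2 : ℝ) < 1 := by norm_num
  -- Candidates for the coefficients of `g`: those of its dilate by 1/2, scaled back.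
  let a : (Fin (e + 1) → ℕ) → ℂ := fun α => 2 ^ (∑ i, α i) *
    inner ℂ (hardyBasis c hR α) (hardyClass hR (hd (1 / 2) hhalf0 hhalf1))
  have ha : ∀ (t : ℝ) (ht0 : 0 ≤ t) (ht1 : t < 1) (α : Fin (e + 1) → ℕ),
      inner ℂ (hardyBasis c hR α) (hardyClass hR (hd t ht0 ht1)) = (t : ℂ) ^ (∑ i, α i) * a α := by
    intro t ht0 ht1 α
    -- The dilate by t/2 is obtained both from the dilate by 1/2 and from the dilate by t; comparing
    -- the two expressions gives the coefficients of the latter.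
    have h1 := hcoef (1 / 2) t hhalf0 hhalf1 ht0 ht1 (by positivity) (by linarith) α
    have h2 := hcoef t (1 / 2) ht0 ht1 hhalf0 hhalf1 (by positivity) (by linarith) α
    simp only [mul_comm t (1 / 2)] at h2
    rw [h1] at h2
    have h3 : (2 : ℂ) ^ (∑ i, α i) * ((1 / 2 : ℝ) : ℂ) ^ (∑ i, α i) = 1 := by
      rw [← mul_pow]; norm_num
    simp only [a]
    linear_combination (-(inner ℂ (hardyBasis c hR α) (hardyClass hR (hd t ht0 ht1)))) * h3 -
      (2 : ℂ) ^ (∑ i, α i) * h2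
  have hnorm : ∀ (t : ℝ) (ht0 : 0 ≤ t) (ht1 : t < 1), ‖hardyClass hR (hd t ht0 ht1)‖ ≤ M :=
    fun t ht0 ht1 => norm_le_of_ae_eq hR (coeFn_hardyClass hR _) hM0 fun z hz =>
      hM _ (dilate_mem_ball hR ht0 ht1 (sphere_subset_closedBall hz))
  have hbound : ∀ s : Finset (Fin (e + 1) → ℕ), ∑ α ∈ s, ‖a α‖ ^ 2 ≤ M ^ 2 := by
    intro s
    -- Bessel's inequality for the dilates, whose norms are at most `M`, passes to the limit t → 1
    -- on finite sums.
    have hlim : Tendsto (fun t : ℝ => ∑ α ∈ s, ‖(t : ℂ) ^ (∑ i, α i) * a α‖ ^ 2) (𝓝[<] 1)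
        (𝓝 (∑ α ∈ s, ‖a α‖ ^ 2)) := by
      have hc : Continuous fun t : ℝ => ∑ α ∈ s, ‖(t : ℂ) ^ (∑ i, α i) * a α‖ ^ 2 := by fun_prop
      have := hc.tendsto 1
      simp only [Complex.ofReal_one, one_pow, one_mul] at this
      exact this.mono_left nhdsWithin_le_nhds
    refine le_of_tendsto hlim ?_
    filter_upwards [Ioo_mem_nhdsLT (show (0 : ℝ) < 1 by norm_num)] with t ht
    have h1 := (hardyBasis c hR).orthonormal.sum_inner_products_le
      (hardyClass hR (hd t ht.1.le ht.2)) (s := s)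
    simp only [ha t ht.1.le ht.2] at h1
    exact h1.trans (pow_le_pow_left₀ (norm_nonneg _) (hnorm t ht.1.le ht.2) 2)
  have hbound' : ∀ s : Finset (Fin (e + 1) → ℕ),
      ∑ α ∈ s, ‖a α‖ ^ (2 : ℝ≥0∞).toReal ≤ M ^ (2 : ℝ≥0∞).toReal := by
    intro s; simpa using hbound s
  let A : lp (fun _ : Fin (e + 1) → ℕ => ℂ) 2 := ⟨a, memℓp_gen' hbound'⟩
  refine ⟨(hardyBasis c hR).repr.symm A, ?_, fun w hw => ?_⟩
  · rw [LinearIsometryEquiv.norm_map]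
    exact lp.norm_le_of_forall_sum_le (by norm_num) hM0 hbound'
  · have hA : ∀ α, inner ℂ (hardyBasis c hR α) ((hardyBasis c hR).repr.symm A) = a α := by
      intro α
      rw [← HilbertBasis.repr_apply_apply, LinearIsometryEquiv.apply_symm_apply]
    rw [mem_ball, dist_eq_norm] at hw
    -- With t between ‖w - c‖/R and 1, the point `w` is the dilate by t of a point `z` of the ball,
    -- and g(w) is the value at `z` of the dilated function, whose extension is known.
    obtain ⟨t, ht, ht1⟩ := exists_between
      (show max (1 / 2) (‖w - c‖ / R) < 1 from max_lt (by norm_num) ((div_lt_one hR).2 hw))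
    have ht0 : 0 < t := lt_of_lt_of_le (by norm_num) ((le_max_left _ _).trans ht.le)
    have htR : ‖w - c‖ < t * R := by
      have := (le_max_right _ _).trans_lt ht
      rwa [div_lt_iff₀ hR] at this
    have htc : (t : ℂ) ≠ 0 := by exact_mod_cast ht0.ne'
    obtain ⟨z, hz, rfl⟩ : ∃ z ∈ ball c R, w = dilate c t z := by
      refine ⟨c + (t : ℂ)⁻¹ • (w - c), ?_, ?_⟩
      · rw [mem_ball, dist_eq_norm, add_sub_cancel_left, norm_smul, norm_inv, Complex.norm_real,
          Real.norm_of_nonneg ht0.le, inv_mul_lt_iff₀ ht0]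
        exact htR
      · rw [dilate, add_sub_cancel_left, smul_smul, mul_inv_cancel₀ htc, one_smul, add_sub_cancel]
    have h1 := hardyExt_hardyClass hR (hd t ht0.le ht1) hz
    rw [← h1, hardyExt, hardyExt]
    refine tsum_congr fun α => ?_
    rw [hA, ha t ht0.le ht1, ballMono_dilate]
    ring

end

/-! ### The transfer operator: norm bounds and compactness -/

noncomputable section

section Weights

variable {d : ℕ} {c : Cd d} {R : ℝ} {ι : Type*} {w : ι → Cd d → ℂ}

theorem norm_weight_le_toReal_iSup (hwsum : (∑' i, ⨆ z ∈ ball c R, ‖w i z‖ₑ) < ∞) (i : ι)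
    {z : Cd d} (hz : z ∈ ball c R) : ‖w i z‖ ≤ (⨆ z ∈ ball c R, ‖w i z‖ₑ).toReal := by
  have h1 : ‖w i z‖ₑ ≤ ⨆ z ∈ ball c R, ‖w i z‖ₑ := le_iSup₂ (f := fun z _ => ‖w i z‖ₑ) z hz
  have h2 : (⨆ z ∈ ball c R, ‖w i z‖ₑ) ≠ ∞ := ENNReal.ne_top_of_tsum_ne_top hwsum.ne i
  rw [← toReal_enorm]
  exact ENNReal.toReal_mono h2 h1

theorem summable_norm_weight (hwsum : (∑' i, ⨆ z ∈ ball c R, ‖w i z‖ₑ) < ∞) {z : Cd d}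
    (hz : z ∈ ball c R) : Summable fun i => ‖w i z‖ :=
  Summable.of_nonneg_of_le (fun _ => norm_nonneg _)
    (fun i => norm_weight_le_toReal_iSup hwsum i hz) (ENNReal.summable_toReal hwsum.ne)

theorem tsum_norm_weight_le_weightSup (hwsum : (∑' i, ⨆ z ∈ ball c R, ‖w i z‖ₑ) < ∞) {z : Cd d}
    (hz : z ∈ ball c R) : ∑' i, ‖w i z‖ ≤ weightSup c R w := by
  have h1 : (∑' i, ‖w i z‖ₑ) ≤ ⨆ z ∈ ball c R, ∑' i, ‖w i z‖ₑ :=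
    le_iSup₂ (f := fun z _ => ∑' i, ‖w i z‖ₑ) z hz
  have h2 : (⨆ z ∈ ball c R, ∑' i, ‖w i z‖ₑ) ≤ ∑' i, ⨆ z ∈ ball c R, ‖w i z‖ₑ :=
    iSup₂_le fun z hz => ENNReal.tsum_le_tsum fun i => le_iSup₂ (f := fun z _ => ‖w i z‖ₑ) z hz
  have h3 : ∑' i, ‖w i z‖ = (∑' i, ‖w i z‖ₑ).toReal := by
    rw [ENNReal.tsum_toReal_eq fun _ => enorm_ne_top]
    simp
  rw [h3]
  exact ENNReal.toReal_mono (h2.trans_lt hwsum).ne h1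

theorem weightSup_nonneg : 0 ≤ weightSup c R w := ENNReal.toReal_nonneg

theorem weightSup_pos (hwsum : (∑' i, ⨆ z ∈ ball c R, ‖w i z‖ₑ) < ∞)
    (h : ∃ i, ∃ z ∈ ball c R, w i z ≠ 0) : 0 < weightSup c R w := by
  obtain ⟨i, z, hz, hi⟩ := h
  refine (norm_pos_iff.2 hi).trans_le (le_trans ?_ (tsum_norm_weight_le_weightSup hwsum hz))
  exact (summable_norm_weight hwsum hz).le_tsum i fun _ _ => norm_nonneg _

variable {T : ι → Cd d → Cd d} {r : ℝ} {F : Cd d → ℂ} {B : ℝ}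

theorem closedBall_mul_subset_ball (hR : 0 < R) (hr1 : r < 1) :
    closedBall c (r * R) ⊆ ball c R :=
  closedBall_subset_ball (by nlinarith)

/-- Weierstrass' M-test with the majorants B sup|w_i|; this is where the suprema must be summable.
-/
theorem differentiableOn_transfer (hR : 0 < R) (hr1 : r < 1)
    (hw : ∀ i, DifferentiableOn ℂ (w i) (ball c R))
    (hwsum : (∑' i, ⨆ z ∈ ball c R, ‖w i z‖ₑ) < ∞)
    (hT : ∀ i, DifferentiableOn ℂ (T i) (ball c R))
    (hTr : ∀ i, Set.MapsTo (T i) (ball c R) (closedBall c (r * R)))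
    (hF : DifferentiableOn ℂ F (ball c R)) (hB : ∀ z ∈ closedBall c (r * R), ‖F z‖ ≤ B) :
    DifferentiableOn ℂ (fun z => ∑' i, w i z * F (T i z)) (ball c R) := by
  intro x hx
  refine DifferentiableAt.differentiableWithinAt ?_
  obtain ⟨ρ, hρ, hball⟩ := Metric.isOpen_iff.1 isOpen_ball x hx
  have hlim : TendstoUniformlyOn (fun (s : Finset ι) z => ∑ i ∈ s, w i z * F (T i z))
      (fun z => ∑' i, w i z * F (T i z)) atTop (ball x ρ) := by
    refine tendstoUniformlyOn_tsum
      ((ENNReal.summable_toReal hwsum.ne).mul_right B) fun i z hz => ?_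
    rw [norm_mul]
    exact mul_le_mul (norm_weight_le_toReal_iSup hwsum i (hball hz)) (hB _ (hTr i (hball hz)))
      (norm_nonneg _) ENNReal.toReal_nonneg
  refine hlim.differentiableAt_center hρ fun s => DifferentiableOn.mono ?_ hball
  exact DifferentiableOn.fun_sum fun i _ => (hw i).fun_mul
    (hF.comp (hT i) fun z hz => closedBall_mul_subset_ball hR hr1 (hTr i hz))

/-- Summing at a fixed point before taking the supremum yields the constant W rather than the sum of
the suprema. -/
theorem norm_transfer_le (hwsum : (∑' i, ⨆ z ∈ ball c R, ‖w i z‖ₑ) < ∞)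
    (hTr : ∀ i, Set.MapsTo (T i) (ball c R) (closedBall c (r * R)))
    (hB0 : 0 ≤ B) (hB : ∀ z ∈ closedBall c (r * R), ‖F z‖ ≤ B) {z : Cd d} (hz : z ∈ ball c R) :
    ‖∑' i, w i z * F (T i z)‖ ≤ weightSup c R w * B := by
  have hs := summable_norm_weight hwsum hz
  refine (tsum_of_norm_bounded (hs.hasSum.mul_right B) fun i => ?_).trans
    (mul_le_mul_of_nonneg_right (tsum_norm_weight_le_weightSup hwsum hz) hB0)
  rw [norm_mul]
  exact mul_le_mul_of_nonneg_left (hB _ (hTr i hz)) (norm_nonneg _)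

theorem summable_transfer (hwsum : (∑' i, ⨆ z ∈ ball c R, ‖w i z‖ₑ) < ∞)
    (hTr : ∀ i, Set.MapsTo (T i) (ball c R) (closedBall c (r * R)))
    (hB : ∀ z ∈ closedBall c (r * R), ‖F z‖ ≤ B) {z : Cd d} (hz : z ∈ ball c R) :
    Summable fun i => w i z * F (T i z) := by
  refine Summable.of_norm_bounded ((summable_norm_weight hwsum hz).mul_right B) fun i => ?_
  rw [norm_mul]
  exact mul_le_mul_of_nonneg_left (hB _ (hTr i hz)) (norm_nonneg _)

end Weights

variable {e : ℕ} {c : Cd (e + 1)} {R : ℝ}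

/-- The polynomials of degree less than `m`, as a subspace of the Hardy space. -/
def polyDegreeLT (c : Cd (e + 1)) (hR : 0 < R) (m : ℕ) : Submodule ℂ (HardySpace c R) := by
  classical
  exact Submodule.span ℂ
    ((((Finset.range m).biUnion (expts e)).image (hardyBasis c hR) : Finset (HardySpace c R)) :
      Set (HardySpace c R))

instance (hR : 0 < R) (m : ℕ) : FiniteDimensional ℂ (polyDegreeLT c hR m) := by
  unfold polyDegreeLT
  exact FiniteDimensional.span_finset ℂ _

theorem sum_range_choose_add (e m : ℕ) :
    ∑ j ∈ Finset.range m, (j + e).choose e = (m + e).choose (e + 1) := by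
  induction m with
  | zero => simp
  | succ m ih =>
    rw [Finset.sum_range_succ, ih, show m + 1 + e = m + e + 1 by omega, Nat.choose_succ_succ,
      add_comm]

theorem finrank_polyDegreeLT_le (hR : 0 < R) (m : ℕ) :
    Module.finrank ℂ (polyDegreeLT c hR m) ≤ (m + e).choose (e + 1) := by
  classical
  refine (finrank_span_finset_le_card _).trans (Finset.card_image_le.trans ?_)
  refine Finset.card_biUnion_le.trans (le_of_eq ?_)
  simp only [card_expts, sum_range_choose_add]

theorem inner_eq_zero_of_mem_orthogonal (hR : 0 < R) {m : ℕ} {f : HardySpace c R}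
    (hf : f ∈ (polyDegreeLT c hR m)ᗮ) (α : Fin (e + 1) → ℕ) (hα : ∑ i, α i < m) :
    inner ℂ (hardyBasis c hR α) f = 0 := by
  classical
  refine (Submodule.mem_orthogonal _ _).1 hf _ (Submodule.subset_span ?_)
  simp only [Finset.coe_image]
  refine ⟨α, ?_, rfl⟩
  simpa [mem_expts] using hα

/-- The transfer operator on the Hardy space, with its norm bounds. -/
theorem exists_transferOperator (hR : 0 < R) {r : ℝ} (hr1 : r < 1)
    {ι : Type*} {w : ι → Cd (e + 1) → ℂ} {T : ι → Cd (e + 1) → Cd (e + 1)}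
    (hw : ∀ i, DifferentiableOn ℂ (w i) (ball c R))
    (hwsum : (∑' i, ⨆ z ∈ ball c R, ‖w i z‖ₑ) < ∞)
    (hT : ∀ i, DifferentiableOn ℂ (T i) (ball c R))
    (hTr : ∀ i, Set.MapsTo (T i) (ball c R) (closedBall c (r * R))) :
    ∃ L : HardySpace c R →L[ℂ] HardySpace c R,
      (∀ f, ∀ z ∈ ball c R, hardyExt hR (L f) z = ∑' i, w i z * hardyExt hR f (T i z)) ∧
      ∀ m, ∀ f ∈ (polyDegreeLT c hR m)ᗮ,
        ‖L f‖ ≤ weightSup c R w * √(kernelTail e r m) * ‖f‖ := by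
  have hbd : ∀ f : HardySpace c R, ∀ z ∈ closedBall c (r * R),
      ‖hardyExt hR f z‖ ≤ √(kernelTail e r 0) * ‖f‖ := fun f z hz =>
    norm_hardyExt_le_zero hR hr1 (norm_unitCoord_le hR hz) f
  have hT' : ∀ i, ∀ z ∈ ball c R, T i z ∈ ball c R := fun i z hz =>
    closedBall_mul_subset_ball hR hr1 (hTr i hz)
  -- Any bound on the small ball is allowed here: the one with m = 0 defines the operator, and the
  -- sharper one on orthogonal complements gives its decay. Injectivity of the extension shows that
  -- both produce the same element.
  have key : ∀ (f : HardySpace c R) (B : ℝ), 0 ≤ B →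
      (∀ z ∈ closedBall c (r * R), ‖hardyExt hR f z‖ ≤ B) →
      ∃ G : HardySpace c R, ‖G‖ ≤ weightSup c R w * B ∧
        ∀ z ∈ ball c R, hardyExt hR G z = ∑' i, w i z * hardyExt hR f (T i z) :=
    fun f B hB0 hB => exists_hardyExt_eq_of_bounded hR
      (differentiableOn_transfer hR hr1 hw hwsum hT hTr (differentiableOn_hardyExt hR f) hB)
      fun z hz => norm_transfer_le hwsum hTr hB0 hB hz
  choose L hLn hL using fun f => key f _ (by positivity) (hbd f)
  have hsum : ∀ f, ∀ z ∈ ball c R, Summable fun i => w i z * hardyExt hR f (T i z) :=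
    fun f z hz => summable_transfer hwsum hTr (hbd f) hz
  let A : HardySpace c R →ₗ[ℂ] HardySpace c R :=
    { toFun := L
      map_add' := fun f g => by
        refine hardyExt_injective hR fun z hz => ?_
        rw [hardyExt_add hR _ _ hz, hL _ z hz, hL _ z hz, hL _ z hz,
          ← (hsum f z hz).tsum_add (hsum g z hz)]
        refine tsum_congr fun i => ?_
        rw [hardyExt_add hR _ _ (hT' i z hz), mul_add]
      map_smul' := fun a f => by
        refine hardyExt_injective hR fun z hz => ?_
        rw [RingHom.id_apply, hardyExt_smul, hL _ z hz, hL _ z hz, ← tsum_mul_left]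
        refine tsum_congr fun i => ?_
        rw [hardyExt_smul]
        ring }
  refine ⟨A.mkContinuous (weightSup c R w * √(kernelTail e r 0)) fun f => ?_, hL, ?_⟩
  · rw [mul_assoc]; exact hLn f
  · intro m f hf
    obtain ⟨G, hG, hGz⟩ := key f (√(kernelTail e r m) * ‖f‖) (by positivity) fun z hz =>
      norm_hardyExt_le hR hr1 (norm_unitCoord_le hR hz) m f (inner_eq_zero_of_mem_orthogonal hR hf)
    have : G = L f := hardyExt_injective hR fun z hz => by rw [hGz z hz, hL f z hz]
    rw [mul_assoc]
    change ‖L f‖ ≤ _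
    rw [← this]
    exact hG

/-- An operator that is small on the orthogonal complements of finite-dimensional spaces is
compact. -/
theorem isCompactOperator_of_norm_le_on_orthogonal {𝕜 E : Type*} [RCLike 𝕜]
    [NormedAddCommGroup E] [InnerProductSpace 𝕜 E] [CompleteSpace E] (L : E →L[𝕜] E)
    (Q : ℕ → Submodule 𝕜 E) [∀ m, FiniteDimensional 𝕜 (Q m)] (s : ℕ → ℝ) (hs0 : ∀ m, 0 ≤ s m)
    (hs : Tendsto s atTop (𝓝 0)) (h : ∀ m, ∀ f ∈ (Q m)ᗮ, ‖L f‖ ≤ s m * ‖f‖) :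
    IsCompactOperator L := by
  -- Composing `L` with the projection onto `Q m` gives a compact operator, and the error is `L` on
  -- the complement, of norm at most `s m`.
  refine isCompactOperator_of_tendsto (l := atTop)
    (F := fun m => L ∘L (Q m).subtypeL ∘L (Q m).orthogonalProjectionOnto) ?_
    (Eventually.of_forall fun m => ?_)
  · rw [tendsto_iff_norm_sub_tendsto_zero]
    refine squeeze_zero (fun _ => norm_nonneg _) (fun m => ?_) hs
    rw [norm_sub_rev]
    refine ContinuousLinearMap.opNorm_le_bound _ (hs0 m) fun f => ?_
    have h1 := h m _ ((Q m).sub_starProjection_mem_orthogonal f)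
    rw [map_sub] at h1
    refine h1.trans (mul_le_mul_of_nonneg_left ?_ (hs0 m))
    rw [← (Q m).starProjection_orthogonal_val]
    exact (Q m)ᗮ.norm_starProjection_apply_le f
  · have : ProperSpace (Q m) := FiniteDimensional.proper 𝕜 (Q m)
    exact (isCompactOperator_of_locallyCompactSpace_dom
      (Q m).orthogonalProjectionOnto).clm_comp (L ∘L (Q m).subtypeL)

end

/-! ### The main theorem -/

theorem theorem1 {d : ℕ} (hd : 1 ≤ d) {ι : Type*} [Countable ι]
    (c : Cd d) (R : ℝ) (hR : 0 < R) (r : ℝ) (hr0 : 0 < r) (hr1 : r < 1)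
    (w : ι → Cd d → ℂ) (T : ι → Cd d → Cd d)
    (hw : ∀ i, DifferentiableOn ℂ (w i) (ball c R))
    (hwsum : (∑' i, ⨆ z ∈ ball c R, ‖w i z‖ₑ) < ∞)
    (hT : ∀ i, DifferentiableOn ℂ (T i) (ball c R))
    (hTr : ∀ i, Set.MapsTo (T i) (ball c R) (closedBall c (r * R))) :
    ∃ L : HardySpace c R →L[ℂ] HardySpace c R,
      IsTransferOperator c R w T L ∧
      (∀ L' : HardySpace c R → HardySpace c R, IsTransferOperator c R w T L' → L' = L) ∧
      IsCompactOperator L ∧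
      (∃ ev : ℕ → ℂ, IsEigenvalueSequence (L : Module.End ℂ (HardySpace c R)) ev) ∧
      ∀ ev : ℕ → ℂ, IsEigenvalueSequence (L : Module.End ℂ (HardySpace c R)) ev →
        ∀ n : ℕ, 1 ≤ n →
          ‖ev (n - 1)‖ ≤ eigenvalueBound d (weightSup c R w) r n ∧
          ((∃ i, ∃ z ∈ ball c R, w i z ≠ 0) →
            ‖ev (n - 1)‖ < eigenvalueBound d (weightSup c R w) r n) ∧
          (d = 1 →
            ‖ev (n - 1)‖ ≤ weightSup c R w / √(1 - r ^ 2) * r ^ (((n : ℝ) - 1) / 2)) := by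
  obtain ⟨e, rfl⟩ : ∃ e, d = e + 1 := ⟨d - 1, by omega⟩
  obtain ⟨L, hL, hLb⟩ := exists_transferOperator hR hr1 hw hwsum hT hTr
  have hT' : ∀ i, ∀ z ∈ ball c R, T i z ∈ ball c R := fun i z hz =>
    closedBall_mul_subset_ball hR hr1 (hTr i hz)
  have hW : 0 ≤ weightSup c R w := weightSup_nonneg
  have hs0 := fun k => approxBound_nonneg (e := e) (r := r) hW k
  have hs := tendsto_approxBound e (weightSup c R w) r
  -- The k-th subspace consists of the polynomials of degree below `degreeBelow e k`, the largest
  -- degree bound for which the dimension is at most `k`.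
  have hweyl : HasWeylBound (L : Module.End ℂ (HardySpace c R))
      (approxBound e (weightSup c R w) r) :=
    hasWeylBound_of_norm_le _ (fun k => polyDegreeLT c hR (degreeBelow e k))
      (fun k => (finrank_polyDegreeLT_le hR _).trans (choose_degreeBelow_le e k)) _
      fun k f hf => hLb _ f hf
  refine ⟨L, fun f => ⟨⟨hardyExt hR f, isHolomorphicExtension_hardyExt hR f fun _ _ => rfl⟩,
    fun F hF => ?_⟩, fun L' hL' => ?_, ?_, hweyl.exists_isEigenvalueSequence hs0 hs,
    fun ev hev n hn => ?_⟩
  · refine isHolomorphicExtension_hardyExt hR _ fun z hz => ?_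
    rw [hL f z hz]
    exact tsum_congr fun i => by
      rw [eq_hardyExt_of_isHolomorphicExtension hR hF (hT' i z hz)]
  · funext f
    refine hardyExt_injective hR fun z hz => ?_
    rw [hL f z hz]
    -- Uniqueness: the prescribed formula determines the extension of the image, and the extension
    -- determines the element.
    exact (eq_hardyExt_of_isHolomorphicExtension hR ((hL' f).2 _
      (isHolomorphicExtension_hardyExt hR f fun _ _ => rfl)) hz).symm
  · exact isCompactOperator_of_norm_le_on_orthogonal L (polyDegreeLT c hR) _
      (fun m => mul_nonneg hW (Real.sqrt_nonneg _)) (tendsto_sqrt_kernelTail e r _) hLb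
  -- The list starts at index 0, so λ_n is `ev (n - 1)` and the exponent `n - 1 + 1` is `n`.
  · have h := hweyl.norm_pow_le_prod hs0 (approxBound_antitone hW hr0.le hr1) hs hev (n - 1)
    rw [Nat.sub_add_cancel hn] at h
    refine ⟨le_eigenvalueBound hW hr0 hr1 hn (norm_nonneg _) h,
      fun hex => lt_eigenvalueBound (weightSup_pos hwsum hex) hr0 hr1 hn h, fun h1 => ?_⟩
    obtain rfl : e = 0 := by omega
    exact le_of_pow_le_prod_approxBound_zero hW hr0 hr1 hn h
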